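/- Let $K$ be a totally real number field with ring of integers $\mathcal O_K$, and let $\mathcal A=\left(\frac{a,b}{K}\right)$ ($a,b\in K^\times$) be a definite quaternion algebra over $K$, i.e. its reduced norm $\mathrm{nrd}$ takes a totally positive value at every nonzero element. Orders are $\mathcal O_K$-orders in $\mathcal A$. For an order $\mathcal G$ put $\mathcal G^1:=\{\mathbf u\in\mathcal G\mid \mathrm{nrd}(\mathbf u)=1\}$ and $r_{\mathcal G}(\alpha):=\#\{\mathbf q\in\mathcal G\mid \mathrm{nrd}(\mathbf q)=\alpha\}$. The class number of $\mathcal G$ is the number of classes of $\mathcal O_K$-lattices $L\subset\mathcal A$ with right order $\{\mathbf x\in\mathcal A\mid L\mathbf x\subseteq L\}=\mathcal G$, under the equivalence $L\sim \mathbf xL$ for $\mathbf x\in\mathcal A^\times$. Let $\mathcal H$ be a maximal order whose reduced discriminant $\mathfrak D$ (the ideal whose square is generated by all $\det(\mathrm{trd}(\mathbf x_i\mathbf x_j))_{i,j=1}^4$ with $\mathbf x_1,\dots,\mathbf x_4\in\mathcal H$) factors into prime ideals as $\mathfrak D=\mathfrak p_1\cdots\mathfrak p_k$. Let $\mathcal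 G\subseteq\mathcal H$ be an order of class number $1$ that is perceptive in $\mathcal H$, i.e. for every $\mathbf q\in\mathcal H$ there is $\mathbf u\in\mathcal H^1$ with $\mathbf u\mathbf q\in\mathcal G$. Suppose that $\mathcal G$ is of the kind $\mathfrak q_1\mathfrak q_2$, i.e. the $\mathcal O_K$-index $[\mathcal H:\mathcal G]_{\mathcal O_K}$ (the ideal generated by $\det\delta$ for all $K$-linear $\delta:\mathcal A\to\mathcal A$ with $\delta(\mathcal H)\subseteq\mathcal G$) equals $\mathfrak q_1\mathfrak q_2$ for two distinct nonzero prime ideals $\mathfrak q_1,\mathfrak q_2$ of $\mathcal O_K$ not dividing $\mathfrak D$. Then for every totally positive $\alpha\in\mathcal O_K$, the quantities $\#\mathcal G^1$ and $r_{\mathcal G}(\alpha)$ are finite and $$\begin{aligned} r_{\mathcal G}(\alpha) ={}& 4\,\#\mathcal G^1\sum_{\mathfrak p_1,\dots,\mathfrak p_k\nmid\delta\mathcal O_K\mid\alpha\mathcal O_K}\mathrm{Nm}(\delta\mathcal O_K) - 2\,\#\mathcal G^1\sum_{\mathfrak q_1,\mathfrak p_1,\dots,\mathfrak p_k\nmid\delta\mathcal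 O_K\mid\alpha\mathcal O_K}\mathrm{Nm}(\delta\mathcal O_K)\\ &- 2\,\#\mathcal G^1\sum_{\mathfrak q_2,\mathfrak p_1,\dots,\mathfrak p_k\nmid\delta\mathcal O_K\mid\alpha\mathcal O_K}\mathrm{Nm}(\delta\mathcal O_K) + \#\mathcal G^1\sum_{\mathfrak q_1,\mathfrak q_2,\mathfrak p_1,\dots,\mathfrak p_k\nmid\delta\mathcal O_K\mid\alpha\mathcal O_K}\mathrm{Nm}(\delta\mathcal O_K)\\ ={}& 4\,\#\mathcal G^1\,\sigma_{\mathfrak D}(\alpha)-2\,\#\mathcal G^1\,\sigma_{\mathfrak q_1\mathfrak D}(\alpha)-2\,\#\mathcal G^1\,\sigma_{\mathfrak q_2\mathfrak D}(\alpha)+\#\mathcal G^1\,\sigma_{\mathfrak q_1\mathfrak q_2\mathfrak D}(\alpha). \end{aligned}$$ Here each sum runs over the principal ideals $\delta\mathcal O_K$ that divide $\alpha\mathcal O_K$ and are divisible by none of the listed primes, and $\sigma_{\mathfrak E}(\alpha)$, for a nonzero ideal $\mathfrak E$ of $\mathcal O_K$, is the sum of $\mathrm{Nm}(\delta\mathcal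 O_K)$ over the principal ideals $\delta\mathcal O_K$ that divide $\alpha\mathcal O_K$ and are not divisible by any prime factor of $\mathfrak E$. -/

import Mathlib

open scoped NumberField

noncomputable section

namespace QuatRep

/-- The quaternion algebra `(a, b / K)`, with `i ^ 2 = a`, `j ^ 2 = b`, `k = i j = - j i`. -/
abbrev QuatAlg (K : Type*) [Field K] (a b : K) : Type _ := QuaternionAlgebra K a 0 b

section Algebra

variable {K : Type*} [Field K] {a b : K}

/-- The reduced norm `x * conj x`, an element of `K`; here `star` is the standard involution. -/
def nrd (x : QuatAlg K a b) : K := (x * star x).re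

/-- The reduced trace `x + conj x`, an element of `K`. -/
def trd (x : QuatAlg K a b) : K := (x + star x).re

theorem coe_nrd (x : QuatAlg K a b) : algebraMap K (QuatAlg K a b) (nrd x) = x * star x :=
  (QuaternionAlgebra.mul_star_eq_coe x).symm

theorem coe_trd (x : QuatAlg K a b) : algebraMap K (QuatAlg K a b) (trd x) = x + star x := by
  ext <;> simp [trd]

theorem nrd_eq (x : QuatAlg K a b) :
    nrd x = x.re ^ 2 - a * x.imI ^ 2 - b * x.imJ ^ 2 + a * b * x.imK ^ 2 := by
  simp [nrd]; ring

end Algebra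

/-- `x` is positive under every real embedding of `K` (used for totally real `K`). -/
def TotallyPositive {K : Type*} [Field K] (x : K) : Prop := ∀ φ : K →+* ℝ, 0 < φ x

/-- The quaternion algebra `(a, b / K)` over a totally real field `K` is definite
(that is, ramified at every infinite place): its norm form is totally positive definite. -/
def IsDefinite {K : Type*} [Field K] (a b : K) : Prop :=
  ∀ x : QuatAlg K a b, x ≠ 0 → TotallyPositive (nrd x)

variable {K : Type*} [Field K] {a b : K}

/-- An `𝓞 K`-order: a subring containing `𝓞 K` that is a finitely generated `𝓞 K`-module
spanning the quaternion algebra over `K`. -/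
def IsQuatOrder (H : Subalgebra (𝓞 K) (QuatAlg K a b)) : Prop :=
  Submodule.IsLattice K (Subalgebra.toSubmodule H)

/-- An order that is maximal with respect to inclusion among all orders. -/
def IsMaximalOrder (H : Subalgebra (𝓞 K) (QuatAlg K a b)) : Prop :=
  IsQuatOrder H ∧ ∀ H' : Subalgebra (𝓞 K) (QuatAlg K a b), IsQuatOrder H' → H ≤ H' → H' = H

/-- The elements of reduced norm `c` in `G`. -/
def elementsOfNorm (G : Subalgebra (𝓞 K) (QuatAlg K a b)) (c : K) : Set (QuatAlg K a b) :=
  {x | x ∈ G ∧ nrd x = c}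

/-- `G ^ 1`, the elements of reduced norm `1`. -/
def normOne (G : Subalgebra (𝓞 K) (QuatAlg K a b)) : Set (QuatAlg K a b) := elementsOfNorm G 1

/-- `r_G(α)`, the number of elements of reduced norm `α` in `G`. -/
def repCount (G : Subalgebra (𝓞 K) (QuatAlg K a b)) (α : 𝓞 K) : ℕ :=
  (elementsOfNorm G (α : K)).ncard

/-- `G ⊆ H`, and every orbit `H ^ 1 q` with `q ∈ H` meets `G`. -/
def IsPerceptive (G H : Subalgebra (𝓞 K) (QuatAlg K a b)) : Prop :=
  G ≤ H ∧ ∀ q ∈ H, ∃ u ∈ normOne H, u * q ∈ G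

/-- The right order `{x | L x ⊆ L}`. -/
def rightOrder (L : Submodule (𝓞 K) (QuatAlg K a b)) : Subalgebra (𝓞 K) (QuatAlg K a b) where
  carrier := {x | ∀ y ∈ L, y * x ∈ L}
  mul_mem' {x z} hx hz := fun y hy => by
    rw [← mul_assoc]; exact hz _ (hx y hy)
  add_mem' {x z} hx hz := fun y hy => by
    rw [mul_add]; exact L.add_mem (hx y hy) (hz y hy)
  algebraMap_mem' r := fun y hy => by
    rw [← Algebra.commutes, ← Algebra.smul_def]; exact L.smul_mem r hy

/-- The lattices in the quaternion algebra whose right order is `G`. -/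
def LatticeWithRightOrder (G : Subalgebra (𝓞 K) (QuatAlg K a b)) : Type _ :=
  {L : Submodule (𝓞 K) (QuatAlg K a b) // Submodule.IsLattice K L ∧ rightOrder L = G}

/-- `L ~ M` if `L = x M` for some invertible `x` in the quaternion algebra. -/
def rightEquivalent (G : Subalgebra (𝓞 K) (QuatAlg K a b)) : Setoid (LatticeWithRightOrder G) where
  r L M := ∃ x : (QuatAlg K a b)ˣ,
    (L.1 : Set (QuatAlg K a b)) = (fun y => (x : QuatAlg K a b) * y) '' (M.1 : Set (QuatAlg K a b))
  iseqv :=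
    { refl := fun L => ⟨1, by simp⟩
      symm := fun {L M} ⟨x, hx⟩ => ⟨x⁻¹, by rw [hx, Set.image_image]; simp⟩
      trans := fun {L M N} ⟨x, hx⟩ ⟨y, hy⟩ => ⟨x * y, by
        rw [hx, hy, Set.image_image]; simp [mul_assoc]⟩ }

/-- The (right) class number: the number of classes `[L]` of lattices `L` with right order `G`. -/
def classNumber (G : Subalgebra (𝓞 K) (QuatAlg K a b)) : ℕ := Nat.card (Quotient (rightEquivalent G))

/-- The `𝓞 K`-index `[L : M]`, as an `𝓞 K`-submodule of `K`: it is generated by the determinants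
of the `K`-linear endomorphisms `δ` with `δ(L) ⊆ M`. -/
def latticeIndex (L M : Submodule (𝓞 K) (QuatAlg K a b)) : Submodule (𝓞 K) K :=
  Submodule.span (𝓞 K)
    {c | ∃ δ : QuatAlg K a b →ₗ[K] QuatAlg K a b, (∀ x ∈ L, δ x ∈ M) ∧ LinearMap.det δ = c}

/-- The discriminant of `L`, as an `𝓞 K`-submodule of `K`: it is generated by the
`det (trd (x_i x_j))` for `x_1, …, x_4` in `L`. -/
def discriminant (L : Submodule (𝓞 K) (QuatAlg K a b)) : Submodule (𝓞 K) K :=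
  Submodule.span (𝓞 K)
    {c | ∃ x : Fin 4 → QuatAlg K a b, (∀ i, x i ∈ L) ∧
      (Matrix.of fun i j => trd (x i * x j)).det = c}

/-- The ideal `𝔇` is the reduced discriminant of `H`: the ideal whose square is the
discriminant. -/
def IsReducedDiscriminant (H : Subalgebra (𝓞 K) (QuatAlg K a b)) (𝔇 : Ideal (𝓞 K)) : Prop :=
  IsLocalization.coeSubmodule K (𝔇 ^ 2) = discriminant (Subalgebra.toSubmodule H)

/-- The suborder `G` of `H` is of the kind `𝔮₁𝔮₂`, where `𝔇` is the reduced discriminant of `H`: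
the index `[H : G]` is the product of two distinct nonzero prime ideals that do not divide `𝔇`. -/
structure IsOfKindQQ (G H : Subalgebra (𝓞 K) (QuatAlg K a b)) (𝔇 𝔮₁ 𝔮₂ : Ideal (𝓞 K)) :
    Prop where
  prime₁ : Prime 𝔮₁
  prime₂ : Prime 𝔮₂
  ne : 𝔮₁ ≠ 𝔮₂
  index_eq : latticeIndex (Subalgebra.toSubmodule H) (Subalgebra.toSubmodule G) =
    IsLocalization.coeSubmodule K (𝔮₁ * 𝔮₂)
  not_dvd₁ : ¬ 𝔮₁ ∣ 𝔇
  not_dvd₂ : ¬ 𝔮₂ ∣ 𝔇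

/-- The sum of `Nm(δ)` over the principal ideals `(δ)` that divide `(α)` and are not divided
by any ideal in `S`. For `α ≠ 0` this is a finite sum. -/
def divisorSum {K : Type*} [Field K] [NumberField K] (S : Set (Ideal (𝓞 K))) (α : 𝓞 K) : ℕ :=
  ∑ᶠ I ∈ {I : Ideal (𝓞 K) | (∃ δ : 𝓞 K, I = Ideal.span {δ}) ∧ I ∣ Ideal.span {α} ∧
    ∀ 𝔭 ∈ S, ¬ 𝔭 ∣ I}, Ideal.absNorm I

/-- `σ_𝔇(α)`: the sum of the norms of the principal ideals that divide `(α)` and are not divided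
by any prime factor of `𝔇`. -/
def sigma {K : Type*} [Field K] [NumberField K] (𝔇 : Ideal (𝓞 K)) (α : 𝓞 K) : ℕ := divisorSum {𝔭 | Prime 𝔭 ∧ 𝔭 ∣ 𝔇} α

end QuatRep

end

/-! The count in $\mathcal G$ is reduced to the count in $\mathcal H$, which is a Hecke-type
recurrence. Class number one of $\mathcal G$ makes enough one-sided ideals of $\mathcal H$
principal. If a right ideal $I$ of $\mathcal H$ is generated by $y$ locally at $\mathfrak
m=\mathfrak q_1\mathfrak q_2$, then $y\mathcal G+\mathfrak mI$ has right order $\mathcal G$, hence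
equals $s\mathcal G$, and $I=s\mathcal H$ (`exists_generator_of_local_generator`). So every prime of
$K$ is generated by a reduced norm. Consequently every nonzero ideal has a totally positive
generator, units realise all signs, and totally positive units are squares (`exists_eq_sq_mul`);
generators can therefore be scaled to a prescribed norm. At $\mathfrak p\mid\mathfrak D$ the
elements with norm in $\mathfrak p$ are the multiples of one element. At $\mathfrak
p=(\pi)\nmid\mathfrak D$, $\mathcal H/\mathfrak p\mathcal H$ is a $2\times2$ matrix algebra
(`exists_matrixUnits`), and counting pairs (element of norm $\pi n$, line that it kills) gives
`card_recurrence`. The divisor sums obey the same recurrences, so $r_{\mathcal H}(\alpha)=\#\mathcal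
H^1\sigma_{\mathfrak D}(\alpha)$ (`ncard_fiber`). Perceptivity and the index force $\mathcal G$ to
consist of the elements of $\mathcal H$ that stabilise a line $\langle v_i\rangle$ modulo each
$\mathfrak q_i$ (`exists_eq_stabilizer`, `mem_iff_of_splittings`), and perceptivity makes $\mathcal
H^1$ transitive on pairs of lines. For fixed $q$, the $u\in\mathcal H^1$ with $uq\in\mathcal G$
number $\#\mathcal G^1$, times $\mathrm{Nm}\,\mathfrak q_i+1$ for each $i$ with $qv_i=0$. Summing
over $q$ of norm $\alpha$ (`ncard_mul_ncard_eq`) expresses $\#\mathcal H^1\,r_{\mathcal G}(\alpha)$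
through $r_{\mathcal H}$ at $\alpha$, $\alpha/\pi_1$, $\alpha/\pi_2$ and $\alpha/\pi_1\pi_2$;
rewriting these by inclusion–exclusion gives the coefficients $4,-2,-2,1$. -/

noncomputable section

/-! ### Standard involutions: trace, norm, and their behaviour modulo a prime -/

/-- A standard involution on an `R`-algebra, with its reduced trace and norm. -/
structure StdInvolution (R H : Type*) [CommRing R] [Ring H] [Algebra R H] where
  conj : H →ₗ[R] H
  T : H →ₗ[R] R
  N : H →* R
  inj : Function.Injective (algebraMap R H)
  conj_mul : ∀ x y, conj (x * y) = conj y * conj x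
  add_conj : ∀ x, x + conj x = algebraMap R H (T x)
  mul_conj : ∀ x, x * conj x = algebraMap R H (N x)

namespace StdInvolution

section Basic

variable {R H : Type*} [CommRing R] [Ring H] [Algebra R H] (S : StdInvolution R H)

theorem conj_eq (x : H) : S.conj x = algebraMap R H (S.T x) - x := by
  rw [← S.add_conj]; abel

theorem conj_one : S.conj 1 = 1 := by
  have := S.mul_conj 1
  simpa using this

theorem conj_algebraMap (r : R) : S.conj (algebraMap R H r) = algebraMap R H r := by
  rw [Algebra.algebraMap_eq_smul_one, map_smul, conj_one]

theorem conj_conj (x : H) : S.conj (S.conj x) = x := by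
  rw [S.conj_eq x, map_sub, conj_algebraMap, S.conj_eq x]; abel

theorem T_conj (x : H) : S.T (S.conj x) = S.T x := by
  apply S.inj
  rw [← S.add_conj, S.conj_conj, ← S.add_conj, add_comm]

theorem conj_mul_self (x : H) : S.conj x * x = algebraMap R H (S.N x) := by
  rw [← S.mul_conj, S.conj_eq, sub_mul, mul_sub, Algebra.commutes]

theorem N_conj (x : H) : S.N (S.conj x) = S.N x := by
  apply S.inj
  rw [← S.mul_conj, S.conj_conj, S.conj_mul_self]

theorem N_algebraMap (r : R) : S.N (algebraMap R H r) = r ^ 2 := by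
  apply S.inj
  rw [← S.mul_conj, S.conj_algebraMap, pow_two, map_mul]

theorem N_smul (r : R) (x : H) : S.N (r • x) = r ^ 2 * S.N x := by
  rw [Algebra.smul_def, map_mul, N_algebraMap]

theorem T_algebraMap (r : R) : S.T (algebraMap R H r) = 2 * r := by
  apply S.inj
  rw [← S.add_conj, S.conj_algebraMap, two_mul, map_add]

theorem T_one : S.T 1 = 2 := by simpa using S.T_algebraMap 1

theorem T_mul_comm (x y : H) : S.T (x * y) = S.T (y * x) := by
  apply S.inj
  rw [← S.add_conj, ← S.add_conj, S.conj_mul, S.conj_mul, S.conj_eq x, S.conj_eq y]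
  have h1 := Algebra.commutes (S.T x) y
  have h2 := Algebra.commutes (S.T y) x
  have h3 := Algebra.commutes (S.T x) (algebraMap R H (S.T y))
  rw [sub_mul, sub_mul, mul_sub, mul_sub, mul_sub, mul_sub, h1, h2, h3]
  abel

theorem N_add (x y : H) : S.N (x + y) = S.N x + S.N y + S.T (x * S.conj y) := by
  apply S.inj
  rw [map_add (algebraMap R H), map_add (algebraMap R H), ← S.mul_conj, ← S.mul_conj,
    ← S.mul_conj, ← S.add_conj, S.conj_mul, S.conj_conj, map_add, add_mul, mul_add, mul_add]
  abel

theorem mul_self (x : H) : x * x = S.T x • x - algebraMap R H (S.N x) := by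
  rw [← S.mul_conj, S.conj_eq, mul_sub, ← Algebra.commutes, Algebra.smul_def]
  abel

end Basic

section Prime

variable {R H : Type*} [CommRing R] [Ring H] [Algebra R H] (S : StdInvolution R H)
  {𝔭 : Ideal R}

theorem mul_mem_smul_top {x : H} (h : H) (hx : x ∈ 𝔭 • (⊤ : Submodule R H)) :
    h * x ∈ 𝔭 • (⊤ : Submodule R H) := by
  refine Submodule.smul_induction_on hx (fun r hr n _ => ?_) (fun a b ha hb => ?_)
  · rw [mul_smul_comm]; exact Submodule.smul_mem_smul hr trivial
  · rw [mul_add]; exact add_mem ha hb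

theorem smul_top_mul_mem {x : H} (h : H) (hx : x ∈ 𝔭 • (⊤ : Submodule R H)) :
    x * h ∈ 𝔭 • (⊤ : Submodule R H) := by
  refine Submodule.smul_induction_on hx (fun r hr n _ => ?_) (fun a b ha hb => ?_)
  · rw [smul_mul_assoc]; exact Submodule.smul_mem_smul hr trivial
  · rw [add_mul]; exact add_mem ha hb

theorem algebraMap_mem_smul_top {r : R} (hr : r ∈ 𝔭) :
    algebraMap R H r ∈ 𝔭 • (⊤ : Submodule R H) := by
  rw [Algebra.algebraMap_eq_smul_one]; exact Submodule.smul_mem_smul hr trivial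

theorem T_mem_of_mem {x : H} (hx : x ∈ 𝔭 • (⊤ : Submodule R H)) : S.T x ∈ 𝔭 := by
  refine Submodule.smul_induction_on hx (fun r hr n _ => ?_) (fun a b ha hb => ?_)
  · rw [map_smul]; exact 𝔭.mul_mem_right _ hr
  · rw [map_add]; exact add_mem ha hb

theorem conj_mem_of_mem {x : H} (hx : x ∈ 𝔭 • (⊤ : Submodule R H)) :
    S.conj x ∈ 𝔭 • (⊤ : Submodule R H) := by
  rw [S.conj_eq]
  exact sub_mem (algebraMap_mem_smul_top (S.T_mem_of_mem hx)) hx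

theorem T_mul_conj_mem_sq {x y : H} (hx : x ∈ 𝔭 • (⊤ : Submodule R H))
    (hy : y ∈ 𝔭 • (⊤ : Submodule R H)) : S.T (x * S.conj y) ∈ 𝔭 ^ 2 := by
  refine Submodule.smul_induction_on hy (fun r hr n _ => ?_) (fun a b ha hb => ?_)
  · rw [map_smul, mul_smul_comm, map_smul, smul_eq_mul, pow_two]
    exact Ideal.mul_mem_mul hr (S.T_mem_of_mem (smul_top_mul_mem _ hx))
  · rw [map_add, mul_add, map_add]; exact add_mem ha hb

theorem N_mem_sq_of_mem {x : H} (hx : x ∈ 𝔭 • (⊤ : Submodule R H)) : S.N x ∈ 𝔭 ^ 2 := by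
  suffices x ∈ 𝔭 • (⊤ : Submodule R H) ∧ S.N x ∈ 𝔭 ^ 2 from this.2
  refine Submodule.smul_induction_on hx (fun r hr n _ => ⟨Submodule.smul_mem_smul hr trivial, ?_⟩)
    (fun a b ha hb => ⟨add_mem ha.1 hb.1, ?_⟩)
  · rw [S.N_smul]; exact Ideal.mul_mem_right _ _ (Ideal.pow_mem_pow hr 2)
  · rw [S.N_add]; exact add_mem (add_mem ha.2 hb.2) (S.T_mul_conj_mem_sq ha.1 hb.1)

theorem N_mem_of_mem {x : H} (hx : x ∈ 𝔭 • (⊤ : Submodule R H)) : S.N x ∈ 𝔭 :=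
  Ideal.pow_le_self two_ne_zero (S.N_mem_sq_of_mem hx)

end Prime
end StdInvolution

/-! ### Isotropic elements and matrix units modulo a prime -/

namespace StdInvolution

variable {R H : Type*} [CommRing R] [Ring H] [Algebra R H]

/-- A noncommutative order is not generated by `1` and one further element modulo `𝔭`. -/
theorem not_two_generated [IsDomain R] [Module.Finite R H] [Module.IsTorsionFree R H]
    {𝔭 : Ideal R} (h𝔭 : 𝔭 ≠ ⊤) (hnc : ∃ x y : H, x * y ≠ y * x) (s : H) :
    ∃ x : H, ∀ a b : R, x - (algebraMap R H a + b • s) ∉ 𝔭 • (⊤ : Submodule R H) := by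
  by_contra! hs
  obtain ⟨x, y, hxy⟩ := hnc
  set N : Submodule R H := Submodule.span R {1, s} with hN
  have hle : (⊤ : Submodule R H) ≤ N ⊔ 𝔭 • (⊤ : Submodule R H) := by
    intro z _
    obtain ⟨a, b, hab⟩ := hs z
    rw [Submodule.mem_sup]
    refine ⟨_, ?_, _, hab, add_sub_cancel _ _⟩
    exact Submodule.mem_span_pair.2 ⟨a, b, by rw [Algebra.algebraMap_eq_smul_one]⟩
  -- Nakayama: some $r\equiv1$ modulo `𝔭` carries all of `H` into the span of $1$ and $s$, whose
  -- elements commute. Hence $r^2(xy-yx)=0$.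
  obtain ⟨r, hr, hrN⟩ := Submodule.exists_sub_one_mem_and_smul_le_of_fg_of_le_sup
    (Module.Finite.fg_top (R := R) (M := H)) le_rfl hle
  have hr0 : r ≠ 0 := by
    rintro rfl
    apply h𝔭
    rw [Ideal.eq_top_iff_one]
    simpa using hr
  have key : ∀ z : H, ∃ a b : R, a • (1 : H) + b • s = r • z := fun z =>
    Submodule.mem_span_pair.1 (hrN (Submodule.smul_mem_pointwise_smul z r ⊤ trivial))
  obtain ⟨a, b, h1⟩ := key x
  obtain ⟨c, d, h2⟩ := key y
  apply hxy
  have h3 : (r * r) • (x * y) = (r * r) • (y * x) := by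
    rw [← smul_mul_smul_comm, ← smul_mul_smul_comm, ← h1, ← h2]
    simp only [add_mul, mul_add, smul_mul_assoc, mul_smul_comm, one_mul, mul_one, smul_add, smul_smul]
    rw [mul_comm c a, mul_comm c b, mul_comm d a, mul_comm d b]
    abel
  exact smul_right_injective H (mul_ne_zero hr0 hr0) h3

variable (S : StdInvolution R H)

/-- The extension `𝔭H` as a two-sided ideal. -/
def extIdeal (H : Type*) [Ring H] [Algebra R H] (𝔭 : Ideal R) : Ideal H where
  carrier := {x | x ∈ 𝔭 • (⊤ : Submodule R H)}
  add_mem' := fun ha hb => (𝔭 • (⊤ : Submodule R H)).add_mem ha hb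
  zero_mem' := (𝔭 • (⊤ : Submodule R H)).zero_mem
  smul_mem' h _ hx := mul_mem_smul_top h hx

instance (𝔭 : Ideal R) : (extIdeal H 𝔭).IsTwoSided := 
  ⟨fun b ha => smul_top_mul_mem (𝔭 := 𝔭) b ha⟩

theorem mem_extIdeal {𝔭 : Ideal R} {x : H} : x ∈ extIdeal H 𝔭 ↔ x ∈ 𝔭 • (⊤ : Submodule R H) :=
  Iff.rfl

theorem finite_quotient_extIdeal [Module.Finite R H] (𝔭 : Ideal R) [Finite (R ⧸ 𝔭)] :
    Finite (H ⧸ extIdeal H 𝔭) := by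
  have : Finite (H ⧸ 𝔭 • (⊤ : Submodule R H)) := Module.finite_of_finite (R ⧸ 𝔭)
  refine Finite.of_surjective
    (fun z : H ⧸ 𝔭 • (⊤ : Submodule R H) => Ideal.Quotient.mk (extIdeal H 𝔭) z.out) fun y => ?_
  obtain ⟨x, rfl⟩ := Ideal.Quotient.mk_surjective y
  refine ⟨Submodule.Quotient.mk x, ?_⟩
  rw [Ideal.Quotient.eq, mem_extIdeal, ← Submodule.Quotient.eq]
  exact Quotient.out_eq' _

/-- Modulo every nonzero prime there is a nonzero element of reduced norm zero. -/
theorem exists_isotropic [IsDomain R] [Module.Finite R H] [Module.IsTorsionFree R H]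
    {𝔭 : Ideal R} (h𝔭 : 𝔭.IsMaximal) [Finite (R ⧸ 𝔭)] (hnc : ∃ x y : H, x * y ≠ y * x) :
    ∃ e : H, e ∉ 𝔭 • (⊤ : Submodule R H) ∧ S.N e ∈ 𝔭 := by
  by_contra! hcon
  have hfin := finite_quotient_extIdeal (H := H) 𝔭
  let q := Ideal.Quotient.mk (extIdeal H 𝔭)
  have hq : ∀ x, q x = 0 ↔ x ∈ 𝔭 • (⊤ : Submodule R H) := fun x => by
    rw [← mem_extIdeal]; exact Ideal.Quotient.eq_zero_iff_mem
  have hone : (1 : H) ∉ 𝔭 • (⊤ : Submodule R H) := by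
    intro h
    obtain ⟨x, hx⟩ := not_two_generated h𝔭.ne_top hnc (0 : H)
    apply hx 0 0
    have := smul_top_mul_mem x h
    simpa using this
  have hnt : Nontrivial (H ⧸ extIdeal H 𝔭) := ⟨⟨q 1, 0, fun h => hone ((hq 1).1 h)⟩⟩
  -- The norm is multiplicative and, by assumption, vanishes modulo `𝔭` only on `𝔭H`, so the finite
  -- quotient ring is a domain.
  have hnzd : NoZeroDivisors (H ⧸ extIdeal H 𝔭) := ⟨by
    intro x y hxy
    obtain ⟨x, rfl⟩ := Ideal.Quotient.mk_surjective x
    obtain ⟨y, rfl⟩ := Ideal.Quotient.mk_surjective y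
    by_contra! hne
    have hx := hcon x (fun h => hne.1 ((hq x).2 h))
    have hy := hcon y (fun h => hne.2 ((hq y).2 h))
    rw [← map_mul] at hxy
    have := S.N_mem_of_mem ((hq _).1 hxy)
    rw [map_mul] at this
    exact (h𝔭.isPrime.mem_or_mem this).elim hx hy⟩
  have hdom : IsDomain (H ⧸ extIdeal H 𝔭) := NoZeroDivisors.to_isDomain _
  -- By Wedderburn the quotient is a finite field, and every nonzero class is a power of one
  -- generator $s$. The quadratic equation of $s$ keeps all its powers in $R+Rs$, against
  -- `not_two_generated`.
  have hfield := Finite.isDomain_to_isField (H ⧸ extIdeal H 𝔭)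
  let := hfield.toField
  obtain ⟨g, hg⟩ := IsCyclic.exists_generator (α := (H ⧸ extIdeal H 𝔭)ˣ)
  obtain ⟨s, hs⟩ := Ideal.Quotient.mk_surjective (g : H ⧸ extIdeal H 𝔭)
  obtain ⟨x, hx⟩ := not_two_generated h𝔭.ne_top hnc s
  have hpow : ∀ n : ℕ, ∃ a b : R, s ^ n = algebraMap R H a + b • s := by
    intro n
    induction n with
    | zero => exact ⟨1, 0, by simp⟩
    | succ n ih =>
      obtain ⟨a, b, hab⟩ := ih
      refine ⟨- (b * S.N s), a + b * S.T s, ?_⟩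
      rw [pow_succ, hab, add_mul, smul_mul_assoc, S.mul_self, ← Algebra.smul_def]
      simp only [Algebra.algebraMap_eq_smul_one, smul_sub, smul_smul, add_smul, neg_smul]
      abel
  by_cases hx0 : x ∈ 𝔭 • (⊤ : Submodule R H)
  · exact hx 0 0 (by simpa using hx0)
  · have hqx : q x ≠ 0 := fun h => hx0 ((hq x).1 h)
    have hu : IsUnit (q x) := by
      obtain ⟨y, hy⟩ := hfield.mul_inv_cancel hqx
      exact IsUnit.of_mul_eq_one y hy
    obtain ⟨u, hu⟩ := hu
    have := mem_powers_iff_mem_zpowers.2 (hg u)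
    obtain ⟨n, hn⟩ := this
    obtain ⟨a, b, hab⟩ := hpow n
    apply hx a b
    rw [← hab]
    apply (hq _).1
    have h2 : q s ^ n = q x := by
      rw [← hu, ← hn]; simp [q, hs]
    rw [map_sub, map_pow, h2, sub_self]

end StdInvolution

namespace StdInvolution

variable {R H : Type*} [CommRing R] [Ring H] [Algebra R H] (S : StdInvolution R H)

/-- When $N(y)\in\mathfrak p$ the last term drops out modulo $\mathfrak p$, so the corner $yHy$
consists of scalar multiples of $y$. This is what makes the matrix units work. -/
theorem mul_mul_self (y t : H) :
    y * t * y = S.T (t * y) • y - S.N y • S.conj t := by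
  have h := S.add_conj (t * y)
  rw [S.conj_mul, ← eq_sub_iff_add_eq] at h
  have h2 : y * t * y = y * (algebraMap R H (S.T (t * y)) - S.conj y * S.conj t) := by
    rw [← h, mul_assoc]
  rw [h2, mul_sub, ← mul_assoc, S.mul_conj, ← Algebra.smul_def, ← Algebra.commutes,
    ← Algebra.smul_def]

/-- The reduction of the trace form modulo `𝔭` is nondegenerate. -/
def NondegenerateAt (𝔭 : Ideal R) : Prop :=
  ∀ x : H, (∀ y, S.T (x * y) ∈ 𝔭) → x ∈ 𝔭 • (⊤ : Submodule R H)

theorem exists_mul_sub_one_mem {𝔭 : Ideal R} (h𝔭 : 𝔭.IsMaximal) {c : R} (hc : c ∉ 𝔭) :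
    ∃ d, d * c - 1 ∈ 𝔭 := by
  obtain ⟨d, i, hi, h⟩ := h𝔭.exists_inv hc
  exact ⟨d, by rw [← h]; simpa using hi⟩

theorem smul_eq_zero_quotient {𝔭 : Ideal R} {c : R} (hc : c ∈ 𝔭) (x : H) :
    Ideal.Quotient.mk (extIdeal H 𝔭) (c • x) = 0 := by
  rw [Ideal.Quotient.eq_zero_iff_mem, mem_extIdeal]
  exact Submodule.smul_mem_smul hc trivial

/-- Lifts of a system of matrix units modulo `𝔭`. -/
structure IsMatrixUnits (𝔭 : Ideal R) (e : Fin 2 → Fin 2 → H) : Prop where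
  mul : ∀ i j k l, Ideal.Quotient.mk (extIdeal H 𝔭) (e i j * e k l) =
    if j = k then Ideal.Quotient.mk (extIdeal H 𝔭) (e i l) else 0
  one : Ideal.Quotient.mk (extIdeal H 𝔭) (e 0 0 + e 1 1) = 1
  corner : ∀ i t, Ideal.Quotient.mk (extIdeal H 𝔭) (e i i * t * e i i) =
    Ideal.Quotient.mk (extIdeal H 𝔭) (S.T (t * e i i) • e i i)
  trace : ∀ i, S.T (e i i) - 1 ∈ 𝔭

/-- An isotropic element rescaled to trace one is an idempotent $y$ modulo `𝔭`, with complement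
$\bar y$. The off-diagonal units are elements $u\in yH\bar y$ and $v\in\bar yHy$ normalised by
$T(uv)\equiv1$. If no such normalisation existed, nondegeneracy would kill both off-diagonal
corners, and $1$ and $y$ would generate `H` modulo `𝔭`. -/
theorem exists_matrixUnits [IsDomain R] [Module.Finite R H] [Module.IsTorsionFree R H]
    {𝔭 : Ideal R} (h𝔭 : 𝔭.IsMaximal) [Finite (R ⧸ 𝔭)] (hnc : ∃ x y : H, x * y ≠ y * x)
    (hnd : S.NondegenerateAt 𝔭) : ∃ e, S.IsMatrixUnits 𝔭 e := by
  obtain ⟨e, heP, heN⟩ := S.exists_isotropic h𝔭 hnc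
  obtain ⟨z, hz⟩ : ∃ z, S.T (e * z) ∉ 𝔭 := by
    by_contra! h; exact heP (hnd e h)
  obtain ⟨d, hd⟩ := exists_mul_sub_one_mem h𝔭 hz
  obtain ⟨y, hyN, hyT⟩ : ∃ y, S.N y ∈ 𝔭 ∧ S.T y - 1 ∈ 𝔭 :=
    ⟨d • (e * z), by rw [S.N_smul, map_mul]; exact 𝔭.mul_mem_left _ (𝔭.mul_mem_right _ heN),
      by rwa [map_smul]⟩
  set q := Ideal.Quotient.mk (extIdeal H 𝔭) with hq
  have hone : ∀ {c : R}, c - 1 ∈ 𝔭 → ∀ x : H, q (c • x) = q x := fun {c} hc x => by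
    rw [← sub_eq_zero, ← map_sub]
    have := smul_eq_zero_quotient hc x
    rwa [sub_smul, one_smul] at this
  have hcorner : ∀ (c : H), S.N c ∈ 𝔭 → ∀ t, q (c * t * c) = q (S.T (t * c) • c) := by
    intro c hc t
    rw [S.mul_mul_self, map_sub, smul_eq_zero_quotient hc, sub_zero]
  have hbN : S.N (S.conj y) ∈ 𝔭 := by rwa [S.N_conj]
  have hbT : S.T (S.conj y) - 1 ∈ 𝔭 := by rwa [S.T_conj]
  have hid : ∀ c : H, S.N c ∈ 𝔭 → S.T c - 1 ∈ 𝔭 → q c * q c = q c := by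
    intro c hc hc1
    have := hcorner c hc 1
    rw [mul_one, one_mul, hone hc1] at this
    rw [← map_mul, this]
  have haa := hid y hyN hyT
  have hbb := hid _ hbN hbT
  have hab : q y * q (S.conj y) = 0 := by
    rw [← map_mul, S.mul_conj, Algebra.algebraMap_eq_smul_one]; exact smul_eq_zero_quotient hyN _
  have hba : q (S.conj y) * q y = 0 := by
    rw [← map_mul, S.conj_mul_self, Algebra.algebraMap_eq_smul_one]
    exact smul_eq_zero_quotient hyN _
  have hsum : q y + q (S.conj y) = 1 := by
    rw [← map_add, S.add_conj, Algebra.algebraMap_eq_smul_one, hone hyT, map_one]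
  obtain ⟨w, w', hw⟩ : ∃ w w', S.T (y * w * S.conj y * w') ∉ 𝔭 := by
    by_contra! h
    have h1 : ∀ w, q (y * w * S.conj y) = 0 := fun w =>
      Ideal.Quotient.eq_zero_iff_mem.2 (hnd _ (h w))
    have h2 : ∀ w, q (S.conj y * w * y) = 0 := fun w =>
      Ideal.Quotient.eq_zero_iff_mem.2 (hnd _ fun w' => by
        have := h w' w
        rwa [mul_assoc (y * w'), S.T_mul_comm, ← mul_assoc] at this)
    obtain ⟨x, hx⟩ := not_two_generated h𝔭.ne_top hnc y
    apply hx (S.T (x * S.conj y)) (S.T (x * y) - S.T (x * S.conj y))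
    rw [← mem_extIdeal, ← Ideal.Quotient.eq]
    have h3 : q x = (q y + q (S.conj y)) * q x * (q y + q (S.conj y)) := by
      rw [hsum, one_mul, mul_one]
    have h4 : q (algebraMap R H (S.T (x * S.conj y))) =
        q (S.T (x * S.conj y) • y) + q (S.T (x * S.conj y) • S.conj y) := by
      rw [← map_add, ← smul_add, S.add_conj, Algebra.algebraMap_eq_smul_one (S.T y), smul_comm,
        hone hyT, Algebra.algebraMap_eq_smul_one]
    change q x = q _
    rw [h3, map_add, h4, sub_smul, map_sub, ← hcorner y hyN, ← hcorner _ hbN]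
    simp only [add_mul, mul_add, ← map_mul, h1, h2]
    abel
  obtain ⟨d, hd⟩ := exists_mul_sub_one_mem h𝔭 hw
  set u := y * w * S.conj y with hu
  set v := S.conj y * (d • w') * y with hv
  have hau : q y * q u = q u := by
    rw [hu, map_mul, map_mul, ← mul_assoc, ← mul_assoc, haa]
  have hbu : q (S.conj y) * q u = 0 := by
    rw [hu, map_mul, map_mul, ← mul_assoc, ← mul_assoc, hba, zero_mul, zero_mul]
  have hua : q u * q y = 0 := by rw [hu, map_mul, mul_assoc, hba, mul_zero]
  have hub : q u * q (S.conj y) = q u := by rw [hu, map_mul, mul_assoc, hbb]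
  have hbv : q (S.conj y) * q v = q v := by
    rw [hv, map_mul, map_mul, ← mul_assoc, ← mul_assoc, hbb]
  have hav : q y * q v = 0 := by
    rw [hv, map_mul, map_mul, ← mul_assoc, ← mul_assoc, hab, zero_mul, zero_mul]
  have hvb : q v * q (S.conj y) = 0 := by rw [hv, map_mul, mul_assoc, hab, mul_zero]
  have hva : q v * q y = q v := by rw [hv, map_mul, mul_assoc, haa]
  have hTq : ∀ {s t : H}, q s = q t → S.T s - S.T t ∈ 𝔭 := fun {s t} h => by
    rw [← map_sub]; exact S.T_mem_of_mem (mem_extIdeal.1 (Ideal.Quotient.eq.1 h))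
  -- Since $u\bar y\equiv u$ and $yu\equiv u$, the trace of $uv$ reduces to $d\,T(uw')$, which the
  -- choice of $d$ makes $1$.
  have huv1 : S.T (u * v) - 1 ∈ 𝔭 := by
    have h1 : q (u * v) = q (u * (d • w') * y) := by
      have : u * v = u * S.conj y * ((d • w') * y) := by simp only [hv, mul_assoc]
      rw [this, map_mul, map_mul q u, hub, ← map_mul, ← mul_assoc]
    have h2 : S.T (u * (d • w') * y) - d * S.T (u * w') ∈ 𝔭 := by
      rw [S.T_mul_comm, mul_smul_comm, mul_smul_comm, map_smul, smul_eq_mul, ← mul_sub]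
      refine 𝔭.mul_mem_left _ (hTq ?_)
      rw [map_mul, map_mul, ← mul_assoc, hau]
    have := add_mem (add_mem (hTq h1) h2) hd
    simpa using this
  -- $uv$ lies in the corner of $y$, so it is $c\,y$ modulo `𝔭`; comparing traces gives $c\equiv1$.
  have huv : q u * q v = q y := by
    have h1 : u * v = y * (w * S.conj y * (S.conj y * (d • w'))) * y := by
      rw [hu, hv]; noncomm_ring
    have h2 := hcorner y hyN (w * S.conj y * (S.conj y * (d • w')))
    rw [← h1] at h2
    have h3 := hTq h2
    rw [map_smul, smul_eq_mul] at h3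
    set c := S.T (w * S.conj y * (S.conj y * (d • w')) * y)
    rw [← map_mul, h2]
    apply hone
    have : c - 1 = (S.T (u * v) - 1) - (S.T (u * v) - c * S.T y) - c * (S.T y - 1) := by ring
    rw [this]
    exact sub_mem (sub_mem huv1 h3) (𝔭.mul_mem_left _ hyT)
  have hvu : q v * q u = q (S.conj y) := by
    have h1 : v * u = S.conj y * ((d • w') * y * (y * w)) * S.conj y := by
      rw [hu, hv]; noncomm_ring
    have h2 := hcorner _ hbN ((d • w') * y * (y * w))
    rw [← h1] at h2
    have h3 := hTq h2
    rw [map_smul, smul_eq_mul, S.T_mul_comm v u] at h3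
    set c := S.T ((d • w') * y * (y * w) * S.conj y)
    rw [← map_mul, h2]
    apply hone
    have : c - 1 = (S.T (u * v) - 1) - (S.T (u * v) - c * S.T (S.conj y)) -
      c * (S.T (S.conj y) - 1) := by ring
    rw [this]
    exact sub_mem (sub_mem huv1 h3) (𝔭.mul_mem_left _ hbT)
  have huu : q u * q u = 0 := by
    have : q u * q u = q u * q (S.conj y) * q u := by rw [hub]
    rw [this, mul_assoc, hbu, mul_zero]
  have hvv : q v * q v = 0 := by
    have : q v * q v = q v * q y * q v := by rw [hva]
    rw [this, mul_assoc, hav, mul_zero]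
  refine ⟨![![y, u], ![v, S.conj y]], ⟨?_, ?_, ?_, ?_⟩⟩
  · intro i j k l
    change q _ = if j = k then q _ else 0
    rw [map_mul]
    fin_cases i <;> fin_cases j <;> fin_cases k <;> fin_cases l <;>
      simp [haa, hbb, hab, hba, hau, hbu, hua, hub, hbv, hav, hvb, hva, huv, hvu, huu, hvv]
  · change q _ = 1
    simpa using hsum
  · intro i t
    fin_cases i
    · exact hcorner y hyN t
    · exact hcorner _ hbN t
  · intro i
    fin_cases i
    · exact hyT
    · exact hbT

end StdInvolution

/-! ### Splittings modulo a prime and Gram determinants -/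

namespace StdInvolution

variable {R H : Type*} [CommRing R] [Ring H] [Algebra R H] (S : StdInvolution R H)

/-- A splitting of `H` modulo `𝔭`: a surjection onto the `2 × 2` matrices over the residue field
with kernel `𝔭H` that turns the standard involution into the adjugate. -/
structure Splitting (𝔭 : Ideal R) where
  toFun : H →ₐ[R] Matrix (Fin 2) (Fin 2) (R ⧸ 𝔭)
  surj : Function.Surjective toFun
  ker : ∀ x, toFun x = 0 ↔ x ∈ 𝔭 • (⊤ : Submodule R H)
  map_conj : ∀ x, toFun (S.conj x) = (toFun x).adjugate
  det : ∀ x, (toFun x).det = Ideal.Quotient.mk 𝔭 (S.N x)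

/-- The trace modulo `𝔭`. -/
def traceMod (𝔭 : Ideal R) : H →ₗ[R] R ⧸ 𝔭 := (Algebra.linearMap R (R ⧸ 𝔭)).comp S.T

theorem traceMod_apply (𝔭 : Ideal R) (x : H) :
    S.traceMod 𝔭 x = Ideal.Quotient.mk 𝔭 (S.T x) := rfl

theorem traceMod_congr {𝔭 : Ideal R} {x y : H}
    (h : Ideal.Quotient.mk (extIdeal H 𝔭) x = Ideal.Quotient.mk (extIdeal H 𝔭) y) :
    S.traceMod 𝔭 x = S.traceMod 𝔭 y := by
  rw [traceMod_apply, traceMod_apply, Ideal.Quotient.eq, ← map_sub]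
  exact S.T_mem_of_mem (mem_extIdeal.1 (Ideal.Quotient.eq.1 h))

namespace IsMatrixUnits

variable {S} {𝔭 : Ideal R} {e : Fin 2 → Fin 2 → H} (he : S.IsMatrixUnits 𝔭 e)
include he

theorem traceMod_unit (i j : Fin 2) : S.traceMod 𝔭 (e i j) = if i = j then 1 else 0 := by
  split_ifs with h
  · subst h
    rw [traceMod_apply, ← map_one (Ideal.Quotient.mk 𝔭), Ideal.Quotient.eq]
    exact he.trace i
  · have h1 : S.traceMod 𝔭 (e i j) = S.traceMod 𝔭 (e i j * e j j) :=
      S.traceMod_congr (by rw [he.mul, if_pos rfl])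
    have h2 : S.traceMod 𝔭 (e j j * e i j) = S.traceMod 𝔭 0 :=
      S.traceMod_congr (by rw [he.mul, if_neg (Ne.symm h), map_zero])
    rw [h1, traceMod_apply, S.T_mul_comm, ← traceMod_apply, h2, map_zero]

/-- Write $e_{ii}xe_{jj}\equiv e_{ii}(xe_{ji})e_{ii}\,e_{ij}$; the diagonal corner is made of
scalars that are read off by the trace. Thus $T(xe_{ji})$ is the $(i,j)$ matrix coordinate of $x$.
-/
theorem corner_mul (x : H) (i j : Fin 2) :
    Ideal.Quotient.mk (extIdeal H 𝔭) (e i i * x * e j j) =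
      Ideal.Quotient.mk (extIdeal H 𝔭) (S.T (x * e j i) • e i j) := by
  have h1 : Ideal.Quotient.mk (extIdeal H 𝔭) (e i i * x * e j j) =
      Ideal.Quotient.mk (extIdeal H 𝔭) (e i i * (x * e j i) * e i i * e i j) := by
    have a1 := he.mul j i i j
    have a2 := he.mul i i i j
    rw [if_pos rfl] at a1 a2
    rw [mul_assoc (e i i * (x * e j i)), map_mul _ (e i i * (x * e j i)), a2, ← map_mul,
      map_mul, ← a1, ← map_mul]
    simp only [mul_assoc]
  have h2 : S.T (x * e j i * e i i) - S.T (x * e j i) ∈ 𝔭 := by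
    rw [← Ideal.Quotient.eq]
    refine S.traceMod_congr ?_
    rw [mul_assoc, map_mul, he.mul, if_pos rfl, ← map_mul]
  rw [h1, map_mul, he.corner, ← map_mul, smul_mul_assoc, Ideal.Quotient.eq, mem_extIdeal]
  have h3 : e i i * e i j - e i j ∈ 𝔭 • (⊤ : Submodule R H) := by
    rw [← mem_extIdeal, ← Ideal.Quotient.eq, he.mul, if_pos rfl]
  have := add_mem (Submodule.smul_mem _ (S.T (x * e j i * e i i)) h3)
    (Submodule.smul_mem_smul h2 (Submodule.mem_top (x := e i j)))
  convert this using 1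
  rw [smul_sub, sub_smul]; abel

theorem expand (x : H) : Ideal.Quotient.mk (extIdeal H 𝔭) x =
    Ideal.Quotient.mk (extIdeal H 𝔭) (∑ i, ∑ j, S.T (x * e j i) • e i j) := by
  have h : Ideal.Quotient.mk (extIdeal H 𝔭) x =
      Ideal.Quotient.mk (extIdeal H 𝔭) ((e 0 0 + e 1 1) * x * (e 0 0 + e 1 1)) := by
    rw [map_mul, map_mul, he.one, one_mul, mul_one]
  rw [h]
  simp only [Fin.sum_univ_two, add_mul, mul_add, map_add, he.corner_mul]
  abel

theorem mul_unit (y : H) (i j : Fin 2) : Ideal.Quotient.mk (extIdeal H 𝔭) (y * e j i) =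
    Ideal.Quotient.mk (extIdeal H 𝔭) (∑ k, S.T (y * e j k) • e k i) := by
  have h : Ideal.Quotient.mk (extIdeal H 𝔭) (y * e j i) =
      Ideal.Quotient.mk (extIdeal H 𝔭) ((e 0 0 + e 1 1) * y * e j j * e j i) := by
    rw [mul_assoc _ (e j j), map_mul _ _ (e j j * e j i), he.mul, if_pos rfl, map_mul _ _ y,
      he.one, one_mul, map_mul]
  rw [h, map_mul]
  simp only [Fin.sum_univ_two, add_mul, map_add, he.corner_mul]
  simp only [← map_mul, smul_mul_assoc]
  congr 1 <;>
  · simp only [Algebra.smul_def, map_mul _ (algebraMap R H _)]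
    rw [he.mul, if_pos rfl]

/-- The splitting modulo `𝔭` given by a system of matrix units. -/
def splittingHom : H →ₐ[R] Matrix (Fin 2) (Fin 2) (R ⧸ 𝔭) :=
  AlgHom.ofLinearMap
    { toFun := fun x => Matrix.of fun i j => S.traceMod 𝔭 (x * e j i)
      map_add' := fun x y => by ext i j; simp [add_mul]
      map_smul' := fun r x => by ext i j; simp }
    (by
      ext i j
      simp [he.traceMod_unit, Matrix.one_apply, eq_comm])
    (by
      intro x y
      ext i j
      simp only [LinearMap.coe_mk, AddHom.coe_mk, Matrix.of_apply, Matrix.mul_apply]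
      rw [mul_assoc]
      have h : S.traceMod 𝔭 (x * (y * e j i)) =
          S.traceMod 𝔭 (x * ∑ k, S.T (y * e j k) • e k i) :=
        S.traceMod_congr (by rw [map_mul, he.mul_unit, ← map_mul])
      rw [h, Finset.mul_sum, map_sum]
      refine Finset.sum_congr rfl fun k _ => ?_
      rw [mul_smul_comm, map_smul, Algebra.smul_def, mul_comm]
      rfl)

theorem splittingHom_apply (x : H) (i j : Fin 2) :
    he.splittingHom x i j = S.traceMod 𝔭 (x * e j i) := rfl

theorem splittingHom_eq_zero (x : H) :
    he.splittingHom x = 0 ↔ x ∈ 𝔭 • (⊤ : Submodule R H) := by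
  constructor
  · intro h
    rw [← mem_extIdeal, ← Ideal.Quotient.eq_zero_iff_mem, he.expand, map_sum]
    refine Finset.sum_eq_zero fun i _ => ?_
    rw [map_sum]
    refine Finset.sum_eq_zero fun j _ => smul_eq_zero_quotient ?_ _
    have := congrFun (congrFun h i) j
    rw [he.splittingHom_apply] at this
    exact Ideal.Quotient.eq_zero_iff_mem.1 this
  · intro h
    ext i j
    rw [he.splittingHom_apply, traceMod_apply]
    exact Ideal.Quotient.eq_zero_iff_mem.2 (S.T_mem_of_mem (smul_top_mul_mem _ h))

theorem splittingHom_surjective : Function.Surjective he.splittingHom := by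
  intro M
  choose c hc using fun i j => Ideal.Quotient.mk_surjective (M i j)
  refine ⟨∑ i, ∑ j, c i j • e i j, ?_⟩
  ext k l
  rw [he.splittingHom_apply]
  have h : ∀ i j, S.traceMod 𝔭 (e i j * e l k) = if j = l then if i = k then 1 else 0 else 0 := by
    intro i j
    split_ifs with h1 h2
    · rw [S.traceMod_congr (y := e i k) (by rw [he.mul, if_pos h1]), he.traceMod_unit, if_pos h2]
    · rw [S.traceMod_congr (y := e i k) (by rw [he.mul, if_pos h1]), he.traceMod_unit, if_neg h2]
    · rw [S.traceMod_congr (y := 0) (by rw [he.mul, if_neg h1, map_zero]), map_zero]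
  simp only [Finset.sum_mul, map_sum, smul_mul_assoc, map_smul, h]
  rw [Finset.sum_eq_single k, Finset.sum_eq_single l]
  · simp [Algebra.smul_def, ← hc]
  · intro j _ hj; simp [hj]
  · simp
  · intro i _ hi; simp [hi]
  · simp

/-- Both operations subtract from the trace: $\bar x=T(x)-x$ and, for $2\times2$ matrices,
$\operatorname{adj}M=\operatorname{tr}M-M$. -/
theorem splittingHom_conj (x : H) :
    he.splittingHom (S.conj x) = (he.splittingHom x).adjugate := by
  have htr : S.traceMod 𝔭 x = S.traceMod 𝔭 (x * e 0 0) + S.traceMod 𝔭 (x * e 1 1) := by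
    rw [← map_add, ← mul_add]
    refine S.traceMod_congr ?_
    rw [map_mul, he.one, mul_one]
  have : ∀ i j, S.traceMod 𝔭 (S.conj x * e j i) =
      (if j = i then S.traceMod 𝔭 x else 0) - S.traceMod 𝔭 (x * e j i) := by
    intro i j
    rw [S.conj_eq, sub_mul, map_sub, ← Algebra.smul_def, map_smul, he.traceMod_unit]
    split_ifs <;> simp [Algebra.smul_def, traceMod_apply]
  ext i j
  rw [he.splittingHom_apply, this, Matrix.adjugate_fin_two]
  fin_cases i <;> fin_cases j <;> simp [he.splittingHom_apply, htr]

/-- The splitting modulo `𝔭` given by a system of matrix units. -/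
def splitting : S.Splitting 𝔭 where
  toFun := he.splittingHom
  surj := he.splittingHom_surjective
  ker := he.splittingHom_eq_zero
  map_conj := he.splittingHom_conj
  det x := by
    -- $x\bar x=N(x)$ becomes $M\operatorname{adj}M=N(x)$, and the left side is $\det M$ times the
    -- identity.
    have h := congrArg he.splittingHom (S.mul_conj x)
    rw [map_mul, he.splittingHom_conj, Matrix.mul_adjugate, AlgHom.commutes] at h
    have := congrFun (congrFun h 0) 0
    simpa [Matrix.algebraMap_matrix_apply] using this

/-- The Gram determinant of the matrix units is a unit modulo `𝔭`. -/
theorem gram_det_notMem [h𝔭 : 𝔭.IsPrime] : ∃ x : Fin 4 → H,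
    (Matrix.of fun i j => S.T (x i * x j)).det ∉ 𝔭 := by
  refine ⟨![e 0 0, e 0 1, e 1 0, e 1 1], ?_⟩
  have h : ∀ i j k l, S.traceMod 𝔭 (e i j * e l k) =
      if j = l then if i = k then 1 else 0 else 0 := by
    intro i j k l
    split_ifs with h1 h2
    · rw [S.traceMod_congr (y := e i k) (by rw [he.mul, if_pos h1]), he.traceMod_unit, if_pos h2]
    · rw [S.traceMod_congr (y := e i k) (by rw [he.mul, if_pos h1]), he.traceMod_unit, if_neg h2]
    · rw [S.traceMod_congr (y := 0) (by rw [he.mul, if_neg h1, map_zero]), map_zero]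
  rw [← Ideal.Quotient.eq_zero_iff_mem, RingHom.map_det]
  -- The trace pairing matches $e_{ij}$ with $e_{ji}$, so the Gram matrix is a permutation matrix,
  -- of determinant $-1$.
  have hM : (Ideal.Quotient.mk 𝔭).mapMatrix (Matrix.of fun i j =>
      S.T (![e 0 0, e 0 1, e 1 0, e 1 1] i * ![e 0 0, e 0 1, e 1 0, e 1 1] j)) =
      !![1, 0, 0, 0; 0, 0, 1, 0; 0, 1, 0, 0; 0, 0, 0, 1] := by
    ext i j
    rw [RingHom.mapMatrix_apply, Matrix.map_apply, Matrix.of_apply, ← traceMod_apply]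
    fin_cases i <;> fin_cases j <;> simp [h]
  rw [hM]
  simp [Matrix.det_succ_row_zero, Fin.sum_univ_succ, Fin.succAbove]

end IsMatrixUnits

/-- If some Gram determinant is a unit modulo `𝔭`, then the trace form is nondegenerate at `𝔭`. -/
theorem nondegenerateAt_of_gram {𝔭 : Ideal R} (h𝔭 : 𝔭.IsMaximal) [IsDomain R]
    (hspan : ∀ x : Fin 4 → H, (Matrix.of fun i j => S.T (x i * x j)).det ≠ 0 →
      ∀ z : H, ∃ d : R, d ≠ 0 ∧ ∃ c : Fin 4 → R, d • z = ∑ i, c i • x i)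
    [Module.IsTorsionFree R H]
    {x : Fin 4 → H} (hx : (Matrix.of fun i j => S.T (x i * x j)).det ∉ 𝔭) :
    S.NondegenerateAt 𝔭 := by
  intro z hz
  set M := Matrix.of fun i j => S.T (x i * x j) with hM
  obtain ⟨d, hd, c, hc⟩ := hspan x (fun h => hx (h ▸ 𝔭.zero_mem)) z
  have h1 : Matrix.vecMul c M = fun j => d * S.T (z * x j) := by
    ext j
    have := congrArg (fun w => S.T (w * x j)) hc
    simp only [smul_mul_assoc, map_smul, Finset.sum_mul, map_sum, smul_eq_mul] at this
    rw [this]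
    rfl
  have h2 : ∀ i, M.det * c i = d * Matrix.vecMul (fun j => S.T (z * x j)) M.adjugate i := by
    intro i
    have := congrArg (fun w => Matrix.vecMul w M.adjugate i) h1
    simp only [Matrix.vecMul_vecMul, Matrix.mul_adjugate] at this
    have e1 : (fun j => d * S.T (z * x j)) = d • fun j => S.T (z * x j) := rfl
    rw [e1, Matrix.smul_vecMul, Matrix.vecMul_smul, Matrix.vecMul_one] at this
    exact this
  -- Cramer's rule: $\det M\cdot z$ is a combination of the $x_i$ whose coefficients are linear in
  -- the traces $T(zx_j)\in\mathfrak p$. The denominator $d$ cancels because `H` is torsion-free.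
  have h3 : M.det • z = ∑ i, Matrix.vecMul (fun j => S.T (z * x j)) M.adjugate i • x i := by
    apply smul_right_injective H hd
    simp only [Finset.smul_sum, smul_smul]
    rw [mul_comm, mul_smul, hc, Finset.smul_sum]
    exact Finset.sum_congr rfl fun i _ => by rw [smul_smul, h2]
  have h4 : M.det • z ∈ 𝔭 • (⊤ : Submodule R H) := by
    rw [h3]
    refine sum_mem fun i _ => Submodule.smul_mem_smul ?_ trivial
    rw [Matrix.vecMul_eq_sum]
    simp only [Finset.sum_apply, Pi.smul_apply, smul_eq_mul]
    exact sum_mem fun j _ => 𝔭.mul_mem_right _ (hz _)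
  obtain ⟨b, hb⟩ := exists_mul_sub_one_mem h𝔭 hx
  have h5 := sub_mem (Submodule.smul_mem _ b h4)
    (Submodule.smul_mem_smul hb (Submodule.mem_top (x := z)))
  rwa [sub_smul, one_smul, smul_smul, sub_sub_cancel] at h5

end StdInvolution

/-! ### Principal right ideals above a prime, and the ramified case -/

namespace StdInvolution

variable {R H : Type*} [CommRing R] [Ring H] [Algebra R H] (S : StdInvolution R H)

theorem mem_right_ideal_of_isUnit {s : H} (hs : IsUnit (S.N s)) (x : H) : ∃ h, x = s * h := by
  obtain ⟨c, hc⟩ := hs.exists_right_inv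
  refine ⟨c • (S.conj s * x), ?_⟩
  rw [mul_smul_comm, ← mul_assoc, S.mul_conj, ← Algebra.smul_def, smul_smul, mul_comm, hc, one_smul]

theorem mem_smul_top_of_mul_mem {𝔭 : Ideal R} (h𝔭 : 𝔭.IsMaximal) {s t : H} (ht : S.N t ∉ 𝔭)
    (h : s * t ∈ 𝔭 • (⊤ : Submodule R H)) : s ∈ 𝔭 • (⊤ : Submodule R H) := by
  have h1 := smul_top_mul_mem (S.conj t) h
  rw [mul_assoc, S.mul_conj, ← Algebra.commutes, ← Algebra.smul_def] at h1
  obtain ⟨b, hb⟩ := exists_mul_sub_one_mem h𝔭 ht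
  have h5 := sub_mem (Submodule.smul_mem _ b h1)
    (Submodule.smul_mem_smul hb (Submodule.mem_top (x := s)))
  rwa [sub_smul, one_smul, smul_smul, sub_sub_cancel] at h5

/-- The norm of a generator of a right ideal strictly between `𝔭H` and `H` generates `𝔭`. -/
theorem span_N_eq [IsDedekindDomain R] {𝔭 : Ideal R} (h𝔭 : 𝔭.IsPrime) (h0 : 𝔭 ≠ ⊥) {s : H}
    (hP : ∀ x ∈ 𝔭 • (⊤ : Submodule R H), ∃ h, x = s * h) (htop : ∃ x, ∀ h, x ≠ s * h)
    (hs : s ∉ 𝔭 • (⊤ : Submodule R H)) : Ideal.span {S.N s} = 𝔭 := by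
  have hmax : 𝔭.IsMaximal := h𝔭.isMaximal h0
  set J := Ideal.span {S.N s} with hJ
  have hsq : ∀ x ∈ 𝔭, ∃ t, s * t = algebraMap R H x ∧ S.N s * S.N t = x ^ 2 := by
    intro x hx
    obtain ⟨t, ht⟩ := hP _ (algebraMap_mem_smul_top hx)
    exact ⟨t, ht.symm, by rw [← map_mul, ← ht, S.N_algebraMap]⟩
  -- Each $x\in\mathfrak p$ factors as $st$, so $N(s)$ divides $x^2$; no maximal ideal other than
  -- `𝔭` can contain $N(s)$.
  have hpr : ∀ r : Ideal R, r.IsMaximal → J ≤ r → r = 𝔭 := by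
    intro r hr hJr
    symm
    apply hmax.eq_of_le hr.ne_top
    intro x hx
    obtain ⟨t, -, ht⟩ := hsq x hx
    refine hr.isPrime.mem_of_pow_mem 2 (hJr ?_)
    rw [← ht]
    exact Ideal.mul_mem_right _ _ (Ideal.mem_span_singleton_self _)
  have hJtop : J ≠ ⊤ := by
    intro h
    obtain ⟨x, hx⟩ := htop
    obtain ⟨h', hh⟩ := S.mem_right_ideal_of_isUnit (Ideal.span_singleton_eq_top.1 h) x
    exact hx h' hh
  obtain ⟨r, hr, hJr⟩ := Ideal.exists_le_maximal J hJtop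
  have hJp : J ≤ 𝔭 := hpr r hr hJr ▸ hJr
  -- Take $x\in\mathfrak p\setminus\mathfrak p^2$ and $x=st$. Here $N(t)\in\mathfrak p$, since
  -- otherwise $t$ is invertible modulo `𝔭` and $s\in\mathfrak pH$. So $N(s)\in\mathfrak p^2$ would
  -- give $x^2\in\mathfrak p^3$, which is impossible.
  have hJp2 : ¬ J ≤ 𝔭 ^ 2 := by
    intro hle
    obtain ⟨x, hx, hx2⟩ := Ideal.exists_mem_pow_notMem_pow_succ 𝔭 h0 h𝔭.ne_top 1
    rw [pow_one] at hx
    obtain ⟨t, hst, ht⟩ := hsq x hx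
    have hNt : S.N t ∈ 𝔭 := by
      by_contra hNt
      exact hs (S.mem_smul_top_of_mul_mem hmax hNt (hst ▸ algebraMap_mem_smul_top hx))
    have h3 : x ^ 2 ∈ 𝔭 ^ 3 := by
      rw [← ht, pow_succ 𝔭 2]
      exact Ideal.mul_mem_mul (hle (Ideal.mem_span_singleton_self _)) hNt
    obtain ⟨C, hC⟩ := Ideal.dvd_iff_le.2 ((Ideal.span_singleton_le_iff_mem _).2 hx)
    have h4 : 𝔭 ^ 2 * 𝔭 ∣ 𝔭 ^ 2 * C ^ 2 := by
      rw [← mul_pow, ← hC, Ideal.span_singleton_pow, ← pow_succ]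
      exact Ideal.dvd_iff_le.2 ((Ideal.span_singleton_le_iff_mem _).2 h3)
    have hprime : Prime 𝔭 := Ideal.prime_of_isPrime h0 h𝔭
    have h5 := hprime.dvd_of_dvd_pow ((mul_dvd_mul_iff_left (pow_ne_zero 2 hprime.ne_zero)).1 h4)
    apply hx2
    rw [← Ideal.span_singleton_le_iff_mem, ← Ideal.dvd_iff_le, hC, pow_succ, pow_one]
    exact mul_dvd_mul_left _ h5
  obtain ⟨C, hC⟩ := Ideal.dvd_iff_le.2 hJp
  by_cases hCt : C = ⊤
  · rw [hC, hCt, Ideal.mul_top]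
  · exfalso
    obtain ⟨r, hr, hCr⟩ := Ideal.exists_le_maximal C hCt
    have hrp := hpr r hr (by rw [hC]; exact Ideal.mul_le_right.trans hCr)
    apply hJp2
    rw [hC, pow_two]
    exact Ideal.mul_mono_right (hCr.trans hrp.le)

/-- Every right ideal that contains `𝔭H` is principal. -/
def PrincipalAbove (H : Type*) [Ring H] [Algebra R H] (𝔭 : Ideal R) : Prop :=
  ∀ I : Submodule R H, (∀ x ∈ I, ∀ h, x * h ∈ I) → 𝔭 • (⊤ : Submodule R H) ≤ I →
    ∃ s, ∀ x, x ∈ I ↔ ∃ h, x = s * h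

/-- If `1` lies in the radical of the trace form modulo `𝔭`, then some right ideal above `𝔭H`
is not principal. -/
theorem not_forall_T_mem [IsDedekindDomain R] [Module.Finite R H] [Module.IsTorsionFree R H]
    {𝔭 : Ideal R} (h𝔭 : 𝔭.IsMaximal) [Finite (R ⧸ 𝔭)] (hnc : ∃ x y : H, x * y ≠ y * x)
    (hPR : PrincipalAbove H 𝔭) : ∃ x, S.T x ∉ 𝔭 := by
  by_contra! hT
  -- If all traces lie in `𝔭`, the norm is additive modulo `𝔭`, so the elements with norm in `𝔭`
  -- form a right ideal.
  let J : Submodule R H :=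
    { carrier := {x | S.N x ∈ 𝔭}
      add_mem' := fun {x y} hx hy => by
        change S.N (x + y) ∈ 𝔭
        rw [S.N_add]; exact add_mem (add_mem hx hy) (hT _)
      zero_mem' := S.N_mem_of_mem (zero_mem _)
      smul_mem' := fun r x hx => by
        change S.N (r • x) ∈ 𝔭
        rw [S.N_smul]; exact 𝔭.mul_mem_left _ hx }
  obtain ⟨s, hs⟩ := hPR J
    (fun x hx h => by change S.N (x * h) ∈ 𝔭; rw [map_mul]; exact 𝔭.mul_mem_right _ hx)
    (fun x hx => S.N_mem_of_mem hx)
  have hsN : S.N s ∈ 𝔭 := (hs s).2 ⟨1, by simp⟩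
  -- Since $2=T(1)\in\mathfrak p$, the residue field has characteristic two and $N(x)\equiv a^2$ for
  -- some $a$; then $N(x-a)\in\mathfrak p$.
  have hred : ∀ x : H, ∃ a : R, ∃ y, x = algebraMap R H a + s * y := by
    intro x
    let := Ideal.Quotient.field 𝔭
    have h2 : ringChar (R ⧸ 𝔭) = 2 := by
      have h2 : (2 : R) ∈ 𝔭 := S.T_one ▸ hT 1
      have : ((2 : ℕ) : R ⧸ 𝔭) = 0 := by
        rw [← map_natCast (Ideal.Quotient.mk 𝔭)]
        exact Ideal.Quotient.eq_zero_iff_mem.2 (by exact_mod_cast h2)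
      have h3 := (Nat.dvd_prime Nat.prime_two).1 (ringChar.dvd this)
      exact h3.resolve_left (CharP.ringChar_ne_one)
    obtain ⟨c, hc⟩ := FiniteField.isSquare_of_char_two h2 (Ideal.Quotient.mk 𝔭 (S.N x))
    obtain ⟨a, rfl⟩ := Ideal.Quotient.mk_surjective c
    rw [← map_mul, Ideal.Quotient.eq] at hc
    have : x - algebraMap R H a ∈ J := by
      change S.N (x - algebraMap R H a) ∈ 𝔭
      rw [sub_eq_add_neg, ← map_neg, S.N_add, S.N_algebraMap]
      refine add_mem ?_ (hT _)
      have h2 : (2 : R) ∈ 𝔭 := S.T_one ▸ hT 1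
      have : S.N x + (-a) ^ 2 = (S.N x - a * a) + a * a * 2 := by ring
      rw [this]
      exact add_mem hc (𝔭.mul_mem_left _ h2)
    obtain ⟨y, hy⟩ := (hs _).1 this
    exact ⟨a, y, by rw [← hy]; abel⟩
  obtain ⟨x, hx⟩ := not_two_generated h𝔭.ne_top hnc s
  obtain ⟨a, y, rfl⟩ := hred x
  obtain ⟨b, z, rfl⟩ := hred y
  apply hx a b
  -- Applying `hred` twice gives $x=a+bs+s^2z$. As $s^2\in\mathfrak pH$, `H` would be generated by
  -- $1$ and $s$ modulo `𝔭`.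
  have hss : s * s ∈ 𝔭 • (⊤ : Submodule R H) := by
    rw [S.mul_self]
    exact sub_mem (Submodule.smul_mem_smul (hT s) trivial) (algebraMap_mem_smul_top hsN)
  have : algebraMap R H a + s * (algebraMap R H b + s * z) - (algebraMap R H a + b • s) =
      s * s * z := by
    rw [mul_add, ← Algebra.commutes, Algebra.smul_def, mul_assoc]; abel
  rw [this]
  exact smul_top_mul_mem z hss

/-- At a ramified prime the elements whose norm lies in `𝔭` form a principal ideal. -/
theorem exists_ramified_generator [IsDedekindDomain R] [Module.Finite R H]
    [Module.IsTorsionFree R H] {𝔭 : Ideal R} (h𝔭 : 𝔭.IsPrime) (h0 : 𝔭 ≠ ⊥) [Finite (R ⧸ 𝔭)]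
    (hnc : ∃ x y : H, x * y ≠ y * x) (hPR : PrincipalAbove H 𝔭) (hnd : ¬ S.NondegenerateAt 𝔭) :
    ∃ s, Ideal.span {S.N s} = 𝔭 ∧ ∀ h, S.N h ∈ 𝔭 → ∃ t, h = s * t := by
  have hmax : 𝔭.IsMaximal := h𝔭.isMaximal h0
  -- The radical of the trace form modulo `𝔭`. Degeneracy makes it strictly larger than `𝔭H`, and
  -- `not_forall_T_mem` makes it proper, so its generator has a norm generating `𝔭`.
  let J : Submodule R H :=
    { carrier := {x | ∀ y, S.T (x * y) ∈ 𝔭}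
      add_mem' := fun {x y} hx hy z => by rw [add_mul, map_add]; exact add_mem (hx z) (hy z)
      zero_mem' := fun y => by simp
      smul_mem' := fun r x hx z => by
        rw [smul_mul_assoc, map_smul]; exact 𝔭.mul_mem_left _ (hx z) }
  have hPJ : 𝔭 • (⊤ : Submodule R H) ≤ J := fun x hx y => S.T_mem_of_mem (smul_top_mul_mem _ hx)
  obtain ⟨s, hs⟩ := hPR J (fun x hx h y => by rw [mul_assoc]; exact hx _) hPJ
  have hsJ : s ∈ J := (hs s).2 ⟨1, by simp⟩
  have h1 : (1 : H) ∉ J := by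
    intro h1
    obtain ⟨x, hx⟩ := S.not_forall_T_mem hmax hnc hPR
    exact hx (by simpa using h1 x)
  have hNs : Ideal.span {S.N s} = 𝔭 := by
    refine S.span_N_eq h𝔭 h0 (fun x hx => (hs x).1 (hPJ hx)) ⟨1, fun h hh => h1 ((hs 1).2 ⟨h, hh⟩)⟩ ?_
    intro hsP
    apply hnd
    intro x hx
    obtain ⟨h, rfl⟩ := (hs x).1 hx
    exact smul_top_mul_mem h hsP
  have hN0 : S.N s ≠ 0 := by
    intro h; rw [h] at hNs; exact h0 (by rw [← hNs]; simp)
  have hNmem : S.N s ∈ 𝔭 := hNs ▸ Ideal.mem_span_singleton_self _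
  refine ⟨s, hNs, fun h hh => ?_⟩
  -- The right ideal $hH+sH=tH$, with $s=tw$. As $N(t)N(w)$ generates a prime, one factor is a unit.
  -- If it is $N(w)$, then $h\in tH=sH$. If it is $N(t)$, then $1=ha+sb$; but $N(1-sb)\equiv1$
  -- because $s$ is in the radical, while $N(ha)\in\mathfrak p$.
  let I : Submodule R H :=
    { carrier := {x | ∃ a b, x = h * a + s * b}
      add_mem' := by
        rintro _ _ ⟨a, b, rfl⟩ ⟨c, d, rfl⟩
        exact ⟨a + c, b + d, by rw [mul_add, mul_add]; abel⟩
      zero_mem' := ⟨0, 0, by simp⟩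
      smul_mem' := by
        rintro r _ ⟨a, b, rfl⟩
        exact ⟨r • a, r • b, by rw [smul_add, mul_smul_comm, mul_smul_comm]⟩ }
  obtain ⟨t, ht⟩ := hPR I
    (by
      rintro _ ⟨a, b, rfl⟩ c
      exact ⟨a * c, b * c, by rw [add_mul, mul_assoc, mul_assoc]⟩)
    (fun x hx => by
      obtain ⟨b, hb⟩ := (hs x).1 (hPJ hx)
      exact ⟨0, b, by rw [hb]; simp⟩)
  obtain ⟨w, hw⟩ := (ht s).1 ⟨0, 1, by simp⟩
  obtain ⟨v, hv⟩ := (ht h).1 ⟨1, 0, by simp⟩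
  have hNw : S.N s = S.N t * S.N w := by rw [← map_mul, ← hw]
  rcases h𝔭.mem_or_mem (hNw ▸ hNmem : S.N t * S.N w ∈ 𝔭) with hp | hp
  · rw [← hNs, Ideal.mem_span_singleton] at hp
    obtain ⟨c, hc⟩ := hp
    have hu : S.N w * c = 1 := by
      apply mul_left_cancel₀ hN0
      calc S.N s * (S.N w * c) = (S.N s * c) * S.N w := by ring
        _ = S.N s * 1 := by rw [← hc, ← hNw, mul_one]
    have hts : t = s * (c • S.conj w) := by
      rw [hw, mul_smul_comm, mul_assoc, S.mul_conj, ← Algebra.commutes, ← Algebra.smul_def,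
        smul_smul, mul_comm c, hu, one_smul]
    exact ⟨c • S.conj w * v, by rw [hv]; nth_rewrite 1 [hts]; rw [mul_assoc]⟩
  · exfalso
    rw [← hNs, Ideal.mem_span_singleton] at hp
    obtain ⟨c, hc⟩ := hp
    have hu : S.N t * c = 1 := by
      apply mul_left_cancel₀ hN0
      calc S.N s * (S.N t * c) = S.N t * (S.N s * c) := by ring
        _ = S.N s * 1 := by rw [← hc, ← hNw, mul_one]
    obtain ⟨a, b, hab⟩ := (ht 1).2 (S.mem_right_ideal_of_isUnit (IsUnit.of_mul_eq_one _ hu) 1)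
    have h3 : S.N (h * a) = S.N 1 + S.N (-(s * b)) + S.T (1 * S.conj (-(s * b))) := by
      rw [← S.N_add]; congr 1; rw [hab]; abel
    rw [one_mul, S.T_conj, map_neg S.T, map_one, map_mul] at h3
    have h4 : S.N (-(s * b)) ∈ 𝔭 := by
      have := S.N_smul (-1) (s * b)
      rw [neg_one_smul] at this
      rw [this, map_mul]; exact 𝔭.mul_mem_left _ (𝔭.mul_mem_right _ hNmem)
    apply h𝔭.ne_top
    rw [Ideal.eq_top_iff_one]
    have : (1 : R) = S.N h * S.N a - S.N (-(s * b)) + S.T (s * b) := by rw [h3]; ring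
    rw [this]
    exact add_mem (sub_mem (𝔭.mul_mem_right _ hh) h4) (hsJ b)

end StdInvolution

/-! ### Matrices killing a vector, and the corresponding ideals at a split prime -/

section TwoByTwo

variable {F : Type*} [Field F]

theorem exists_smul_of_dotProduct_eq_zero {v r : Fin 2 → F} (hv : v ≠ 0)
    (h : r 0 * v 0 + r 1 * v 1 = 0) : ∃ c : F, r = c • ![-v 1, v 0] := by
  by_cases h0 : v 0 = 0
  · have h1 : v 1 ≠ 0 := by
      intro h1; apply hv; ext i; fin_cases i <;> simp [h0, h1]
    have hr : r 1 = 0 := by simpa [h0, h1] using h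
    refine ⟨-r 0 / v 1, ?_⟩
    ext i; fin_cases i <;> simp [h0, h1, hr]
  · refine ⟨r 1 / v 0, ?_⟩
    ext i; fin_cases i
    · simp; field_simp; linear_combination h
    · simp [h0]

/-- All rows of a matrix killing $v$ are multiples of $(-v_1,v_0)$, so any nonzero such matrix
generates the whole left annihilator. -/
theorem exists_eq_mul_of_mulVec_eq_zero {v : Fin 2 → F} (hv : v ≠ 0)
    {M Z : Matrix (Fin 2) (Fin 2) F} (hM : M ≠ 0) (hMv : M.mulVec v = 0) (hZ : Z.mulVec v = 0) :
    ∃ W, Z = W * M := by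
  have key : ∀ A : Matrix (Fin 2) (Fin 2) F, A.mulVec v = 0 → ∀ i, ∃ c : F, A i = c • ![-v 1, v 0] :=
    fun A hA i => exists_smul_of_dotProduct_eq_zero hv (by
      have := congrFun hA i
      simpa [Matrix.mulVec, dotProduct] using this)
  choose m hm using key M hMv
  choose z hz using key Z hZ
  obtain ⟨i, hi⟩ : ∃ i, m i ≠ 0 := by
    by_contra! h
    apply hM
    ext i j
    rw [hm i, h i]; simp
  refine ⟨Matrix.of fun a b => if b = i then z a / m i else 0, ?_⟩
  ext a j
  rw [hz a]
  simp [Matrix.mul_apply, hm i, ← mul_assoc, hi]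

theorem exists_ne_zero_mulVec_eq_zero {v : Fin 2 → F} (hv : v ≠ 0) :
    ∃ M : Matrix (Fin 2) (Fin 2) F, M ≠ 0 ∧ M.mulVec v = 0 := by
  refine ⟨!![-v 1, v 0; -v 1, v 0], ?_, ?_⟩
  · intro h
    apply hv
    have h0 := congrFun (congrFun h 0) 0
    have h1 := congrFun (congrFun h 0) 1
    ext i; fin_cases i
    · simpa using h1
    · simpa using h0
  · ext i; fin_cases i <;> simp [Matrix.mulVec, dotProduct] <;> ring

theorem det_eq_zero_of_mulVec_eq_zero {v : Fin 2 → F} (hv : v ≠ 0)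
    {M : Matrix (Fin 2) (Fin 2) F} (hMv : M.mulVec v = 0) : M.det = 0 :=
  Matrix.exists_mulVec_eq_zero_iff.1 ⟨v, hv, hMv⟩

end TwoByTwo

namespace StdInvolution

variable {R H : Type*} [CommRing R] [Ring H] [Algebra R H] (S : StdInvolution R H)

namespace Splitting

variable {S} {𝔭 : Ideal R} (σ : S.Splitting 𝔭)

include σ in
theorem nondegenerateAt (h𝔭 : 𝔭.IsMaximal) : S.NondegenerateAt 𝔭 := by
  let := Ideal.Quotient.field 𝔭
  intro x hx
  rw [← σ.ker]
  have htr : ∀ y, (σ.toFun y).trace = Ideal.Quotient.mk 𝔭 (S.T y) := by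
    intro y
    have h := congrArg σ.toFun (S.add_conj y)
    rw [map_add, σ.map_conj, AlgHom.commutes, Matrix.adjugate_fin_two] at h
    have := congrFun (congrFun h 0) 0
    simpa [Matrix.algebraMap_matrix_apply, Matrix.trace_fin_two] using this
  ext i j
  obtain ⟨y, hy⟩ := σ.surj (Matrix.single j i 1)
  have h := htr (x * y)
  rw [Ideal.Quotient.eq_zero_iff_mem.2 (hx y), map_mul, hy, Matrix.trace_mul_single] at h
  simpa using h

/-- The elements whose conjugates annihilate the vector `v` modulo `𝔭`. -/
def conjAnnihilator (v : Fin 2 → R ⧸ 𝔭) : Submodule R H where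
  carrier := {x | (σ.toFun (S.conj x)).mulVec v = 0}
  add_mem' {x y} hx hy := by
    change (σ.toFun (S.conj (x + y))).mulVec v = 0
    rw [map_add, map_add, Matrix.add_mulVec, hx, hy, add_zero]
  zero_mem' := by
    change (σ.toFun (S.conj 0)).mulVec v = 0
    simp
  smul_mem' r x hx := by
    change (σ.toFun (S.conj (r • x))).mulVec v = 0
    rw [map_smul, map_smul, Matrix.smul_mulVec, hx, smul_zero]

theorem mem_conjAnnihilator {v : Fin 2 → R ⧸ 𝔭} {x : H} :
    x ∈ σ.conjAnnihilator v ↔ (σ.toFun (S.conj x)).mulVec v = 0 := Iff.rfl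

/-- Conjugation turns the left ideal of elements killing $v$ into a right ideal, the side on which
the class number hypothesis acts. -/
theorem conjAnnihilator_mul_mem {v : Fin 2 → R ⧸ 𝔭} {x : H} (hx : x ∈ σ.conjAnnihilator v)
    (h : H) : x * h ∈ σ.conjAnnihilator v := by
  rw [mem_conjAnnihilator] at hx ⊢
  rw [S.conj_mul, map_mul, ← Matrix.mulVec_mulVec, hx, Matrix.mulVec_zero]

theorem smul_top_le_conjAnnihilator (v : Fin 2 → R ⧸ 𝔭) :
    𝔭 • (⊤ : Submodule R H) ≤ σ.conjAnnihilator v := by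
  intro x hx
  rw [mem_conjAnnihilator, (σ.ker _).2 (S.conj_mem_of_mem hx), Matrix.zero_mulVec]

theorem exists_mem_conjAnnihilator [h𝔭 : 𝔭.IsMaximal] {v : Fin 2 → R ⧸ 𝔭} (hv : v ≠ 0) :
    ∃ y ∈ σ.conjAnnihilator v, y ∉ 𝔭 • (⊤ : Submodule R H) := by
  let := Ideal.Quotient.field 𝔭
  obtain ⟨M, hM, hMv⟩ := exists_ne_zero_mulVec_eq_zero hv
  obtain ⟨y, hy⟩ := σ.surj M
  refine ⟨S.conj y, ?_, fun h => hM ?_⟩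
  · rw [mem_conjAnnihilator, S.conj_conj, hy, hMv]
  · rw [← hy, σ.ker, ← S.conj_conj y]; exact S.conj_mem_of_mem h

theorem N_mem_of_mem_conjAnnihilator [h𝔭 : 𝔭.IsMaximal] {v : Fin 2 → R ⧸ 𝔭} (hv : v ≠ 0) {y : H}
    (hy : y ∈ σ.conjAnnihilator v) : S.N y ∈ 𝔭 := by
  let := Ideal.Quotient.field 𝔭
  rw [← S.N_conj, ← Ideal.Quotient.eq_zero_iff_mem, ← σ.det]
  exact det_eq_zero_of_mulVec_eq_zero hv hy

theorem exists_sub_mul_mem [h𝔭 : 𝔭.IsMaximal] {v : Fin 2 → R ⧸ 𝔭} (hv : v ≠ 0) {x y : H}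
    (hx : x ∈ σ.conjAnnihilator v) (hy : y ∈ σ.conjAnnihilator v)
    (hy0 : y ∉ 𝔭 • (⊤ : Submodule R H)) : ∃ h, x - y * h ∈ 𝔭 • (⊤ : Submodule R H) := by
  let := Ideal.Quotient.field 𝔭
  have hM : σ.toFun (S.conj y) ≠ 0 := by
    intro h
    rw [σ.ker] at h
    exact hy0 (S.conj_conj y ▸ S.conj_mem_of_mem h)
  obtain ⟨W, hW⟩ := exists_eq_mul_of_mulVec_eq_zero hv hM hy hx
  obtain ⟨w, rfl⟩ := σ.surj W
  refine ⟨S.conj w, ?_⟩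
  have : S.conj x - w * S.conj y ∈ 𝔭 • (⊤ : Submodule R H) := by
    rw [← σ.ker, map_sub, hW, map_mul, sub_self]
  have := S.conj_mem_of_mem this
  rwa [map_sub, S.conj_conj, S.conj_mul, S.conj_conj] at this

/-- The right ideal `conjAnnihilator v` is locally principal at `𝔭`. -/
theorem exists_local_generator [IsDedekindDomain R] [h𝔭 : 𝔭.IsMaximal] (h0 : 𝔭 ≠ ⊥)
    {v : Fin 2 → R ⧸ 𝔭} (hv : v ≠ 0) : ∃ y ∈ σ.conjAnnihilator v, ∀ x ∈ σ.conjAnnihilator v,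
      ∃ h, x - y * h ∈ 𝔭 • σ.conjAnnihilator v := by
  have hp2 : ∀ {c d : R}, c ∉ 𝔭 ^ 2 → d ∉ 𝔭 → c * d ∉ 𝔭 ^ 2 ∨ c ∉ 𝔭 := by
    intro c d hc hd
    by_contra! h
    obtain ⟨b, hb⟩ := exists_mul_sub_one_mem h𝔭 hd
    apply hc
    have : c = (c * d) * b - c * (b * d - 1) := by ring
    rw [this]
    refine sub_mem (Ideal.mul_mem_right _ _ h.1) ?_
    rw [pow_two]
    exact Ideal.mul_mem_mul h.2 hb
  -- If $N(y)\in\mathfrak p^2$, add $c\bar z$ with $c\in\mathfrak p\setminus\mathfrak p^2$ and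
  -- $T(yz)\notin\mathfrak p$: modulo $\mathfrak p^2$ the norm changes by $cT(yz)$, which is not in
  -- $\mathfrak p^2$.
  obtain ⟨y, hy, hy0, hyN⟩ : ∃ y ∈ σ.conjAnnihilator v, y ∉ 𝔭 • (⊤ : Submodule R H) ∧
      S.N y ∉ 𝔭 ^ 2 := by
    obtain ⟨y, hy, hy0⟩ := σ.exists_mem_conjAnnihilator hv
    by_cases hyN : S.N y ∈ 𝔭 ^ 2
    · obtain ⟨z, hz⟩ : ∃ z, S.T (y * z) ∉ 𝔭 := by
        by_contra! h; exact hy0 (σ.nondegenerateAt h𝔭 y h)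
      obtain ⟨c, hc, hc2⟩ := Ideal.exists_mem_pow_notMem_pow_succ 𝔭 h0 h𝔭.ne_top 1
      rw [pow_one] at hc
      have hcz : c • S.conj z ∈ 𝔭 • (⊤ : Submodule R H) := Submodule.smul_mem_smul hc trivial
      refine ⟨y + c • S.conj z, add_mem hy (σ.smul_top_le_conjAnnihilator v hcz), ?_, ?_⟩
      · intro h
        exact hy0 (by simpa using sub_mem h hcz)
      · intro h
        rw [S.N_add, map_smul S.conj, S.conj_conj, mul_smul_comm, map_smul S.T,
          smul_eq_mul] at h
        have h1 : c * S.T (y * z) ∈ 𝔭 ^ 2 := by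
          have := sub_mem h (add_mem hyN (S.N_mem_sq_of_mem hcz))
          simpa using this
        exact (hp2 hc2 hz).elim (fun h => h h1) (fun h => h hc)
    · exact ⟨y, hy, hy0, hyN⟩
  have hyp := σ.N_mem_of_mem_conjAnnihilator hv hy
  have hsup : Ideal.span {S.N y} ⊔ 𝔭 ^ 2 = 𝔭 := by
    have := h𝔭.isPrime
    have h := Ideal.eq_prime_pow_of_succ_lt_of_le (P := 𝔭) (i := 1)
      (I := Ideal.span {S.N y} ⊔ 𝔭 ^ 2) h0 ?_ ?_
    · rwa [pow_one] at h
    · refine lt_of_le_of_ne le_sup_right fun h => hyN ?_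
      have h2 : S.N y ∈ Ideal.span {S.N y} ⊔ 𝔭 ^ 2 :=
        Ideal.mem_sup_left (Ideal.mem_span_singleton_self _)
      rw [← h] at h2
      exact h2
    · rw [pow_one]
      exact sup_le ((Ideal.span_singleton_le_iff_mem _).2 hyp) (Ideal.pow_le_self two_ne_zero)
  -- As $N(y)=y\bar y$ generates `𝔭` modulo $\mathfrak p^2$, one has $\mathfrak pH\subseteq
  -- yH+\mathfrak p^2H$, and $\mathfrak p^2H$ lies in `𝔭` times the ideal.
  have hP : ∀ z ∈ 𝔭 • (⊤ : Submodule R H), ∃ h, z - y * h ∈ 𝔭 • σ.conjAnnihilator v := by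
    intro z hz
    refine Submodule.smul_induction_on hz (fun r hr n _ => ?_) ?_
    · rw [← hsup, Submodule.mem_sup] at hr
      obtain ⟨a, ha, b, hb, rfl⟩ := hr
      obtain ⟨c, rfl⟩ := Ideal.mem_span_singleton'.1 ha
      refine ⟨S.conj y * c • n, ?_⟩
      have : (c * S.N y + b) • n - y * (S.conj y * c • n) = b • n := by
        rw [← mul_assoc, S.mul_conj, ← Algebra.smul_def, smul_smul, mul_comm (S.N y), add_smul]
        abel
      rw [this]
      have h2 : b • n ∈ (𝔭 ^ 2) • (⊤ : Submodule R H) := Submodule.smul_mem_smul hb trivial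
      rw [pow_two, Submodule.mul_smul] at h2
      exact Submodule.smul_mono le_rfl (σ.smul_top_le_conjAnnihilator v) h2
    · rintro a b ⟨h, hh⟩ ⟨h', hh'⟩
      refine ⟨h + h', ?_⟩
      have := add_mem hh hh'
      convert this using 1
      rw [mul_add]; abel
  refine ⟨y, hy, fun x hx => ?_⟩
  obtain ⟨h, hh⟩ := σ.exists_sub_mul_mem hv hx hy hy0
  obtain ⟨h', hh'⟩ := hP _ hh
  exact ⟨h + h', by rwa [mul_add, ← sub_sub]⟩

/-- If `conjAnnihilator v` is principal, then so is the left ideal annihilating `v`. -/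
theorem exists_generator [IsDedekindDomain R] [h𝔭 : 𝔭.IsMaximal] (h0 : 𝔭 ≠ ⊥)
    {v : Fin 2 → R ⧸ 𝔭} (hv : v ≠ 0)
    (hI : ∃ s, ∀ x, x ∈ σ.conjAnnihilator v ↔ ∃ h, x = s * h) :
    ∃ s, Ideal.span {S.N s} = 𝔭 ∧ ∀ h, (σ.toFun h).mulVec v = 0 ↔ ∃ t, h = t * s := by
  obtain ⟨s, hs⟩ := hI
  obtain ⟨y, hy, hy0⟩ := σ.exists_mem_conjAnnihilator hv
  refine ⟨S.conj s, ?_, fun h => ?_⟩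
  · rw [S.N_conj]
    refine S.span_N_eq h𝔭.isPrime h0
      (fun x hx => (hs x).1 (σ.smul_top_le_conjAnnihilator v hx))
      ⟨1, fun h hh => hv ?_⟩ ?_
    · have := (hs 1).2 ⟨h, hh⟩
      rw [mem_conjAnnihilator, S.conj_one, map_one, Matrix.one_mulVec] at this
      exact this
    · intro hsP
      obtain ⟨h, rfl⟩ := (hs y).1 hy
      exact hy0 (smul_top_mul_mem h hsP)
  · have := hs (S.conj h)
    rw [mem_conjAnnihilator, S.conj_conj] at this
    rw [this]
    constructor
    · rintro ⟨t, ht⟩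
      exact ⟨S.conj t, by rw [← S.conj_mul, ← ht, S.conj_conj]⟩
    · rintro ⟨t, rfl⟩
      exact ⟨S.conj t, by rw [S.conj_mul, S.conj_conj]⟩

end Splitting

end StdInvolution

/-! ### Orders of quaternion algebras carry an integral standard involution -/

namespace QuatRep
open Polynomial

section Field

variable {K : Type*} [Field K] {a b : K} {H : Subalgebra (𝓞 K) (QuatAlg K a b)}

theorem trd_algebraMap (c : K) : trd (algebraMap K (QuatAlg K a b) c) = 2 * c := by
  simp [trd, QuaternionAlgebra.algebraMap_eq]; ring

theorem nrd_algebraMap (c : K) : nrd (algebraMap K (QuatAlg K a b) c) = c ^ 2 := by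
  rw [nrd_eq]; simp [QuaternionAlgebra.algebraMap_eq]

theorem mul_self_eq (x : QuatAlg K a b) :
    x * x = algebraMap K _ (trd x) * x - algebraMap K _ (nrd x) := by
  rw [coe_nrd, coe_trd, add_mul]
  have : Commute (star x) x := (star_comm_self (x := x))
  rw [this.eq]; abel

theorem IsQuatOrder.isIntegral (hH : IsQuatOrder H) {x : QuatAlg K a b} (hx : x ∈ H) :
    IsIntegral (𝓞 K) x :=
  IsIntegral.of_mem_of_fg H hH.fg x hx

theorem algebraMap_eq_algebraMap (r : 𝓞 K) :
    algebraMap (𝓞 K) (QuatAlg K a b) r = algebraMap K (QuatAlg K a b) (algebraMap (𝓞 K) K r) := rfl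

theorem nrd_mul (x y : QuatAlg K a b) : nrd (x * y) = nrd x * nrd y := by
  simp only [nrd_eq]; simp; ring

theorem trd_add (x y : QuatAlg K a b) : trd (x + y) = trd x + trd y := by
  simp [trd]; ring

theorem trd_smul (r : K) (x : QuatAlg K a b) : trd (r • x) = r * trd x := by
  simp [trd]; ring

theorem coe_injective_ringOfIntegers : Function.Injective (algebraMap (𝓞 K) K) :=
  NumberField.RingOfIntegers.coe_injective

theorem IsQuatOrder.module_finite (hH : IsQuatOrder H) : Module.Finite (𝓞 K) H :=
  Module.Finite.of_fg hH.fg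

theorem IsQuatOrder.isTorsionFree : Module.IsTorsionFree (𝓞 K) H := by
  have : Module.IsTorsionFree (𝓞 K) (QuatAlg K a b) := .trans_faithfulSMul (𝓞 K) K _
  exact Function.Injective.moduleIsTorsionFree (Subtype.val : H → QuatAlg K a b)
    Subtype.val_injective (fun _ _ => rfl)

end Field

section Integrality

variable {K : Type*} [Field K] [NumberField K] {a b : K} {H : Subalgebra (𝓞 K) (QuatAlg K a b)}

/-- Off $K$, the polynomial $X^2-\mathrm{trd}(x)X+\mathrm{nrd}(x)$ is the minimal polynomial of $x$.
It divides a monic polynomial with integral coefficients, hence has integral coefficients itself. -/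
theorem isIntegral_trd_nrd {x : QuatAlg K a b} (hx : IsIntegral (𝓞 K) x) :
    IsIntegral (𝓞 K) (trd x) ∧ IsIntegral (𝓞 K) (nrd x) := by
  by_cases hxK : x ∈ (algebraMap K (QuatAlg K a b)).range
  · obtain ⟨c, rfl⟩ := hxK
    have hc : IsIntegral (𝓞 K) c :=
      (isIntegral_algebraMap_iff (algebraMap K (QuatAlg K a b)).injective).1 hx
    rw [trd_algebraMap, nrd_algebraMap, two_mul]
    exact ⟨hc.add hc, hc.pow 2⟩
  · obtain ⟨p, hp, hpx⟩ := hx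
    set q : K[X] := X ^ 2 + (C (-trd x) * X + C (nrd x)) with hq
    have hdeg : (C (-trd x) * X + C (nrd x)).degree < 2 := by
      compute_degree!
    have hqm : q.Monic := monic_X_pow_add hdeg
    have hqdeg : q.natDegree = 2 := by
      rw [hq]; compute_degree!
    have hqx : aeval x q = 0 := by
      simp only [hq, map_add, map_mul, aeval_X, aeval_C, map_neg, pow_two, mul_self_eq]
      noncomm_ring
    have hint : IsIntegral K x := ⟨q, hqm, hqx⟩
    have hmin : minpoly K x = q := by
      refine (eq_of_monic_of_dvd_of_natDegree_le (minpoly.monic hint) hqm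
        (minpoly.dvd K x hqx) ?_).symm
      rw [hqdeg]
      exact (minpoly.two_le_natDegree_iff hint).2 hxK
    have hdvd : q ∣ p.map (algebraMap (𝓞 K) K) := by
      rw [← hmin]
      apply minpoly.dvd
      rw [aeval_map_algebraMap]
      exact hpx
    have := Polynomial.isIntegral_coeff_of_dvd p q hp hqm hdvd
    have h1 := this 1
    have h0 := this 0
    simp [hq, coeff_X, coeff_C] at h1 h0
    exact ⟨h1, h0⟩

theorem IsQuatOrder.exists_trd (hH : IsQuatOrder H) {x : QuatAlg K a b} (hx : x ∈ H) :
    ∃ r : 𝓞 K, algebraMap (𝓞 K) K r = trd x :=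
  IsIntegrallyClosed.isIntegral_iff.1 (isIntegral_trd_nrd (hH.isIntegral hx)).1

theorem IsQuatOrder.exists_nrd (hH : IsQuatOrder H) {x : QuatAlg K a b} (hx : x ∈ H) :
    ∃ r : 𝓞 K, algebraMap (𝓞 K) K r = nrd x :=
  IsIntegrallyClosed.isIntegral_iff.1 (isIntegral_trd_nrd (hH.isIntegral hx)).2

theorem IsQuatOrder.star_mem (hH : IsQuatOrder H) {x : QuatAlg K a b} (hx : x ∈ H) :
    star x ∈ H := by
  obtain ⟨r, hr⟩ := hH.exists_trd hx
  have : star x = algebraMap (𝓞 K) _ r - x := by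
    rw [algebraMap_eq_algebraMap, hr, coe_trd]; abel
  rw [this]
  exact sub_mem (H.algebraMap_mem r) hx

/-- The standard involution on an order. -/
def involution (hH : IsQuatOrder H) : StdInvolution (𝓞 K) H where
  conj :=
    { toFun := fun x => ⟨star (x : QuatAlg K a b), hH.star_mem x.2⟩
      map_add' := fun x y => Subtype.ext (by simp)
      map_smul' := fun r x => Subtype.ext (by
        simp only [Subalgebra.coe_smul, RingHom.id_apply]
        rw [Algebra.smul_def, star_mul, Algebra.smul_def, algebraMap_eq_algebraMap,
          Algebra.commutes]
        congr 1
        ext <;> simp [QuaternionAlgebra.algebraMap_eq]) }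
  T :=
    { toFun := fun x => (hH.exists_trd x.2).choose
      map_add' := fun x y => coe_injective_ringOfIntegers (by
        rw [(hH.exists_trd (x + y).2).choose_spec, map_add, (hH.exists_trd x.2).choose_spec,
          (hH.exists_trd y.2).choose_spec, Subalgebra.coe_add, trd_add])
      map_smul' := fun r x => coe_injective_ringOfIntegers (by
        rw [(hH.exists_trd (r • x).2).choose_spec, smul_eq_mul, map_mul,
          (hH.exists_trd x.2).choose_spec,
          Subalgebra.coe_smul, Algebra.smul_def, algebraMap_eq_algebraMap, ← Algebra.smul_def,
          trd_smul, RingHom.id_apply]) }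
  N :=
    { toFun := fun x => (hH.exists_nrd x.2).choose
      map_one' := coe_injective_ringOfIntegers (by
        rw [(hH.exists_nrd (x := ((1 : H) : QuatAlg K a b)) (1 : H).2).choose_spec]
        simp [nrd_eq])
      map_mul' := fun x y => coe_injective_ringOfIntegers (by
        rw [(hH.exists_nrd (x * y).2).choose_spec, map_mul, (hH.exists_nrd x.2).choose_spec,
          (hH.exists_nrd y.2).choose_spec, Subalgebra.coe_mul, nrd_mul]) }
  inj := by
    intro r s h
    have h2 := congrArg (Subtype.val) h
    exact coe_injective_ringOfIntegers ((algebraMap K (QuatAlg K a b)).injective h2)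
  conj_mul x y := Subtype.ext (by simp)
  add_conj x := Subtype.ext (by
    have := coe_trd (x : QuatAlg K a b)
    rw [← (hH.exists_trd x.2).choose_spec] at this
    exact this.symm)
  mul_conj x := Subtype.ext (by
    have := coe_nrd (x : QuatAlg K a b)
    rw [← (hH.exists_nrd x.2).choose_spec] at this
    exact this.symm)

theorem coe_involution_N (hH : IsQuatOrder H) (x : H) :
    algebraMap (𝓞 K) K ((involution hH).N x) = nrd (x : QuatAlg K a b) :=
  (hH.exists_nrd x.2).choose_spec

theorem coe_involution_T (hH : IsQuatOrder H) (x : H) :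
    algebraMap (𝓞 K) K ((involution hH).T x) = trd (x : QuatAlg K a b) :=
  (hH.exists_trd x.2).choose_spec

/-- Every element of the algebra becomes an element of the order after scaling. -/
theorem IsQuatOrder.exists_smul_mem (hH : IsQuatOrder H) (x : QuatAlg K a b) :
    ∃ d : 𝓞 K, d ≠ 0 ∧ d • x ∈ H := by
  have hx : x ∈ Submodule.span K (Subalgebra.toSubmodule H : Set (QuatAlg K a b)) := by
    rw [hH.span_eq_top]; trivial
  refine Submodule.span_induction (fun x hx => ⟨1, one_ne_zero, by simpa using hx⟩)
    ⟨1, one_ne_zero, by simp⟩ (fun x y _ _ ⟨d, hd, hx⟩ ⟨e, he, hy⟩ => ?_)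
    (fun c x _ ⟨d, hd, hx⟩ => ?_) hx
  · refine ⟨d * e, mul_ne_zero hd he, ?_⟩
    rw [smul_add]
    refine add_mem ?_ ?_
    · rw [mul_comm, mul_smul]; exact H.smul_mem hx e
    · rw [mul_smul]; exact H.smul_mem hy d
  · obtain ⟨r, s, hs, hc⟩ := IsFractionRing.div_surjective (A := 𝓞 K) c
    have hs0 := nonZeroDivisors.ne_zero hs
    refine ⟨s * d, mul_ne_zero hs0 hd, ?_⟩
    have : (s * d) • c • x = r • d • x := by
      rw [← hc, ← algebraMap_smul K (s * d), ← algebraMap_smul K r, ← algebraMap_smul K d,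
        smul_smul, smul_smul, map_mul]
      congr 1
      have : algebraMap (𝓞 K) K s ≠ 0 := by simpa using hs0
      field_simp
    rw [this]
    exact H.smul_mem hx r

theorem IsQuatOrder.exists_mul_ne (hH : IsQuatOrder H) :
    ∃ x y : H, x * y ≠ y * x := by
  obtain ⟨d, hd, hi⟩ := hH.exists_smul_mem (⟨0, 1, 0, 0⟩ : QuatAlg K a b)
  obtain ⟨e, he, hj⟩ := hH.exists_smul_mem (⟨0, 0, 1, 0⟩ : QuatAlg K a b)
  refine ⟨⟨_, hi⟩, ⟨_, hj⟩, fun h => ?_⟩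
  have h2 := congrArg (fun z : H => (z : QuatAlg K a b).imK) h
  have hd' : algebraMap (𝓞 K) K d ≠ 0 := by simpa using hd
  have he' : algebraMap (𝓞 K) K e ≠ 0 := by simpa using he
  have h3 : algebraMap (𝓞 K) K d * algebraMap (𝓞 K) K e +
      algebraMap (𝓞 K) K d * algebraMap (𝓞 K) K e = 0 := by
    simp [Algebra.smul_def] at h2
    linear_combination h2
  exact mul_ne_zero hd' he' (add_self_eq_zero.1 h3)

end Integrality

end QuatRep

/-! ### The index annihilates the quotient of lattices -/

section Adjugate
open Polynomial

variable {R K V : Type*} [CommRing R] [Field K] [Algebra R K]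

/-- Every eigenvalue in an algebraic closure is a root of $p$, hence integral, and the coefficients
are polynomials in the eigenvalues. -/
theorem Matrix.isIntegral_charpoly_coeff {n : Type*} [Fintype n] [DecidableEq n]
    {M : Matrix n n K} {p : R[X]} (hp : p.Monic) (hM : aeval M p = 0) (i : ℕ) :
    IsIntegral R (M.charpoly.coeff i) := by
  set L := AlgebraicClosure K
  set f := algebraMap K L
  rw [← isIntegral_algebraMap_iff (A := K) (B := L) f.injective, ← coeff_map]
  refine Polynomial.isIntegral_coeff_of_factors _
    (by rw [(M.charpoly_monic.map f)]; exact isIntegral_one) (IsAlgClosed.splits _) (fun x hx => ?_) i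
  rw [← Matrix.charpoly_map] at hx
  have hroot : (M.map f).charpoly.IsRoot x := hx
  rw [Polynomial.IsRoot, Matrix.eval_charpoly] at hroot
  obtain ⟨v, hv, hv0⟩ := Matrix.exists_mulVec_eq_zero_iff.2 hroot
  refine ⟨p, hp, ?_⟩
  have hmul : (M.map f).mulVec v = x • v := by
    rw [Matrix.sub_mulVec, sub_eq_zero, Matrix.scalar_apply, Matrix.diagonal_const_mulVec] at hv0
    exact hv0.symm
  have hpow : ∀ k : ℕ, ((M.map f) ^ k).mulVec v = x ^ k • v := by
    intro k
    induction k with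
    | zero => simp
    | succ k ih => rw [pow_succ', ← Matrix.mulVec_mulVec, ih, Matrix.mulVec_smul, hmul, smul_smul,
        pow_succ]
  have h0 : aeval (M.map f) p = 0 := by
    have h := aeval_algHom_apply (IsScalarTower.toAlgHom R K L).mapMatrix M p
    rw [hM, map_zero] at h
    exact h
  have h1 : (aeval (M.map f) p).mulVec v = (aeval x p) • v := by
    rw [aeval_eq_sum_range, aeval_eq_sum_range, Matrix.sum_mulVec, Finset.sum_smul]
    refine Finset.sum_congr rfl fun k _ => ?_
    rw [Matrix.smul_mulVec, hpow, smul_assoc]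
  rw [h0, Matrix.zero_mulVec] at h1
  exact (smul_eq_zero.1 h1.symm).resolve_right hv

variable [AddCommGroup V] [Module R V] [Module K V] [IsScalarTower R K V] [Module.Finite K V]

/-- A lattice-preserving endomorphism multiplies onto `det δ` times the lattice. -/
theorem det_smul_mem_of_map_le [IsIntegrallyClosed R] [IsFractionRing R K]
    {L M : Submodule R V} (hfg : L.FG) (hspan : Submodule.span K (L : Set V) = ⊤) (hML : M ≤ L)
    {δ : V →ₗ[K] V} (hδ : ∀ x ∈ L, δ x ∈ M) {x : V} (hx : x ∈ L) :
    LinearMap.det δ • x ∈ M := by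
  have hfin : Module.Finite R L := Module.Finite.of_fg hfg
  let δL : L →ₗ[R] L := (δ.restrictScalars R).restrict (fun x hx => hML (hδ x hx))
  obtain ⟨p, hp, hpδ⟩ := LinearMap.exists_monic_and_aeval_eq_zero R δL
  have hev : ∀ q : R[X], ∀ z : L, ((aeval δL q) z : V) = (aeval δ q) z := by
    intro q z
    have hpow : ∀ k : ℕ, ((δL ^ k) z : V) = (δ ^ k) z := by
      intro k
      induction k with
      | zero => simp
      | succ k ih =>
        rw [pow_succ', pow_succ', Module.End.mul_apply, Module.End.mul_apply, ← ih]; rfl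
    rw [aeval_eq_sum_range, aeval_eq_sum_range]
    simp [LinearMap.sum_apply, hpow]
  have hpδ' : aeval δ p = 0 := by
    apply LinearMap.ext_on hspan
    intro z hz
    rw [← hev p ⟨z, hz⟩, hpδ]; rfl
  have hcoeff : ∀ i, IsIntegral R (δ.charpoly.coeff i) := by
    intro i
    let b := Module.finBasis K V
    rw [← LinearMap.charpoly_toMatrix δ b]
    refine Matrix.isIntegral_charpoly_coeff hp ?_ i
    have h := aeval_algHom_apply ((LinearMap.toMatrixAlgEquiv b).restrictScalars R) δ p
    rw [hpδ', map_zero] at h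
    exact h
  choose c hc using fun i => IsIntegrallyClosed.isIntegral_iff.1 (hcoeff i)
  have hmem : ∀ k : ℕ, ∀ z ∈ L, (δ ^ k) z ∈ L := by
    intro k
    induction k with
    | zero => intro z hz; simpa using hz
    | succ k ih => intro z hz; rw [pow_succ, Module.End.mul_apply]; exact ih _ (hML (hδ z hz))
  -- Cayley–Hamilton with $\chi=XQ+\chi(0)$: up to sign, $\det\delta\cdot x=\delta(Q(\delta)x)$.
  -- Here $Q$ has integral coefficients, so $Q(\delta)x\in L$ and its image lies in $M$.
  have hQ : (aeval δ δ.charpoly.divX) x ∈ L := by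
    rw [aeval_eq_sum_range, LinearMap.sum_apply]
    refine sum_mem fun k _ => ?_
    rw [coeff_divX, LinearMap.smul_apply, ← hc, algebraMap_smul]
    exact L.smul_mem _ (hmem k x hx)
  have hCH : δ ((aeval δ δ.charpoly.divX) x) + δ.charpoly.coeff 0 • x = 0 := by
    have h := LinearMap.aeval_self_charpoly δ
    rw [← X_mul_divX_add δ.charpoly, map_add, map_mul, aeval_X, aeval_C] at h
    have := congrArg (fun g : V →ₗ[K] V => g x) h
    simpa [Module.algebraMap_end_apply] using this
  have hdet : LinearMap.det δ • x =
      ((-1 : R) ^ (Module.finrank K V) * -1) • δ ((aeval δ δ.charpoly.divX) x) := by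
    rw [eq_neg_of_add_eq_zero_left hCH, LinearMap.det_eq_sign_charpoly_coeff,
      ← algebraMap_smul K ((-1 : R) ^ (Module.finrank K V) * -1)]
    simp [mul_smul]
  rw [hdet]
  exact M.smul_mem _ (hδ _ hQ)

end Adjugate

/-! ### Class number one makes ideals of the maximal order principal -/

namespace QuatRep

section Field

variable {K : Type*} [Field K] {a b : K}

instance isScalarTower_quatAlg : IsScalarTower (𝓞 K) (QuatAlg K a b) (QuatAlg K a b) :=
  IsScalarTower.right

instance smulCommClass_quatAlg : SMulCommClass (𝓞 K) (QuatAlg K a b) (QuatAlg K a b) :=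
  Algebra.to_smulCommClass

theorem integer_smul_def (c : 𝓞 K) (x : QuatAlg K a b) :
    c • x = algebraMap (𝓞 K) (QuatAlg K a b) c * x := Algebra.smul_def c x

theorem rightOrder_toSubmodule (G : Subalgebra (𝓞 K) (QuatAlg K a b)) :
    rightOrder (Subalgebra.toSubmodule G) = G := by
  ext x
  constructor
  · intro h
    have := h 1 G.one_mem
    rwa [one_mul] at this
  · intro h y hy
    exact G.mul_mem hy h

/-- If the class number is one, every lattice with right order `G` is a translate of `G`. -/
theorem exists_eq_mul_of_classNumber_eq_one {G : Subalgebra (𝓞 K) (QuatAlg K a b)}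
    (hG : IsQuatOrder G) (hcls : classNumber G = 1) {J : Submodule (𝓞 K) (QuatAlg K a b)}
    (hJ : Submodule.IsLattice K J) (hJG : rightOrder J = G) :
    ∃ s : QuatAlg K a b, ∀ x, x ∈ J ↔ ∃ g ∈ G, x = s * g := by
  have hsub : Subsingleton (Quotient (rightEquivalent G)) :=
    (Nat.card_eq_one_iff_unique.1 hcls).1
  have h : (rightEquivalent G).r ⟨J, hJ, hJG⟩
      ⟨Subalgebra.toSubmodule G, hG, rightOrder_toSubmodule G⟩ :=
    Quotient.exact (Subsingleton.elim _ _)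
  obtain ⟨s, hs⟩ := h
  refine ⟨s, fun x => ?_⟩
  change x ∈ (J : Set (QuatAlg K a b)) ↔ _
  change (J : Set (QuatAlg K a b)) = _ at hs
  rw [hs]
  constructor
  · rintro ⟨g, hg, rfl⟩; exact ⟨g, hg, rfl⟩
  · rintro ⟨g, hg, rfl⟩; exact ⟨g, hg, rfl⟩

end Field

variable {K : Type*} [Field K] [NumberField K] {a b : K}

/-- This makes $\mathfrak q_1\mathfrak q_2$ act as a conductor: $\mathfrak q_1\mathfrak q_2\mathcal
H\subseteq\mathcal G$. -/
theorem smul_mem_of_mem_latticeIndex {L M : Submodule (𝓞 K) (QuatAlg K a b)}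
    (hL : Submodule.IsLattice K L) (hML : M ≤ L) {c : K} (hc : c ∈ latticeIndex L M)
    {x : QuatAlg K a b} (hx : x ∈ L) : c • x ∈ M := by
  refine Submodule.span_induction ?_ (by simp) (fun c d _ _ h h' => ?_) (fun r c _ h => ?_) hc
  · rintro _ ⟨δ, hδ, rfl⟩
    exact det_smul_mem_of_map_le hL.fg hL.span_eq_top hML hδ hx
  · rw [add_smul]; exact add_mem h h'
  · rw [smul_assoc]; exact M.smul_mem r h

/-- A submodule caught between two multiples of a lattice is a lattice. -/
theorem isLattice_of_smul_mem {L M : Submodule (𝓞 K) (QuatAlg K a b)}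
    (hL : Submodule.IsLattice K L) {c d : 𝓞 K} (hc : c ≠ 0) (hd : d ≠ 0)
    (hLM : ∀ x ∈ L, c • x ∈ M) (hML : ∀ x ∈ M, d • x ∈ L) : Submodule.IsLattice K M := by
  have hinj : ∀ {e : 𝓞 K}, e ≠ 0 → ∀ {x y : QuatAlg K a b}, e • x = e • y → x = y := by
    intro e he x y h
    rw [← algebraMap_smul K e, ← algebraMap_smul K e] at h
    exact smul_right_injective _ (by simpa using he : algebraMap (𝓞 K) K e ≠ 0) h
  refine ⟨?_, ?_⟩
  · have hfin : Module.Finite (𝓞 K) L := Module.Finite.of_fg hL.fg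
    let f : M →ₗ[𝓞 K] L :=
      { toFun := fun x => ⟨d • (x : QuatAlg K a b), hML x x.2⟩
        map_add' := fun x y => Subtype.ext (by simp)
        map_smul' := fun r x => Subtype.ext (by simp [smul_smul, mul_comm]) }
    have : Module.Finite (𝓞 K) M := Module.Finite.of_injective f fun x y h =>
      Subtype.ext (hinj hd (congrArg Subtype.val h))
    exact Module.Finite.iff_fg.1 this
  · rw [eq_top_iff, ← hL.span_eq_top, Submodule.span_le]
    intro x hx
    have h1 : c • x ∈ Submodule.span K (M : Set (QuatAlg K a b)) := Submodule.subset_span (hLM x hx)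
    rw [← algebraMap_smul K c] at h1
    have hc' : algebraMap (𝓞 K) K c ≠ 0 := by simpa using hc
    have h2 := Submodule.smul_mem _ (algebraMap (𝓞 K) K c)⁻¹ h1
    rwa [smul_smul, inv_mul_cancel₀ hc', one_smul] at h2

section Division

variable [NumberField.IsTotallyReal K]

theorem exists_realEmbedding (K : Type*) [Field K] [NumberField K]
    [NumberField.IsTotallyReal K] : Nonempty (K →+* ℝ) := by
  obtain ⟨w⟩ := (inferInstance : Nonempty (NumberField.InfinitePlace K))
  exact ⟨NumberField.InfinitePlace.embedding_of_isReal
    (NumberField.IsTotallyReal.isReal w)⟩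

theorem IsDefinite.nrd_ne_zero (hdef : IsDefinite a b) {x : QuatAlg K a b} (hx : x ≠ 0) :
    nrd x ≠ 0 := by
  obtain ⟨φ⟩ := exists_realEmbedding K
  intro h
  have := hdef x hx φ
  rw [h, map_zero] at this
  exact lt_irrefl _ this

theorem IsDefinite.isUnit (hdef : IsDefinite a b) {x : QuatAlg K a b} (hx : x ≠ 0) : IsUnit x := by
  have hn := hdef.nrd_ne_zero hx
  rw [isUnit_iff_exists]
  refine ⟨(nrd x)⁻¹ • star x, ?_, ?_⟩
  · rw [mul_smul_comm, ← coe_nrd, Algebra.smul_def, ← map_mul, inv_mul_cancel₀ hn, map_one]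
  · have : Commute (star x) x := star_comm_self (x := x)
    rw [smul_mul_assoc, this.eq, ← coe_nrd, Algebra.smul_def, ← map_mul, inv_mul_cancel₀ hn,
      map_one]

theorem IsDefinite.mul_left_cancel (hdef : IsDefinite a b) {x y z : QuatAlg K a b} (hx : x ≠ 0)
    (h : x * y = x * z) : y = z := (hdef.isUnit hx).mul_left_cancel h

end Division

/-- Right ideals of `H` that are locally generated by one element at the primes dividing the
conductor of an order `G` of class number one are principal. -/
theorem exists_generator_of_local_generator [NumberField.IsTotallyReal K] (hdef : IsDefinite a b)
    {G H : Subalgebra (𝓞 K) (QuatAlg K a b)} (hH : IsMaximalOrder H) (hG : IsQuatOrder G)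
    (hGH : G ≤ H) (hcls : classNumber G = 1) {𝔪 : Ideal (𝓞 K)} (h𝔪 : 𝔪 ≠ ⊤) (h𝔪0 : 𝔪 ≠ ⊥)
    (hcond : ∀ c ∈ 𝔪, ∀ x ∈ H, c • x ∈ G) (I : Submodule (𝓞 K) H)
    (hI : ∀ x ∈ I, ∀ h, x * h ∈ I) {c : 𝓞 K} (hc : c ≠ 0) (hcI : algebraMap (𝓞 K) H c ∈ I)
    {y : H} (hy : y ∈ I) (hyI : ∀ x ∈ I, ∃ h, x - y * h ∈ 𝔪 • I) :
    ∃ s : H, ∀ x, x ∈ I ↔ ∃ h, x = s * h := by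
  set IA : Submodule (𝓞 K) (QuatAlg K a b) := I.map H.val.toLinearMap with hIA
  have hmemIA : ∀ {x}, x ∈ IA ↔ ∃ h : x ∈ H, (⟨x, h⟩ : H) ∈ I := by
    intro x
    constructor
    · rintro ⟨z, hz, rfl⟩; exact ⟨z.2, hz⟩
    · rintro ⟨h, hx⟩; exact ⟨⟨x, h⟩, hx, rfl⟩
  have hIAH : ∀ {x}, x ∈ IA → x ∈ H := fun hx => (hmemIA.1 hx).1
  have hIAmul : ∀ {x h}, x ∈ IA → h ∈ H → x * h ∈ IA := by
    intro x h hx hh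
    obtain ⟨hxH, hx⟩ := hmemIA.1 hx
    exact hmemIA.2 ⟨H.mul_mem hxH hh, hI _ hx ⟨h, hh⟩⟩
  have hcIA : ∀ x ∈ H, c • x ∈ IA := by
    intro x hx
    rw [integer_smul_def]
    exact hIAmul (hmemIA.2 ⟨H.algebraMap_mem c, hcI⟩) hx
  have hIAlat : Submodule.IsLattice K IA :=
    isLattice_of_smul_mem (L := Subalgebra.toSubmodule H) hH.1 hc one_ne_zero hcIA
      (fun x hx => by rw [one_smul]; exact hIAH hx)
  -- The right order contains `H`, and $cx\in H$ for each $x$ in it shows that it is an order;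
  -- maximality leaves only `H`.
  have hIAord : rightOrder IA = H := by
    apply hH.2
    · refine isLattice_of_smul_mem (L := Subalgebra.toSubmodule H) hH.1 one_ne_zero hc
        (fun x hx => ?_) (fun x hx => ?_)
      · rw [one_smul]; exact fun y hy => hIAmul hy hx
      · have := hx _ (hcIA 1 H.one_mem)
        rw [smul_mul_assoc, one_mul] at this
        exact hIAH this
    · exact fun x hx y hy => hIAmul hy hx
  -- $J=yG+\mathfrak mI$ is a sublattice of $I$ designed to have right order exactly `G`, so that
  -- the class number hypothesis applies to it.
  set J : Submodule (𝓞 K) (QuatAlg K a b) :=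
    (Subalgebra.toSubmodule G).map (LinearMap.mulLeft (𝓞 K) (y : QuatAlg K a b)) ⊔ 𝔪 • IA with hJ
  have hmemJ : ∀ {x}, x ∈ J ↔ ∃ g ∈ G, ∃ w ∈ 𝔪 • IA, (y : QuatAlg K a b) * g + w = x := by
    intro x
    rw [hJ, Submodule.mem_sup]
    constructor
    · rintro ⟨_, ⟨g, hg, rfl⟩, w, hw, rfl⟩
      exact ⟨g, hg, w, hw, rfl⟩
    · rintro ⟨g, hg, w, hw, rfl⟩
      exact ⟨_, ⟨g, hg, rfl⟩, w, hw, rfl⟩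
  have hyIA : (y : QuatAlg K a b) ∈ IA := hmemIA.2 ⟨y.2, hy⟩
  have hJIA : ∀ {x}, x ∈ J → x ∈ IA := by
    intro x hx
    obtain ⟨g, hg, w, hw, rfl⟩ := hmemJ.1 hx
    exact add_mem (hIAmul hyIA (hGH hg)) (Submodule.smul_le_right hw)
  have hmJ : ∀ {w}, w ∈ 𝔪 • IA → w ∈ J := fun hw => Submodule.mem_sup_right hw
  have hmIAmul : ∀ {x h}, x ∈ 𝔪 • IA → h ∈ H → x * h ∈ 𝔪 • IA := by
    intro x h hx hh
    refine Submodule.smul_induction_on hx (fun r hr n hn => ?_) (fun a b ha hb => ?_)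
    · rw [smul_mul_assoc]; exact Submodule.smul_mem_smul hr (hIAmul hn hh)
    · rw [add_mul]; exact add_mem ha hb
  obtain ⟨μ, hμ, hμ0⟩ := Submodule.exists_mem_ne_zero_of_ne_bot h𝔪0
  have hJlat : Submodule.IsLattice K J := by
    refine isLattice_of_smul_mem (L := Subalgebra.toSubmodule H) hH.1 (mul_ne_zero hμ0 hc)
      one_ne_zero (fun x hx => ?_) (fun x hx => by rw [one_smul]; exact hIAH (hJIA hx))
    rw [mul_smul]
    exact hmJ (Submodule.smul_mem_smul hμ (hcIA x hx))
  have hdec : ∀ x ∈ IA, ∃ h ∈ H, ∃ w ∈ 𝔪 • IA, x = (y : QuatAlg K a b) * h + w := by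
    intro x hx
    obtain ⟨hxH, hx⟩ := hmemIA.1 hx
    obtain ⟨h, hh⟩ := hyI _ hx
    refine ⟨h, h.2, x - y * h, ?_, by abel⟩
    have := Submodule.mem_map_of_mem (f := H.val.toLinearMap) hh
    rw [Submodule.map_smul''] at this
    exact this
  have hJord : rightOrder J = G := by
    apply le_antisymm
    · intro x hx
      have h1 : ∀ v ∈ 𝔪, v • x ∈ H := by
        intro v hv
        rw [← hIAord]
        intro z hz
        have h2 := hx _ (hmJ (Submodule.smul_mem_smul hv hz))
        rw [smul_mul_assoc] at h2
        rw [mul_smul_comm]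
        exact hJIA h2
      set YH : Submodule (𝓞 K) (QuatAlg K a b) :=
        (Subalgebra.toSubmodule H).map (LinearMap.mulLeft (𝓞 K) (y : QuatAlg K a b))
      -- Nakayama gives $r\equiv1$ modulo `𝔪` with $rI\subseteq yH$, hence $r\mathfrak mI\subseteq
      -- yG$. If $x$ is in the right order of $J$, then $yx\in J$ yields $rx\in G$ after cancelling
      -- $y$.
      obtain ⟨r, hr, hrY⟩ := Submodule.exists_sub_one_mem_and_smul_le_of_fg_of_le_sup
        (N := YH) (I := 𝔪) hIAlat.fg le_rfl (fun x hx => by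
          obtain ⟨h, hh, w, hw, rfl⟩ := hdec x hx
          exact Submodule.add_mem_sup ⟨h, hh, rfl⟩ hw)
      have hrY' : ∀ z ∈ IA, ∃ h ∈ H, r • z = y * h := by
        intro z hz
        obtain ⟨h, hh, he⟩ := hrY (Submodule.smul_mem_pointwise_smul z r IA hz)
        exact ⟨h, hh, he.symm⟩
      have hr0 : r ≠ 0 := by
        rintro rfl
        apply h𝔪
        rw [Ideal.eq_top_iff_one]
        simpa using hr
      have hy0 : (y : QuatAlg K a b) ≠ 0 := by
        intro h0
        obtain ⟨h, -, he⟩ := hrY' _ (hcIA 1 H.one_mem)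
        rw [h0, zero_mul, smul_smul, integer_smul_def, mul_one, algebraMap_eq_algebraMap,
          map_eq_zero_iff _ (algebraMap K (QuatAlg K a b)).injective] at he
        exact mul_ne_zero hr0 hc (by simpa using he)
      have h3 : ∀ w ∈ 𝔪 • IA, ∃ g ∈ G, r • w = y * g := by
        intro w hw
        refine Submodule.smul_induction_on hw (fun v hv n hn => ?_) ?_
        · obtain ⟨h, hh, he⟩ := hrY' n hn
          refine ⟨v • h, hcond v hv h hh, ?_⟩
          rw [smul_comm, he, mul_smul_comm]
        · rintro w w' ⟨g, hg, he⟩ ⟨g', hg', he'⟩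
          exact ⟨g + g', add_mem hg hg', by rw [smul_add, he, he', mul_add]⟩
      have hrx : r • x ∈ G := by
        have h4 : (y : QuatAlg K a b) * x ∈ J :=
          hx _ (hmemJ.2 ⟨1, G.one_mem, 0, zero_mem _, by simp⟩)
        obtain ⟨g, hg, w, hw, he⟩ := hmemJ.1 h4
        obtain ⟨g', hg', he'⟩ := h3 w hw
        have : r • x = r • g + g' := by
          apply hdef.mul_left_cancel hy0
          rw [mul_smul_comm, ← he, smul_add, he', mul_add, mul_smul_comm]
        rw [this]
        exact add_mem (G.smul_mem hg r) hg'
      -- One factor $r-1\in\mathfrak m$ moves $x$ into `H`, the second into `G`. With $rx\in G$ and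
      -- $1=(r-1)^2-r^2+2r$ this gives $x\in G$.
      have h5 : (r - 1) • (r - 1) • x ∈ G := hcond _ hr _ (h1 _ hr)
      have h6 : x = (r - 1) • (r - 1) • x - r • (r • x) + (2 : 𝓞 K) • r • x := by
        simp only [smul_smul, ← sub_smul, ← add_smul]
        rw [show (r - 1) * (r - 1) - r * r + 2 * r = 1 by ring, one_smul]
      rw [h6]
      exact add_mem (sub_mem h5 (G.smul_mem hrx r)) (G.smul_mem hrx 2)
    · intro x hx z hz
      obtain ⟨g, hg, w, hw, rfl⟩ := hmemJ.1 hz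
      exact hmemJ.2 ⟨g * x, G.mul_mem hg hx, w * x, hmIAmul hw (hGH hx), by
        rw [add_mul, mul_assoc]⟩
  -- $J=sG$ contains $y$ and $\mathfrak mI$, so $I=yH+\mathfrak mI\subseteq sH$.
  obtain ⟨s, hs⟩ := exists_eq_mul_of_classNumber_eq_one hG hcls hJlat hJord
  have hsIA : s ∈ IA := hJIA ((hs s).2 ⟨1, G.one_mem, by rw [mul_one]⟩)
  obtain ⟨hsH, hsI⟩ := hmemIA.1 hsIA
  refine ⟨⟨s, hsH⟩, fun x => ⟨fun hx => ?_, ?_⟩⟩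
  · obtain ⟨h, hh, w, hw, he⟩ := hdec x (hmemIA.2 ⟨x.2, hx⟩)
    obtain ⟨g, hg, hyg⟩ := (hs y).1 (hmemJ.2 ⟨1, G.one_mem, 0, zero_mem _, by simp⟩)
    obtain ⟨g', hg', hwg⟩ := (hs w).1 (hmJ hw)
    refine ⟨⟨g * h + g', add_mem (H.mul_mem (hGH hg) hh) (hGH hg')⟩, Subtype.ext ?_⟩
    change (x : QuatAlg K a b) = s * (g * h + g')
    rw [he, hwg, mul_add, ← mul_assoc, ← hyg]
  · rintro ⟨h, rfl⟩
    exact hI _ hsI h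

end QuatRep

namespace StdInvolution

variable {R H : Type*} [CommRing R] [Ring H] [Algebra R H]

/-- Local generators at two coprime ideals combine to one for their product. -/
theorem exists_mul_local_generator {𝔮 𝔯 : Ideal R} (hcop : 𝔮 ⊔ 𝔯 = ⊤) {I : Submodule R H}
    (hI : ∀ x ∈ I, ∀ h, x * h ∈ I) (hqI : 𝔮 • (⊤ : Submodule R H) ≤ I)
    (hloc : ∃ y ∈ I, ∀ x ∈ I, ∃ h, x - y * h ∈ 𝔮 • I) :
    ∃ y ∈ I, ∀ x ∈ I, ∃ h, x - y * h ∈ (𝔮 * 𝔯) • I := by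
  obtain ⟨y, hy, hyI⟩ := hloc
  obtain ⟨f, hf, e, he, hfe⟩ := Submodule.mem_sup.1 (hcop ▸ Submodule.mem_top : (1 : R) ∈ 𝔮 ⊔ 𝔯)
  have hfI : ∀ h, f • h ∈ I := fun h => hqI (Submodule.smul_mem_smul hf trivial)
  -- The witness is $y$ modulo `𝔮` and $1$ modulo `𝔯`. The square of $f$ is needed: $f\cdot h$ is
  -- only known to lie in $I$, so a second factor $f$ puts the correction in $\mathfrak qI$.
  refine ⟨e • y + (f * f) • 1, add_mem (I.smul_mem e hy) (by rw [mul_smul]; exact hfI _),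
    fun x hx => ?_⟩
  obtain ⟨h, hh⟩ := hyI x hx
  refine ⟨e • h + f • x, ?_⟩
  have he1 : e = 1 - f := by rw [← hfe]; ring
  set z := x - (e • y + (f * f) • (1 : H)) * (e • h + f • x) with hz
  have h1 : z ∈ 𝔮 • I := by
    have : z = (x - y * h) + f • ((1 + e) • (y * h) - e • (y * x) - f • (e • h + f • x)) := by
      rw [hz, he1]
      simp only [add_mul, mul_add, smul_mul_assoc, mul_smul_comm, one_mul, smul_sub, smul_add,
        smul_smul]
      module
    rw [this]
    exact add_mem hh (Submodule.smul_mem_smul hf (sub_mem (sub_mem (I.smul_mem _ (hI y hy h))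
      (I.smul_mem _ (hI y hy x))) (hfI _)))
  have h2 : z ∈ 𝔯 • I := by
    have : z = e • ((1 + f + f * f) • x - y * (e • h + f • x) - f • f • h) := by
      rw [hz, he1]
      simp only [add_mul, mul_add, smul_mul_assoc, mul_smul_comm, one_mul, smul_sub, smul_add,
        smul_smul]
      module
    rw [this]
    exact Submodule.smul_mem_smul he (sub_mem (sub_mem (I.smul_mem _ hx) (hI y hy _)) (hfI _))
  have h3 : z = e • z + f • z := by rw [← add_smul, add_comm, hfe, one_smul]
  rw [h3]
  refine add_mem ?_ ?_
  · rw [mul_comm, Submodule.mul_smul]; exact Submodule.smul_mem_smul he h1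
  · rw [Submodule.mul_smul]; exact Submodule.smul_mem_smul hf h2

end StdInvolution

/-! ### Primes away from the conductor; the discriminant and nondegeneracy -/

namespace QuatRep

open StdInvolution

variable {K : Type*} [Field K] [NumberField K] {a b : K}
  {G H : Subalgebra (𝓞 K) (QuatAlg K a b)}

/-- An element $n\in\mathfrak p$ with $n\equiv1$ modulo `𝔪` lies in the ideal and generates it
locally at `𝔪`. -/
theorem principalAbove_of_sup_eq_top [NumberField.IsTotallyReal K] (hdef : IsDefinite a b)
    (hH : IsMaximalOrder H) (hG : IsQuatOrder G)
    (hGH : G ≤ H) (hcls : classNumber G = 1) {𝔪 : Ideal (𝓞 K)} (h𝔪 : 𝔪 ≠ ⊤) (h𝔪0 : 𝔪 ≠ ⊥)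
    (hcond : ∀ c ∈ 𝔪, ∀ x ∈ H, c • x ∈ G) {𝔭 : Ideal (𝓞 K)} (h𝔭 : 𝔭 ≠ ⊥) (hcop : 𝔭 ⊔ 𝔪 = ⊤) :
    PrincipalAbove H 𝔭 := by
  intro I hI hPI
  obtain ⟨c, hc, hc0⟩ := Submodule.exists_mem_ne_zero_of_ne_bot h𝔭
  obtain ⟨n, hn, e, he, hne⟩ :=
    Submodule.mem_sup.1 (hcop ▸ Submodule.mem_top : (1 : 𝓞 K) ∈ 𝔭 ⊔ 𝔪)
  refine exists_generator_of_local_generator hdef hH hG hGH hcls h𝔪 h𝔪0 hcond I hI hc0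
    (hPI (algebraMap_mem_smul_top hc)) (hPI (algebraMap_mem_smul_top hn)) (fun x hx => ⟨x, ?_⟩)
  have : x - algebraMap (𝓞 K) H n * x = e • x := by
    rw [← Algebra.smul_def]
    nth_rewrite 1 [← one_smul (𝓞 K) x]
    rw [← sub_smul, ← hne, add_sub_cancel_left]
  rw [this]
  exact Submodule.smul_mem_smul he hx

omit [NumberField K] in
theorem integral_smul_eq {d : 𝓞 K} {x : QuatAlg K a b} : d • x = algebraMap (𝓞 K) K d • x :=
  (algebraMap_smul K d x).symm

/-- Elements with nonzero Gram determinant span the algebra. -/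
theorem exists_smul_eq_sum (hH : IsQuatOrder H) (x : Fin 4 → H)
    (hx : (Matrix.of fun i j => (involution hH).T (x i * x j)).det ≠ 0) (z : H) :
    ∃ d : 𝓞 K, d ≠ 0 ∧ ∃ c : Fin 4 → 𝓞 K, d • z = ∑ i, c i • x i := by
  set M := Matrix.of fun i j => (involution hH).T (x i * x j) with hM
  have hMK : (M.map (algebraMap (𝓞 K) K)).det ≠ 0 := by
    have := RingHom.map_det (algebraMap (𝓞 K) K) M
    rw [RingHom.mapMatrix_apply] at this
    rw [← this]
    simpa using hx
  let trdL : QuatAlg K a b →ₗ[K] K :=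
    { toFun := trd, map_add' := trd_add, map_smul' := trd_smul }
  have hli : LinearIndependent K (fun i => (x i : QuatAlg K a b)) := by
    rw [Fintype.linearIndependent_iff]
    intro g hg
    have hv : Matrix.vecMul g (M.map (algebraMap (𝓞 K) K)) = 0 := by
      ext j
      have := congrArg (fun w => trdL (w * x j)) hg
      simp only [zero_mul, map_zero, Finset.sum_mul, map_sum, smul_mul_assoc, map_smul] at this
      rw [Pi.zero_apply, ← this]
      simp only [Matrix.vecMul, dotProduct, smul_eq_mul]
      refine Finset.sum_congr rfl fun i _ => ?_
      rw [Matrix.map_apply, hM, Matrix.of_apply, coe_involution_T]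
      rfl
    exact congrFun (Matrix.eq_zero_of_vecMul_eq_zero hMK hv)
  have hspan : Submodule.span K (Set.range fun i => (x i : QuatAlg K a b)) = ⊤ :=
    hli.span_eq_top_of_card_eq_finrank (by
      rw [QuaternionAlgebra.finrank_eq_four, Fintype.card_fin])
  have hz : (z : QuatAlg K a b) ∈ Submodule.span K (Set.range fun i => (x i : QuatAlg K a b)) := by
    rw [hspan]; trivial
  obtain ⟨g, hg⟩ := (Submodule.mem_span_range_iff_exists_fun K).1 hz
  obtain ⟨d, hd⟩ := IsLocalization.exist_integer_multiples_of_finite (nonZeroDivisors (𝓞 K)) g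
  choose c hc using hd
  refine ⟨d, nonZeroDivisors.coe_ne_zero d, c, Subtype.ext ?_⟩
  change (d : 𝓞 K) • (z : QuatAlg K a b) = _
  rw [integral_smul_eq, ← hg, Finset.smul_sum, AddSubmonoidClass.coe_finsetSum]
  refine Finset.sum_congr rfl fun i _ => ?_
  change _ = c i • (x i : QuatAlg K a b)
  rw [integral_smul_eq, hc i, Algebra.smul_def (d : 𝓞 K) (g i), smul_smul]

theorem coe_gram_det (hH : IsQuatOrder H) (x : Fin 4 → H) :
    algebraMap (𝓞 K) K (Matrix.of fun i j => (involution hH).T (x i * x j)).det =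
      (Matrix.of fun i j => trd ((x i : QuatAlg K a b) * (x j : QuatAlg K a b))).det := by
  rw [RingHom.map_det]
  congr 1
  ext i j
  exact coe_involution_T hH _

/-- The trace form of an order is nondegenerate at exactly the primes that do not divide the
reduced discriminant. -/
theorem nondegenerateAt_iff (hH : IsQuatOrder H) {𝔇 : Ideal (𝓞 K)}
    (h𝔇 : IsReducedDiscriminant H 𝔇) {𝔭 : Ideal (𝓞 K)} (h𝔭 : Prime 𝔭) :
    (involution hH).NondegenerateAt 𝔭 ↔ ¬ 𝔭 ∣ 𝔇 := by
  have := hH.module_finite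
  have : Module.IsTorsionFree (𝓞 K) H := IsQuatOrder.isTorsionFree
  have hp := Ideal.isPrime_of_prime h𝔭
  have hmax : 𝔭.IsMaximal := hp.isMaximal h𝔭.ne_zero
  have : Finite (𝓞 K ⧸ 𝔭) := Ideal.finiteQuotientOfFreeOfNeBot 𝔭 h𝔭.ne_zero
  constructor
  · intro hnd hdvd
    obtain ⟨e, he⟩ := (involution hH).exists_matrixUnits hmax hH.exists_mul_ne hnd
    obtain ⟨x, hx⟩ := he.gram_det_notMem
    apply hx
    have h1 : algebraMap (𝓞 K) K (Matrix.of fun i j => (involution hH).T (x i * x j)).det ∈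
        IsLocalization.coeSubmodule K (𝔇 ^ 2) := by
      rw [h𝔇, coe_gram_det]
      exact Submodule.subset_span ⟨fun i => x i, fun i => (x i).2, rfl⟩
    obtain ⟨d, hd, hde⟩ := (IsLocalization.mem_coeSubmodule K _).1 h1
    rw [← coe_injective_ringOfIntegers hde]
    exact Ideal.dvd_iff_le.1 hdvd (Ideal.pow_le_self two_ne_zero hd)
  · intro hndvd
    obtain ⟨x, hx⟩ : ∃ x : Fin 4 → H,
        (Matrix.of fun i j => (involution hH).T (x i * x j)).det ∉ 𝔭 := by
      by_contra! hcon
      apply hndvd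
      apply h𝔭.dvd_of_dvd_pow (n := 2)
      rw [Ideal.dvd_iff_le, ← IsFractionRing.coeSubmodule_le_coeSubmodule (R := 𝓞 K) (K := K), h𝔇]
      apply Submodule.span_le.2
      rintro _ ⟨x, hx, rfl⟩
      rw [SetLike.mem_coe, IsLocalization.mem_coeSubmodule]
      exact ⟨_, hcon fun i => ⟨x i, hx i⟩, coe_gram_det hH _⟩
    exact nondegenerateAt_of_gram _ hmax (exists_smul_eq_sum hH) hx

end QuatRep

/-! ### The suborder as the stabiliser of one line modulo each prime of the index -/

section Borel

variable {F : Type*} [Field F]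

open Matrix

/-- A proper subalgebra of the `2 × 2` matrices that meets every left translate class of rank one
matrices is the stabilizer of a line. -/
theorem exists_eq_stabilizer {S : Submodule F (Matrix (Fin 2) (Fin 2) F)}
    (hmul : ∀ A ∈ S, ∀ B ∈ S, A * B ∈ S) (hone : 1 ∈ S) (htop : S ≠ ⊤)
    (hrank : ∀ φ : Fin 2 → F, φ ≠ 0 → ∃ w : Fin 2 → F, w ≠ 0 ∧ vecMulVec w φ ∈ S) :
    ∃ v : Fin 2 → F, v ≠ 0 ∧ ∀ A, A ∈ S ↔ A *ᵥ v ∈ Submodule.span F {v} := by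
  have hindep : ∀ {x y : Fin 2 → F}, x ≠ 0 → y ∉ Submodule.span F {x} →
      ∀ z, ∃ c d : F, z = c • x + d • y := by
    intro x y hx hy z
    have hli : LinearIndependent F ![x, y] := by
      rw [LinearIndependent.pair_iff' hx]
      intro c hc
      exact hy (Submodule.mem_span_singleton.2 ⟨c, hc⟩)
    have hspan := hli.span_eq_top_of_card_eq_finrank (by simp)
    have hz : z ∈ Submodule.span F (Set.range ![x, y]) := by rw [hspan]; trivial
    rw [Matrix.range_cons, Matrix.range_cons, Matrix.range_empty, Set.union_empty] at hz
    obtain ⟨c, d, h⟩ := Submodule.mem_span_pair.1 hz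
    exact ⟨c, d, h.symm⟩
  have hsum : ∀ A : Matrix (Fin 2) (Fin 2) F,
      A = vecMulVec (A.col 0) ![1, 0] + vecMulVec (A.col 1) ![0, 1] := by
    intro A; ext i j; fin_cases j <;> simp
  -- Without an invariant line, a rank one $w\varphi^T\in S$ and some $A\in S$ with $Aw$ independent
  -- of $w$ give all $x\varphi^T$. This for every $\varphi$ makes $S$ the full matrix algebra.
  obtain ⟨v, hv, hinv⟩ : ∃ v : Fin 2 → F, v ≠ 0 ∧ ∀ A ∈ S, A *ᵥ v ∈ Submodule.span F {v} := by
    by_contra! hcon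
    apply htop
    have hfull : ∀ φ : Fin 2 → F, (∃ w, w ≠ 0 ∧ vecMulVec w φ ∈ S) → ∀ x, vecMulVec x φ ∈ S := by
      rintro φ ⟨w, hw, hS⟩ x
      obtain ⟨A, hA, hAw⟩ := hcon w hw
      obtain ⟨c, d, rfl⟩ := hindep hw hAw x
      rw [add_vecMulVec, smul_vecMulVec, smul_vecMulVec, ← mul_vecMulVec]
      exact add_mem (S.smul_mem _ hS) (S.smul_mem _ (hmul _ hA _ hS))
    have hall : ∀ φ : Fin 2 → F, ∀ x, vecMulVec x φ ∈ S := by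
      intro φ
      by_cases hφ : φ = 0
      · intro x; subst hφ; simp
      · exact hfull φ (hrank φ hφ)
    rw [eq_top_iff]
    intro A _
    rw [hsum A]
    exact add_mem (hall _ _) (hall _ _)
  -- If $\varphi\cdot v\ne0$, the given $w\varphi^T\in S$ sends $v$ to a nonzero multiple of $w$, so
  -- $w$ is parallel to $v$. The remaining $\varphi$ are differences of such ones.
  have hvφ : ∀ φ : Fin 2 → F, vecMulVec v φ ∈ S := by
    have h1 : ∀ φ : Fin 2 → F, φ ⬝ᵥ v ≠ 0 → vecMulVec v φ ∈ S := by
      intro φ hφ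
      obtain ⟨w, hw, hS⟩ := hrank φ (by rintro rfl; simp at hφ)
      have h2 := hinv _ hS
      rw [vecMulVec_mulVec] at h2
      obtain ⟨c, hc⟩ := Submodule.mem_span_singleton.1 h2
      rw [op_smul_eq_smul] at hc
      have hc0 : c ≠ 0 := by
        rintro rfl
        rw [zero_smul, eq_comm, smul_eq_zero] at hc
        exact hc.elim hφ hw
      have h3 : v = (c⁻¹ * φ ⬝ᵥ v) • w := by
        rw [mul_smul, ← hc, smul_smul, inv_mul_cancel₀ hc0, one_smul]
      rw [h3, smul_vecMulVec]
      exact S.smul_mem _ hS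
    intro φ
    by_cases hφ : φ ⬝ᵥ v = 0
    · obtain ⟨ψ, hψ⟩ : ∃ ψ : Fin 2 → F, ψ ⬝ᵥ v ≠ 0 := by
        by_contra! h
        apply hv
        ext i
        have := h (Pi.single i 1)
        simpa using this
      have h2 : vecMulVec v φ = vecMulVec v (φ + ψ) - vecMulVec v ψ := by
        rw [vecMulVec_add]; abel
      rw [h2]
      exact sub_mem (h1 _ (by rwa [add_dotProduct, hφ, zero_add])) (h1 _ hψ)
    · exact h1 φ hφ
  refine ⟨v, hv, fun A => ⟨hinv A, fun hA => ?_⟩⟩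
  obtain ⟨c, hc⟩ := Submodule.mem_span_singleton.1 hA
  have e0 := congrFun hc 0
  have e1 := congrFun hc 1
  simp only [Pi.smul_apply, smul_eq_mul, mulVec, dotProduct, Fin.sum_univ_two] at e0 e1
  -- If $Av=cv$, the other eigenvalue is $\operatorname{tr}A-c$, and subtracting it from $A$ leaves
  -- a matrix whose columns are multiples of $v$.
  have key : ∃ φ : Fin 2 → F, A = vecMulVec v φ + (A 0 0 + A 1 1 - c) • (1 : Matrix _ _ F) := by
    by_cases h0 : v 0 = 0
    · have h1 : v 1 ≠ 0 := by
        intro h1; apply hv; ext i; fin_cases i <;> simp [h0, h1]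
      refine ⟨![A 1 0 / v 1, (c - A 0 0) / v 1], ?_⟩
      ext i j
      fin_cases i <;> fin_cases j <;> simp <;> field_simp <;>
        first | ring1 | linear_combination e0 | linear_combination -e0 | linear_combination e1
    · refine ⟨![(c - A 1 1) / v 0, A 0 1 / v 0], ?_⟩
      ext i j
      fin_cases i <;> fin_cases j <;> simp <;> field_simp <;>
        first | ring1 | linear_combination e0 | linear_combination -e0 | linear_combination e1 |
          linear_combination -e1
  obtain ⟨φ, hφ⟩ := key
  rw [hφ]
  exact add_mem (hvφ φ) (S.smul_mem _ hone)

end Borel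

namespace QuatRep

open StdInvolution Matrix

section Field

variable {K : Type*} [Field K] {a b : K} {G H : Subalgebra (𝓞 K) (QuatAlg K a b)}

theorem coe_mem_of_mem_smul_top {𝔪 : Ideal (𝓞 K)} (hcond : ∀ c ∈ 𝔪, ∀ x ∈ H, c • x ∈ G) {z : H}
    (hz : z ∈ 𝔪 • (⊤ : Submodule (𝓞 K) H)) : (z : QuatAlg K a b) ∈ G := by
  refine Submodule.smul_induction_on hz (fun r hr n _ => hcond r hr n n.2) (fun x y hx hy => ?_)
  exact add_mem hx hy

end Field

variable {K : Type*} [Field K] [NumberField K] {a b : K}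
  {G H : Subalgebra (𝓞 K) (QuatAlg K a b)}

/-- The image of `G` under a splitting of `H`. -/
def imageSubmodule (G : Subalgebra (𝓞 K) (QuatAlg K a b)) {H : Subalgebra (𝓞 K) (QuatAlg K a b)}
    {hH : IsQuatOrder H} {𝔮 : Ideal (𝓞 K)} (σ : (involution hH).Splitting 𝔮) :
    Submodule (𝓞 K ⧸ 𝔮) (Matrix (Fin 2) (Fin 2) (𝓞 K ⧸ 𝔮)) where
  carrier := {A | ∃ g : H, (g : QuatAlg K a b) ∈ G ∧ σ.toFun g = A}
  add_mem' := by
    rintro _ _ ⟨g, hg, rfl⟩ ⟨g', hg', rfl⟩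
    exact ⟨g + g', add_mem hg hg', map_add _ _ _⟩
  zero_mem' := ⟨0, zero_mem _, map_zero _⟩
  smul_mem' := by
    rintro c _ ⟨g, hg, rfl⟩
    obtain ⟨c, rfl⟩ := Ideal.Quotient.mk_surjective c
    exact ⟨c • g, G.smul_mem hg c, by rw [map_smul]; rfl⟩

/-- The image of `G` is proper: otherwise multiplication by some $e\in\mathfrak r$ with $e\equiv1$
modulo `𝔮` would map `H` into `G`, and its determinant, a power of $e$, would lie in `𝔮`.
Perceptivity supplies the rank one matrices: a unit moving a lift of $w\varphi^T$ into `G` changes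
$w$ but not $\varphi$. -/
theorem exists_stabilized_line {hH : IsQuatOrder H} (hperc : IsPerceptive G H)
    {𝔮 𝔯 : Ideal (𝓞 K)} (hmax : 𝔮.IsMaximal) (hcop : 𝔮 ⊔ 𝔯 = ⊤)
    (hcond : ∀ c ∈ 𝔮 * 𝔯, ∀ x ∈ H, c • x ∈ G)
    (hdet : ∀ δ : QuatAlg K a b →ₗ[K] QuatAlg K a b, (∀ x ∈ H, δ x ∈ G) →
      LinearMap.det δ ∈ IsLocalization.coeSubmodule K (𝔮 * 𝔯))
    (σ : (involution hH).Splitting 𝔮) :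
    ∃ v : Fin 2 → 𝓞 K ⧸ 𝔮, v ≠ 0 ∧
      ∀ A, A ∈ imageSubmodule G σ ↔ A *ᵥ v ∈ Submodule.span (𝓞 K ⧸ 𝔮) {v} := by
  let := Ideal.Quotient.field 𝔮
  refine exists_eq_stabilizer ?_ ?_ ?_ ?_
  · rintro _ ⟨g, hg, rfl⟩ _ ⟨g', hg', rfl⟩
    exact ⟨g * g', mul_mem hg hg', map_mul _ _ _⟩
  · exact ⟨1, G.one_mem, map_one _⟩
  · intro htop
    obtain ⟨f, hf, e, he, hfe⟩ :=
      Submodule.mem_sup.1 (hcop ▸ Submodule.mem_top : (1 : 𝓞 K) ∈ 𝔮 ⊔ 𝔯)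
    have h1 := hdet (algebraMap (𝓞 K) K e • LinearMap.id) (fun x hx => by
      obtain ⟨g, hg, hgx⟩ : σ.toFun ⟨x, hx⟩ ∈ imageSubmodule G σ := by rw [htop]; trivial
      have h2 : (⟨x, hx⟩ : H) - g ∈ 𝔮 • (⊤ : Submodule (𝓞 K) H) := by
        rw [← σ.ker, map_sub, hgx, sub_self]
      have h3 : e • ((⟨x, hx⟩ : H) - g) ∈ (𝔮 * 𝔯) • (⊤ : Submodule (𝓞 K) H) := by
        rw [mul_comm, Submodule.mul_smul]; exact Submodule.smul_mem_smul he h2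
      have h4 : e • (⟨x, hx⟩ : H) = e • ((⟨x, hx⟩ : H) - g) + e • g := by
        rw [← smul_add, sub_add_cancel]
      have h5 : ((e • (⟨x, hx⟩ : H) : H) : QuatAlg K a b) ∈ G := by
        rw [h4]
        exact add_mem (coe_mem_of_mem_smul_top hcond h3) (G.smul_mem hg e)
      rw [LinearMap.smul_apply, LinearMap.id_apply, ← integral_smul_eq]
      exact h5)
    rw [LinearMap.det_smul, LinearMap.det_id, mul_one, ← map_pow] at h1
    obtain ⟨d, hd, hde⟩ := (IsLocalization.mem_coeSubmodule K _).1 h1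
    have h2 : d ∈ 𝔮 := (Ideal.mul_le_left : 𝔮 * 𝔯 ≤ 𝔮) hd
    rw [coe_injective_ringOfIntegers hde] at h2
    apply hmax.ne_top
    rw [Ideal.eq_top_iff_one, ← hfe]
    exact add_mem hf (hmax.isPrime.mem_of_pow_mem _ h2)
  · intro φ hφ
    obtain ⟨q, hq⟩ := σ.surj (vecMulVec ![1, 0] φ)
    obtain ⟨u, ⟨huH, hu1⟩, hu⟩ := hperc.2 q q.2
    refine ⟨σ.toFun ⟨u, huH⟩ *ᵥ ![1, 0], ?_, ⟨⟨u, huH⟩ * q, hu, ?_⟩⟩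
    · intro h0
      have hdet0 : (σ.toFun ⟨u, huH⟩).det = 0 :=
        exists_mulVec_eq_zero_iff.1 ⟨![1, 0], by simp, h0⟩
      have hN : (involution hH).N ⟨u, huH⟩ = 1 := coe_injective_ringOfIntegers (by
        rw [coe_involution_N, map_one]; exact hu1)
      rw [σ.det, hN, map_one] at hdet0
      exact one_ne_zero hdet0
    · rw [map_mul, hq, mul_vecMulVec]

/-- Since `G` contains $\mathfrak q_1\mathfrak q_2H$, membership is decided modulo $\mathfrak q_1$
and $\mathfrak q_2$ separately, by the Chinese remainder theorem. -/
theorem mem_iff_of_splittings {hH : IsQuatOrder H} {𝔮₁ 𝔮₂ : Ideal (𝓞 K)}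
    (hcop : 𝔮₁ ⊔ 𝔮₂ = ⊤) (hcond : ∀ c ∈ 𝔮₁ * 𝔮₂, ∀ x ∈ H, c • x ∈ G)
    (σ₁ : (involution hH).Splitting 𝔮₁) (σ₂ : (involution hH).Splitting 𝔮₂) (h : H) :
    (h : QuatAlg K a b) ∈ G ↔
      σ₁.toFun h ∈ imageSubmodule G σ₁ ∧ σ₂.toFun h ∈ imageSubmodule G σ₂ := by
  refine ⟨fun hh => ⟨⟨h, hh, rfl⟩, ⟨h, hh, rfl⟩⟩, ?_⟩
  rintro ⟨⟨g, hg, h1⟩, ⟨g', hg', h2⟩⟩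
  obtain ⟨f, hf, e, he, hfe⟩ :=
    Submodule.mem_sup.1 (hcop ▸ Submodule.mem_top : (1 : 𝓞 K) ∈ 𝔮₁ ⊔ 𝔮₂)
  have h3 : h - g ∈ 𝔮₁ • (⊤ : Submodule (𝓞 K) H) := by rw [← σ₁.ker, map_sub, h1, sub_self]
  have h4 : h - g' ∈ 𝔮₂ • (⊤ : Submodule (𝓞 K) H) := by rw [← σ₂.ker, map_sub, h2, sub_self]
  have h5 : e • (h - g) + f • (h - g') ∈ (𝔮₁ * 𝔮₂) • (⊤ : Submodule (𝓞 K) H) := by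
    refine add_mem ?_ ?_
    · rw [mul_comm, Submodule.mul_smul]; exact Submodule.smul_mem_smul he h3
    · rw [Submodule.mul_smul]; exact Submodule.smul_mem_smul hf h4
  have h6 : h = (e • (h - g) + f • (h - g')) + (e • g + f • g') := by
    have : h = (f + e) • h := by rw [hfe, one_smul]
    nth_rewrite 1 [this]
    rw [smul_sub, smul_sub, add_smul]; abel
  rw [h6]
  exact add_mem (coe_mem_of_mem_smul_top hcond h5)
    (add_mem (G.smul_mem hg e) (G.smul_mem hg' f))

end QuatRep

/-! ### Generators of one-sided ideals and totally positive generators under the hypotheses -/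

namespace QuatRep

open StdInvolution

variable {K : Type*} [Field K] [NumberField K] [NumberField.IsTotallyReal K] {a b : K}

/-- The standing hypotheses: `G` is a perceptive order of class number one and of the kind
`𝔮₁𝔮₂` in the maximal order `H` of a definite quaternion algebra. -/
structure Setting (G H : Subalgebra (𝓞 K) (QuatAlg K a b)) (𝔇 𝔮₁ 𝔮₂ : Ideal (𝓞 K)) : Prop where
  hdef : IsDefinite a b
  hH : IsMaximalOrder H
  hG : IsQuatOrder G
  hperc : IsPerceptive G H
  hcls : classNumber G = 1
  h𝔇 : IsReducedDiscriminant H 𝔇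
  hkind : IsOfKindQQ G H 𝔇 𝔮₁ 𝔮₂

theorem sup_eq_top_of_prime_of_ne {𝔭 𝔮 : Ideal (𝓞 K)} (h𝔭 : Prime 𝔭) (h𝔮 : Prime 𝔮) (h : 𝔭 ≠ 𝔮) :
    𝔭 ⊔ 𝔮 = ⊤ :=
  Ideal.IsMaximal.coprime_of_ne
    ((Ideal.isPrime_of_prime h𝔭).isMaximal h𝔭.ne_zero)
    ((Ideal.isPrime_of_prime h𝔮).isMaximal h𝔮.ne_zero) h

namespace Setting

variable {G H : Subalgebra (𝓞 K) (QuatAlg K a b)} {𝔇 𝔮₁ 𝔮₂ : Ideal (𝓞 K)}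
  (D : Setting G H 𝔇 𝔮₁ 𝔮₂)
include D

theorem symm : Setting G H 𝔇 𝔮₂ 𝔮₁ where
  hdef := D.hdef
  hH := D.hH
  hG := D.hG
  hperc := D.hperc
  hcls := D.hcls
  h𝔇 := D.h𝔇
  hkind := ⟨D.hkind.prime₂, D.hkind.prime₁, D.hkind.ne.symm, by
    rw [D.hkind.index_eq, mul_comm], D.hkind.not_dvd₂, D.hkind.not_dvd₁⟩

theorem smul_mem {c : 𝓞 K} (hc : c ∈ 𝔮₁ * 𝔮₂) {x : QuatAlg K a b} (hx : x ∈ H) : c • x ∈ G := by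
  have h : algebraMap (𝓞 K) K c ∈ latticeIndex (Subalgebra.toSubmodule H)
      (Subalgebra.toSubmodule G) := by
    rw [D.hkind.index_eq]
    exact (IsLocalization.mem_coeSubmodule K _).2 ⟨c, hc, rfl⟩
  rw [integral_smul_eq]
  exact smul_mem_of_mem_latticeIndex (L := Subalgebra.toSubmodule H)
    (M := Subalgebra.toSubmodule G) D.hH.1 D.hperc.1 h hx

theorem conductor_ne_top : 𝔮₁ * 𝔮₂ ≠ ⊤ := fun h =>
  (Ideal.isPrime_of_prime D.hkind.prime₁).ne_top
    (top_le_iff.1 (h ▸ (Ideal.mul_le_left : 𝔮₁ * 𝔮₂ ≤ 𝔮₁)))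

theorem conductor_ne_bot : 𝔮₁ * 𝔮₂ ≠ ⊥ :=
  mul_ne_zero D.hkind.prime₁.ne_zero D.hkind.prime₂.ne_zero

theorem coprime : 𝔮₁ ⊔ 𝔮₂ = ⊤ :=
  sup_eq_top_of_prime_of_ne D.hkind.prime₁ D.hkind.prime₂ D.hkind.ne

theorem principalAbove {𝔭 : Ideal (𝓞 K)} (h𝔭 : Prime 𝔭) (h1 : 𝔭 ≠ 𝔮₁) (h2 : 𝔭 ≠ 𝔮₂) :
    PrincipalAbove H 𝔭 := by
  refine principalAbove_of_sup_eq_top D.hdef D.hH D.hG D.hperc.1 D.hcls D.conductor_ne_top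
    D.conductor_ne_bot (fun c hc x hx => D.smul_mem hc hx) h𝔭.ne_zero ?_
  rw [Ideal.sup_mul_eq_of_coprime_left (sup_eq_top_of_prime_of_ne h𝔭 D.hkind.prime₁ h1)]
  exact sup_eq_top_of_prime_of_ne h𝔭 D.hkind.prime₂ h2

/-- The left ideals of `H` that annihilate a vector modulo a split prime are principal. -/
theorem exists_split_generator {𝔭 : Ideal (𝓞 K)} (h𝔭 : Prime 𝔭)
    (σ : (involution D.hH.1).Splitting 𝔭) {v : Fin 2 → 𝓞 K ⧸ 𝔭} (hv : v ≠ 0) :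
    ∃ s, Ideal.span {(involution D.hH.1).N s} = 𝔭 ∧
      ∀ h, (σ.toFun h).mulVec v = 0 ↔ ∃ t, h = t * s := by
  have hmax : 𝔭.IsMaximal := (Ideal.isPrime_of_prime h𝔭).isMaximal h𝔭.ne_zero
  apply σ.exists_generator h𝔭.ne_zero hv
  have hI : ∀ x ∈ σ.conjAnnihilator v, ∀ h, x * h ∈ σ.conjAnnihilator v :=
    fun x hx h => σ.conjAnnihilator_mul_mem hx h
  have hPI := σ.smul_top_le_conjAnnihilator v
  obtain ⟨c, hc, hc0⟩ := Submodule.exists_mem_ne_zero_of_ne_bot h𝔭.ne_zero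
  -- At a prime of the index, a generator local at that prime must be combined with one at the other
  -- prime, since the conductor is their product. The quantification over both orders covers
  -- $\mathfrak q_1$ and $\mathfrak q_2$.
  have main : ∀ {𝔯 𝔯' : Ideal (𝓞 K)}, Setting G H 𝔇 𝔯 𝔯' → 𝔭 = 𝔯 →
      ∃ s, ∀ x, x ∈ σ.conjAnnihilator v ↔ ∃ h, x = s * h := by
    intro 𝔯 𝔯' D' h
    obtain ⟨y, hy, hyI⟩ := exists_mul_local_generator (h ▸ D'.coprime : 𝔭 ⊔ 𝔯' = ⊤) hI hPI
      (σ.exists_local_generator h𝔭.ne_zero hv)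
    exact exists_generator_of_local_generator D.hdef D.hH D.hG D.hperc.1 D.hcls
      (h ▸ D'.conductor_ne_top : 𝔭 * 𝔯' ≠ ⊤) (h ▸ D'.conductor_ne_bot : 𝔭 * 𝔯' ≠ ⊥)
      (fun c hc x hx => D'.smul_mem (h ▸ hc) hx) _ hI hc0 (hPI (algebraMap_mem_smul_top hc)) hy hyI
  by_cases h1 : 𝔭 = 𝔮₁
  · exact main D h1
  · by_cases h2 : 𝔭 = 𝔮₂
    · exact main D.symm h2
    · exact D.principalAbove h𝔭 h1 h2 _ hI hPI

theorem exists_splitting {𝔭 : Ideal (𝓞 K)} (h𝔭 : Prime 𝔭) (hndvd : ¬ 𝔭 ∣ 𝔇) :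
    Nonempty ((involution D.hH.1).Splitting 𝔭) := by
  have := D.hH.1.module_finite
  have : Module.IsTorsionFree (𝓞 K) H := IsQuatOrder.isTorsionFree
  have : Finite (𝓞 K ⧸ 𝔭) := Ideal.finiteQuotientOfFreeOfNeBot 𝔭 h𝔭.ne_zero
  obtain ⟨e, he⟩ := (involution D.hH.1).exists_matrixUnits
    ((Ideal.isPrime_of_prime h𝔭).isMaximal h𝔭.ne_zero) D.hH.1.exists_mul_ne
    ((nondegenerateAt_iff D.hH.1 D.h𝔇 h𝔭).2 hndvd)
  exact ⟨he.splitting⟩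

/-- A prime dividing the discriminant is coprime to the index, so right ideals above it are
principal. Conjugation passes from right to left multiples. -/
theorem exists_ramified_generator {𝔭 : Ideal (𝓞 K)} (h𝔭 : Prime 𝔭) (hdvd : 𝔭 ∣ 𝔇) :
    ∃ s, Ideal.span {(involution D.hH.1).N s} = 𝔭 ∧
      ∀ h, (involution D.hH.1).N h ∈ 𝔭 → ∃ t, h = t * s := by
  have := D.hH.1.module_finite
  have : Module.IsTorsionFree (𝓞 K) H := IsQuatOrder.isTorsionFree
  have : Finite (𝓞 K ⧸ 𝔭) := Ideal.finiteQuotientOfFreeOfNeBot 𝔭 h𝔭.ne_zero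
  obtain ⟨s, hs, hgen⟩ := (involution D.hH.1).exists_ramified_generator
    (Ideal.isPrime_of_prime h𝔭) h𝔭.ne_zero D.hH.1.exists_mul_ne
    (D.principalAbove h𝔭 (fun h => D.hkind.not_dvd₁ (h ▸ hdvd))
      (fun h => D.hkind.not_dvd₂ (h ▸ hdvd)))
    (fun h => (nondegenerateAt_iff D.hH.1 D.h𝔇 h𝔭).1 h hdvd)
  set S := involution D.hH.1
  refine ⟨S.conj s, by rw [S.N_conj, hs], fun h hh => ?_⟩
  obtain ⟨t, ht⟩ := hgen (S.conj h) (by rwa [S.N_conj])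
  exact ⟨S.conj t, by rw [← S.conj_mul, ← ht, S.conj_conj]⟩

theorem exists_span_N_eq {𝔭 : Ideal (𝓞 K)} (h𝔭 : Prime 𝔭) :
    ∃ s, Ideal.span {(involution D.hH.1).N s} = 𝔭 := by
  by_cases hdvd : 𝔭 ∣ 𝔇
  · obtain ⟨s, hs, -⟩ := D.exists_ramified_generator h𝔭 hdvd
    exact ⟨s, hs⟩
  · obtain ⟨σ⟩ := D.exists_splitting h𝔭 hdvd
    have : Nontrivial (𝓞 K ⧸ 𝔭) :=
      Ideal.Quotient.nontrivial_iff.2 (Ideal.isPrime_of_prime h𝔭).ne_top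
    obtain ⟨s, hs, -⟩ := D.exists_split_generator h𝔭 σ (v := ![1, 0]) (by simp)
    exact ⟨s, hs⟩

theorem totallyPositive_N {s : H} (hs : (involution D.hH.1).N s ≠ 0) :
    TotallyPositive (algebraMap (𝓞 K) K ((involution D.hH.1).N s)) := by
  rw [coe_involution_N]
  apply D.hdef
  intro h
  apply hs
  have : s = 0 := Subtype.ext h
  rw [this]
  have := (involution D.hH.1).N_smul 0 0
  simpa using this

/-- Every nonzero ideal has a totally positive generator. -/
theorem exists_totallyPositive_generator (I : Ideal (𝓞 K)) (hI : I ≠ ⊥) :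
    ∃ c : 𝓞 K, TotallyPositive (algebraMap (𝓞 K) K c) ∧ Ideal.span {c} = I := by
  induction I using UniqueFactorizationMonoid.induction_on_prime with
  | h₁ => exact absurd rfl hI
  | h₂ I hu =>
    refine ⟨1, fun φ => by simp, ?_⟩
    rw [Ideal.span_singleton_one, Ideal.isUnit_iff.1 hu]
  | h₃ I 𝔭 hI0 h𝔭 ih =>
    obtain ⟨c, hc, hcI⟩ := ih hI0
    -- Every prime is generated by a reduced norm, which is totally positive because the algebra is
    -- definite.
    obtain ⟨s, hs⟩ := D.exists_span_N_eq h𝔭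
    have hN : (involution D.hH.1).N s ≠ 0 := by
      intro h; rw [h] at hs; exact h𝔭.ne_zero (by rw [← hs]; simp)
    refine ⟨(involution D.hH.1).N s * c, fun φ => ?_, ?_⟩
    · rw [map_mul, map_mul]
      exact mul_pos (D.totallyPositive_N hN φ) (hc φ)
    · rw [← Ideal.span_singleton_mul_span_singleton, hs, hcI]

end Setting

end QuatRep

/-! ### Signs of units, and totally positive units as squares -/

namespace QuatRep

open NumberField

section Signs

variable {K : Type*} [Field K] [NumberField K] [IsTotallyReal K]

/-- The real embedding of a totally real field that belongs to an infinite place. -/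
def realEmbedding (v : InfinitePlace K) : K →+* ℝ :=
  InfinitePlace.embedding_of_isReal (IsTotallyReal.isReal v)

/-- Every system of signs is that of an integer. -/
theorem exists_integer_signs (t : InfinitePlace K → Bool) :
    ∃ x : 𝓞 K, x ≠ 0 ∧ ∀ v, 0 < realEmbedding v (algebraMap (𝓞 K) K x) ↔ t v = true := by
  -- Weak approximation: being within distance $1$ of $\pm1$ fixes the sign.
  obtain ⟨x, hx⟩ := (InfinitePlace.denseRange_algebraMap_pi K).exists_dist_lt
    (fun v => WithAbs.toAbs v.1 (if t v then 1 else -1 : K)) one_pos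
  rw [dist_pi_lt_iff one_pos] at hx
  have hs : ∀ v, realEmbedding v x ≠ 0 ∧ (0 < realEmbedding v x ↔ t v = true) := by
    intro v
    have h := hx v
    rw [dist_eq_norm, Pi.algebraMap_apply] at h
    have h2 : ‖realEmbedding v ((if t v then 1 else -1) - x)‖ < 1 := by
      rw [realEmbedding, InfinitePlace.norm_embedding_of_isReal]
      exact h
    rw [map_sub, Real.norm_eq_abs, abs_lt] at h2
    by_cases ht : t v = true
    · simp only [ht, if_true, map_one] at h2 ⊢
      constructor
      · linarith
      · simp; linarith
    · simp only [ht] at h2 ⊢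
      simp only [Bool.false_eq_true, if_false, map_neg, map_one] at h2 ⊢
      constructor
      · linarith
      · simp; linarith
  obtain ⟨n, d, hd, hnd⟩ := IsFractionRing.div_surjective (A := 𝓞 K) x
  have hd0 : algebraMap (𝓞 K) K d ≠ 0 := by
    simpa using nonZeroDivisors.ne_zero hd
  -- With $x=n/d$, the integer $nd=xd^2$ has the same signs as $x$.
  have hx' : algebraMap (𝓞 K) K (n * d) = x * algebraMap (𝓞 K) K d ^ 2 := by
    rw [← hnd, map_mul]; field_simp
  refine ⟨n * d, fun h => ?_, fun v => ?_⟩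
  · rw [h, map_zero] at hx'
    rcases mul_eq_zero.1 hx'.symm with h | h
    · obtain ⟨v⟩ := (inferInstance : Nonempty (InfinitePlace K))
      exact (hs v).1 (by rw [h, map_zero])
    · exact hd0 (by simpa using h)
  · rw [hx', map_mul, map_pow, mul_pos_iff_of_pos_right, (hs v).2]
    have : realEmbedding v (algebraMap (𝓞 K) K d) ≠ 0 := by simpa using hd0
    positivity

theorem eq_one_or_neg_one_of_mem_torsion (u : Units.torsion K) :
    (u : (𝓞 K)ˣ) = 1 ∨ (u : (𝓞 K)ˣ) = -1 := by
  obtain ⟨v⟩ := (inferInstance : Nonempty (InfinitePlace K))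
  obtain ⟨n, hn, h⟩ := isOfFinOrder_iff_pow_eq_one.1 ((CommGroup.mem_torsion _).1 u.2)
  set x : ℝ := realEmbedding v (algebraMap (𝓞 K) K (u : (𝓞 K)ˣ)) with hx
  have hinj : Function.Injective fun u : (𝓞 K)ˣ => realEmbedding v (algebraMap (𝓞 K) K u) :=
    fun a b hab => Units.ext (coe_injective_ringOfIntegers ((realEmbedding v).injective hab))
  have hxn : x ^ n = 1 := by
    rw [hx, ← map_pow, ← map_pow, ← Units.val_pow_eq_pow_val, h]; simp
  rcases pow_eq_one_iff_cases.1 hxn with h | h | ⟨h, -⟩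
  · omega
  · left; apply hinj; simpa [hx] using h
  · right; apply hinj; simpa [hx] using h

/-- If all systems of signs are those of units, then totally positive units are squares. -/
theorem exists_sq_eq_of_totallyPositive
    (hsign : ∀ t : InfinitePlace K → Bool, ∃ u : (𝓞 K)ˣ,
      ∀ v, 0 < realEmbedding v (algebraMap (𝓞 K) K u) ↔ t v = true)
    (u : (𝓞 K)ˣ) (hu : ∀ v, 0 < realEmbedding v (algebraMap (𝓞 K) K u)) :
    ∃ w : (𝓞 K)ˣ, u = w ^ 2 := by
  classical
  -- Representatives of the units modulo squares, from Dirichlet's theorem: a sign and, for each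
  -- fundamental unit, the parity of its exponent (`true` for even).
  let f : Bool × (Fin (Units.rank K) → Bool) → (𝓞 K)ˣ := fun e =>
    (if e.1 then 1 else -1) * ∏ i, if e.2 i then 1 else Units.fundSystem K i
  have hf : ∀ u : (𝓞 K)ˣ, ∃ e w, u = f e * w ^ 2 := by
    intro u
    obtain ⟨⟨ζ, n⟩, h, -⟩ := Units.exist_unique_eq_mul_prod K u
    refine ⟨(decide ((ζ : (𝓞 K)ˣ) = 1), fun i => decide (Even (n i))),
      ∏ i, Units.fundSystem K i ^ (n i / 2), ?_⟩
    simp only [f, h]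
    rw [mul_assoc, ← Finset.prod_pow, ← Finset.prod_mul_distrib]
    congr 1
    · rcases eq_one_or_neg_one_of_mem_torsion ζ with h | h
      · simp [h]
      · by_cases h1 : (ζ : (𝓞 K)ˣ) = 1
        · simp [h1]
        · simp [h1]; exact h
    · refine Finset.prod_congr rfl fun i _ => ?_
      rw [← zpow_natCast, ← zpow_mul]
      rcases Int.even_or_odd (n i) with he | ho
      · rw [if_pos (by simpa using he), one_mul, Nat.cast_ofNat, Int.ediv_two_mul_two_of_even he]
      · rw [if_neg (by simpa using ho), ← zpow_one_add, Nat.cast_ofNat, add_comm,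
          Int.ediv_two_mul_two_add_one_of_odd ho]
  let g : Bool × (Fin (Units.rank K) → Bool) → (InfinitePlace K → Bool) := fun e v =>
    decide (0 < realEmbedding v (algebraMap (𝓞 K) K (f e)))
  have hpos : ∀ (e) (w : (𝓞 K)ˣ) (v), 0 < realEmbedding v (algebraMap (𝓞 K) K (f e * w ^ 2 : (𝓞 K)ˣ)) ↔
      0 < realEmbedding v (algebraMap (𝓞 K) K (f e)) := by
    intro e w v
    rw [Units.val_mul, Units.val_pow_eq_pow_val, map_mul, map_mul, map_pow, map_pow,
      mul_pos_iff_of_pos_right]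
    have : realEmbedding v (algebraMap (𝓞 K) K w) ≠ 0 := by simp
    positivity
  have hg : Function.Surjective g := by
    intro t
    obtain ⟨u, hu⟩ := hsign t
    obtain ⟨e, w, rfl⟩ := hf u
    refine ⟨e, funext fun v => ?_⟩
    rw [Bool.eq_iff_iff, ← hu v, hpos]
    simp [g]
  -- There are $2^{1+\mathrm{rank}}$ representatives and as many sign systems, since the rank is the
  -- number of infinite places minus one. So the surjective sign map is injective, and only the
  -- trivial representative is totally positive.
  have hcard : Fintype.card (Bool × (Fin (Units.rank K) → Bool)) =
      Fintype.card (InfinitePlace K → Bool) := by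
    have : 0 < Fintype.card (InfinitePlace K) := Fintype.card_pos
    rw [Fintype.card_prod, Fintype.card_fun, Fintype.card_fun, Fintype.card_fin, Fintype.card_bool,
      Units.rank, ← pow_succ', Nat.sub_add_cancel this]
  have hinj := ((Fintype.bijective_iff_surjective_and_card g).2 ⟨hg, hcard⟩).1
  obtain ⟨e, w, rfl⟩ := hf u
  have he : e = (true, fun _ => true) := by
    apply hinj
    funext v
    have h := (hpos e w v).1 (hu v)
    have h1 : g (true, fun _ => true) v = true := by simp [g, f]
    rw [h1]
    exact decide_eq_true h
  exact ⟨w, by simp [he, f]⟩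

end Signs

namespace Setting

variable {K : Type*} [Field K] [NumberField K] [NumberField.IsTotallyReal K] {a b : K}
  {G H : Subalgebra (𝓞 K) (QuatAlg K a b)} {𝔇 𝔮₁ 𝔮₂ : Ideal (𝓞 K)}
  (D : Setting G H 𝔇 𝔮₁ 𝔮₂)
include D

/-- Totally positive generators of the same ideal differ by the square of a unit. -/
theorem exists_eq_sq_mul {c d : 𝓞 K} (hc : TotallyPositive (algebraMap (𝓞 K) K c))
    (hd : TotallyPositive (algebraMap (𝓞 K) K d)) (h : Ideal.span {c} = Ideal.span {d}) :
    ∃ w : (𝓞 K)ˣ, d = (w : 𝓞 K) ^ 2 * c := by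
  obtain ⟨u, hu⟩ := Ideal.span_singleton_eq_span_singleton.1 h
  obtain ⟨w, hw⟩ := exists_sq_eq_of_totallyPositive (K := K) (fun t => by
    -- An integer with prescribed signs, divided by a totally positive generator of its ideal, is a
    -- unit with those signs.
    obtain ⟨x, hx0, hx⟩ := exists_integer_signs t
    obtain ⟨e, he, hex⟩ := D.exists_totallyPositive_generator (Ideal.span {x}) (by simpa using hx0)
    obtain ⟨u, hu⟩ := Ideal.span_singleton_eq_span_singleton.1 hex
    refine ⟨u, fun v => ?_⟩
    rw [← hx v, ← hu, map_mul, map_mul, mul_pos_iff_of_pos_left (he _)]) u (fun v => by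
    have := hd (realEmbedding v)
    rwa [← hu, map_mul, map_mul, mul_pos_iff_of_pos_left (hc _)] at this)
  refine ⟨w, ?_⟩
  rw [← hu, hw, Units.val_pow_eq_pow_val, mul_comm]

end Setting

end QuatRep

/-! ### Finiteness of the sets of elements of given norm -/

namespace QuatRep

open NumberField

section Finiteness

variable {K : Type*} [Field K] {a b : K}

theorem IsDefinite.nrd_nonneg (hdef : IsDefinite a b) (φ : K →+* ℝ) (x : QuatAlg K a b) :
    0 ≤ φ (nrd x) := by
  by_cases hx : x = 0
  · simp [hx, nrd]
  · exact (hdef x hx φ).le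

/-- The Cauchy-Schwarz inequality for the norm form. -/
theorem IsDefinite.trd_mul_sq_le (hdef : IsDefinite a b) (φ : K →+* ℝ) (x y : QuatAlg K a b) :
    φ (trd (x * y)) ^ 2 ≤ φ (4 * nrd x * nrd y) := by
  by_cases hy : y = 0
  · simp [hy, trd, nrd]
  -- Positivity is applied to the multiple by $2\,\mathrm{nrd}(y)$ of the component of $x$
  -- orthogonal to $\bar y$.
  have h := hdef.nrd_nonneg φ ((2 * nrd y) • x - (trd (x * y)) • star y)
  have h1 : nrd ((2 * nrd y) • x - (trd (x * y)) • star y) =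
      nrd y * (4 * nrd x * nrd y - trd (x * y) ^ 2) := by
    simp only [nrd_eq, trd, QuaternionAlgebra.re_sub, QuaternionAlgebra.imI_sub,
      QuaternionAlgebra.imJ_sub, QuaternionAlgebra.imK_sub, QuaternionAlgebra.re_smul,
      QuaternionAlgebra.imI_smul, QuaternionAlgebra.imJ_smul, QuaternionAlgebra.imK_smul,
      QuaternionAlgebra.re_star, QuaternionAlgebra.imI_star, QuaternionAlgebra.imJ_star,
      QuaternionAlgebra.imK_star, QuaternionAlgebra.re_add, QuaternionAlgebra.re_mul, smul_eq_mul,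
      QuaternionAlgebra.imI_mul]
    ring
  rw [h1, map_mul] at h
  have h2 := nonneg_of_mul_nonneg_right h (hdef y hy φ)
  rw [map_sub, map_pow] at h2
  linarith

/-- Integers that are bounded under all real embeddings form a finite set. -/
theorem finite_setOf_isIntegral_sq_le [NumberField K] [IsTotallyReal K] (β : K) :
    {y : K | IsIntegral ℤ y ∧ ∀ φ : K →+* ℝ, φ y ^ 2 ≤ φ β}.Finite := by
  classical
  refine (Embeddings.finite_of_norm_le K ℂ (1 + ∑ φ : K →+* ℂ, ‖φ β‖)).subset ?_
  rintro y ⟨hy, hb⟩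
  refine ⟨hy, fun φ => ?_⟩
  have hr : ComplexEmbedding.IsReal φ := IsTotallyReal.complexEmbedding_isReal φ
  have h := hb hr.embedding
  have h1 : ∀ x, ‖φ x‖ = |hr.embedding x| := fun x => by
    rw [← hr.coe_embedding_apply, Complex.norm_real, Real.norm_eq_abs]
  have h2 : ‖φ β‖ ≤ ∑ φ : K →+* ℂ, ‖φ β‖ :=
    Finset.single_le_sum (f := fun φ : K →+* ℂ => ‖φ β‖) (fun _ _ => norm_nonneg _)
      (Finset.mem_univ φ)
  have h3 : ‖φ y‖ ^ 2 ≤ ‖φ β‖ := by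
    rw [h1, h1, sq_abs]
    exact h.trans (le_abs_self _)
  have h4 := norm_nonneg (φ y)
  nlinarith [sq_nonneg (‖φ y‖ - 1)]

/-- An order of a definite quaternion algebra has finitely many elements of a given norm. -/
theorem IsDefinite.elementsOfNorm_finite [NumberField K] [IsTotallyReal K]
    (hdef : IsDefinite a b) {H : Subalgebra (𝓞 K) (QuatAlg K a b)} (hH : IsQuatOrder H) (c : K) :
    (elementsOfNorm H c).Finite := by
  have ha : a ≠ 0 := by
    rintro rfl
    have := hdef.nrd_ne_zero (x := ⟨0, 1, 0, 0⟩) (fun h => by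
      simpa using congrArg QuaternionAlgebra.imI h)
    simp [nrd_eq] at this
  have hb : b ≠ 0 := by
    rintro rfl
    have := hdef.nrd_ne_zero (x := ⟨0, 0, 1, 0⟩) (fun h => by
      simpa using congrArg QuaternionAlgebra.imJ h)
    simp [nrd_eq] at this
  let B : Fin 4 → QuatAlg K a b := ![⟨1, 0, 0, 0⟩, ⟨0, 1, 0, 0⟩, ⟨0, 0, 1, 0⟩, ⟨0, 0, 0, 1⟩]
  choose d hd hB using fun i => hH.exists_smul_mem (B i)
  have hd' : ∀ i, algebraMap (𝓞 K) K (d i) ≠ 0 := fun i => by simpa using hd i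
  -- The traces against four scaled basis vectors in `H` determine $x$; they are integral, and
  -- Cauchy–Schwarz bounds them in every real embedding.
  let F : QuatAlg K a b → Fin 4 → K := fun x i => trd (x * (algebraMap (𝓞 K) K (d i) • B i))
  have hF : Function.Injective F := by
    intro x y h
    have h0 := congrFun h 0
    have h1 := congrFun h 1
    have h2 := congrFun h 2
    have h3 := congrFun h 3
    have e0 : ∀ x, F x 0 = (2 * algebraMap (𝓞 K) K (d 0)) * x.re := fun x => by
      simp [F, B, trd, Algebra.smul_def]; ring
    have e1 : ∀ x, F x 1 = (2 * a * algebraMap (𝓞 K) K (d 1)) * x.imI := fun x => by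
      simp [F, B, trd, Algebra.smul_def]; ring
    have e2 : ∀ x, F x 2 = (2 * b * algebraMap (𝓞 K) K (d 2)) * x.imJ := fun x => by
      simp [F, B, trd, Algebra.smul_def]; ring
    have e3 : ∀ x, F x 3 = (-2 * a * b * algebraMap (𝓞 K) K (d 3)) * x.imK := fun x => by
      simp [F, B, trd, Algebra.smul_def]; ring
    rw [e0, e0] at h0
    rw [e1, e1] at h1
    rw [e2, e2] at h2
    rw [e3, e3] at h3
    ext
    · exact mul_left_cancel₀ (by simp [hd]) h0
    · exact mul_left_cancel₀ (by simp [hd, ha]) h1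
    · exact mul_left_cancel₀ (by simp [hd, hb]) h2
    · exact mul_left_cancel₀ (by simp [hd, ha, hb]) h3
  refine ((Set.Finite.pi' fun i => finite_setOf_isIntegral_sq_le
    (4 * c * nrd (algebraMap (𝓞 K) K (d i) • B i))).preimage hF.injOn).subset ?_
  rintro x ⟨hx, rfl⟩ i
  refine ⟨?_, fun φ => hdef.trd_mul_sq_le φ _ _⟩
  have h := hB i
  rw [integral_smul_eq] at h
  obtain ⟨r, hr⟩ := hH.exists_trd (H.mul_mem hx h)
  show IsIntegral ℤ (trd _)
  rw [← hr]
  exact r.isIntegral_coe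

end Finiteness

end QuatRep

/-! ### Divisor sums over ideals and their recurrences -/

namespace QuatRep

section DivisorSum

variable {K : Type*} [Field K] [NumberField K]

/-- The divisors of an ideal that are not divided by any ideal in `S`. -/
def idealDivisors (S : Set (Ideal (𝓞 K))) (I : Ideal (𝓞 K)) : Set (Ideal (𝓞 K)) :=
  {J | J ∣ I ∧ ∀ 𝔭 ∈ S, ¬ 𝔭 ∣ J}

/-- The sum of the norms of the divisors of an ideal that are not divided by any ideal in `S`. -/
def idealDivisorSum (S : Set (Ideal (𝓞 K))) (I : Ideal (𝓞 K)) : ℕ :=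
  ∑ᶠ J ∈ idealDivisors S I, Ideal.absNorm J

variable {S : Set (Ideal (𝓞 K))} {𝔭 I : Ideal (𝓞 K)}

theorem idealDivisors_finite (hI : I ≠ ⊥) : (idealDivisors S I).Finite := by
  have := UniqueFactorizationMonoid.fintypeSubtypeDvd I hI
  have h : Finite {J // J ∣ I} := inferInstance
  exact Set.Finite.subset (s := {J | J ∣ I}) h fun J hJ => hJ.1

theorem idealDivisorSum_top (hS : ∀ 𝔭 ∈ S, Prime 𝔭) : idealDivisorSum S ⊤ = 1 := by
  have : idealDivisors S ⊤ = {⊤} := by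
    ext J
    simp only [idealDivisors, Set.mem_ofPred_eq, Set.mem_singleton_iff]
    constructor
    · intro h
      exact Ideal.isUnit_iff.1 (isUnit_of_dvd_unit h.1 (Ideal.isUnit_iff.2 rfl))
    · rintro rfl
      refine ⟨dvd_rfl, fun 𝔭 h𝔭 h => (hS 𝔭 h𝔭).not_isUnit (isUnit_of_dvd_unit h ?_)⟩
      exact Ideal.isUnit_iff.2 rfl
  rw [idealDivisorSum, this, finsum_mem_singleton, Ideal.absNorm_top]

theorem idealDivisorSum_insert_of_not_dvd (h : ¬ 𝔭 ∣ I) :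
    idealDivisorSum (insert 𝔭 S) I = idealDivisorSum S I := by
  have : idealDivisors (insert 𝔭 S) I = idealDivisors S I := by
    ext J
    simp only [idealDivisors, Set.mem_ofPred_eq, Set.forall_mem_insert]
    exact ⟨fun h => ⟨h.1, h.2.2⟩, fun hJ => ⟨hJ.1, fun h1 => h (h1.trans hJ.1), hJ.2⟩⟩
  rw [idealDivisorSum, this, idealDivisorSum]

theorem idealDivisorSum_mul_of_mem (h𝔭 : Prime 𝔭) (h : 𝔭 ∈ S) :
    idealDivisorSum S (𝔭 * I) = idealDivisorSum S I := by
  have : idealDivisors S (𝔭 * I) = idealDivisors S I := by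
    ext J
    simp only [idealDivisors, Set.mem_ofPred_eq]
    refine ⟨fun hJ => ⟨?_, hJ.2⟩, fun hJ => ⟨hJ.1.mul_left _, hJ.2⟩⟩
    obtain ⟨J', hJ'⟩ := hJ.1
    rcases h𝔭.dvd_or_dvd (Dvd.intro _ hJ') with h1 | ⟨J'', rfl⟩
    · exact absurd h1 (hJ.2 _ h)
    · refine ⟨J'', mul_left_cancel₀ h𝔭.ne_zero ?_⟩
      rw [hJ', mul_left_comm]
  rw [idealDivisorSum, this, idealDivisorSum]

/-- The divisors of $\mathfrak pI$ divisible by `𝔭` are the $\mathfrak pJ$ with $J\mid I$. -/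
theorem idealDivisorSum_mul (hS : ∀ 𝔮 ∈ S, Prime 𝔮) (h𝔭 : Prime 𝔭) (h : 𝔭 ∉ S) (hI : I ≠ ⊥) :
    idealDivisorSum S (𝔭 * I) =
      idealDivisorSum (insert 𝔭 S) (𝔭 * I) + Ideal.absNorm 𝔭 * idealDivisorSum S I := by
  have hinj : Set.InjOn (𝔭 * ·) (idealDivisors S I) :=
    (mul_right_injective₀ h𝔭.ne_zero).injOn
  have hunion : idealDivisors S (𝔭 * I) =
      idealDivisors (insert 𝔭 S) (𝔭 * I) ∪ (𝔭 * ·) '' idealDivisors S I := by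
    ext J
    simp only [idealDivisors, Set.mem_union, Set.mem_image, Set.mem_ofPred_eq,
      Set.forall_mem_insert]
    constructor
    · rintro ⟨h1, h2⟩
      by_cases hp : 𝔭 ∣ J
      · obtain ⟨J', rfl⟩ := hp
        exact Or.inr ⟨J', ⟨(mul_dvd_mul_iff_left h𝔭.ne_zero).1 h1,
          fun 𝔮 h𝔮 h3 => h2 𝔮 h𝔮 (h3.mul_left _)⟩, rfl⟩
      · exact Or.inl ⟨h1, hp, h2⟩
    · rintro (⟨h1, -, h2⟩ | ⟨J', ⟨h1, h2⟩, rfl⟩)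
      · exact ⟨h1, h2⟩
      · refine ⟨mul_dvd_mul_left _ h1, fun 𝔮 h𝔮 h3 => ?_⟩
        rcases (hS 𝔮 h𝔮).dvd_or_dvd h3 with h4 | h4
        · exact h ((associated_iff_eq.1 ((hS 𝔮 h𝔮).associated_of_dvd h𝔭 h4)) ▸ h𝔮)
        · exact h2 𝔮 h𝔮 h4
  have hdisj : Disjoint (idealDivisors (insert 𝔭 S) (𝔭 * I)) ((𝔭 * ·) '' idealDivisors S I) := by
    rw [Set.disjoint_left]
    rintro _ hJ ⟨J', -, rfl⟩
    exact hJ.2 𝔭 (Set.mem_insert _ _) (Dvd.intro _ rfl)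
  rw [idealDivisorSum, hunion, finsum_mem_union hdisj
    (idealDivisors_finite (mul_ne_zero h𝔭.ne_zero hI)) ((idealDivisors_finite hI).image _),
    finsum_mem_image hinj, idealDivisorSum, idealDivisorSum,
    mul_finsum_mem' _ _ (idealDivisors_finite hI)]
  simp only [map_mul]

/-- The recurrence for divisor sums at a prime outside `S`. -/
theorem idealDivisorSum_recurrence (hS : ∀ 𝔮 ∈ S, Prime 𝔮) (h𝔭 : Prime 𝔭) (h : 𝔭 ∉ S)
    (hI : I ≠ ⊥) : idealDivisorSum S (𝔭 * I) =
      idealDivisorSum (insert 𝔭 S) I + Ideal.absNorm 𝔭 * idealDivisorSum S I := by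
  rw [idealDivisorSum_mul hS h𝔭 h hI, idealDivisorSum_mul_of_mem h𝔭 (Set.mem_insert _ _)]

/-- If all ideals are principal, `divisorSum` is a sum over all ideals. -/
theorem divisorSum_eq_idealDivisorSum
    (hprin : ∀ I : Ideal (𝓞 K), I ≠ ⊥ → ∃ c, Ideal.span {c} = I) {α : 𝓞 K} (hα : α ≠ 0) :
    divisorSum S α = idealDivisorSum S (Ideal.span {α}) := by
  rw [divisorSum, idealDivisorSum]
  refine finsum_mem_congr (Set.ext fun J => ?_) fun _ _ => rfl
  simp only [idealDivisors, Set.mem_ofPred_eq]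
  refine ⟨fun h => h.2, fun h => ⟨?_, h⟩⟩
  obtain ⟨c, hc⟩ := hprin J (fun hJ => hα (by
    have := h.1
    rwa [hJ, ← Ideal.zero_eq_bot, zero_dvd_iff, Ideal.zero_eq_bot,
      Ideal.span_singleton_eq_bot] at this))
  exact ⟨c, hc.symm⟩

theorem sigma_eq_divisorSum {𝔇 : Ideal (𝓞 K)} {S : Set (Ideal (𝓞 K))}
    (h : ∀ 𝔭, Prime 𝔭 → (𝔭 ∣ 𝔇 ↔ 𝔭 ∈ S)) (hS : ∀ 𝔭 ∈ S, Prime 𝔭) (α : 𝓞 K) :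
    sigma 𝔇 α = divisorSum S α := by
  rw [sigma]
  congr 1
  ext 𝔭
  exact ⟨fun h1 => (h 𝔭 h1.1).1 h1.2, fun h1 => ⟨hS _ h1, (h 𝔭 (hS _ h1)).2 h1⟩⟩

end DivisorSum

end QuatRep

/-! ### Double counting, projective lines and the Hecke recurrence -/

section DoubleCounting

variable {α β : Type*}

theorem Set.Finite.sum_ncard_sep_comm {s : Set α} {t : Set β} (hs : s.Finite) (ht : t.Finite)
    (r : α → β → Prop) :
    ∑ a ∈ hs.toFinset, {b ∈ t | r a b}.ncard = ∑ b ∈ ht.toFinset, {a ∈ s | r a b}.ncard := by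
  classical
  have h := Finset.sum_card_bipartiteAbove_eq_sum_card_bipartiteBelow r
    (s := hs.toFinset) (t := ht.toFinset)
  convert h using 2 with a ha b hb
  · rw [← Set.ncard_coe_finset]
    congr 1
    ext b
    simp [Finset.bipartiteAbove]
  · rw [← Set.ncard_coe_finset]
    congr 1
    ext a
    simp [Finset.bipartiteBelow]

theorem Set.Finite.card_filter_toFinset {s : Set α} (hs : s.Finite) (P : α → Prop)
    [DecidablePred P] : (hs.toFinset.filter P).card = {a ∈ s | P a}.ncard := by
  rw [← Set.ncard_coe_finset]
  congr 1
  ext; simp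

theorem Set.Finite.sum_ite_eq_ncard {s : Set α} (hs : s.Finite) (P : α → Prop) [DecidablePred P]
    (n : ℕ) : ∑ a ∈ hs.toFinset, (if P a then n + 1 else 1) =
      s.ncard + n * {a ∈ s | P a}.ncard := by
  have h : ∀ a, (if P a then n + 1 else 1) = 1 + n * (if P a then 1 else 0) := fun a => by
    split_ifs <;> ring
  simp only [h, Finset.sum_add_distrib, ← Finset.mul_sum, Finset.sum_boole, Finset.sum_const,
    smul_eq_mul, mul_one, Nat.cast_id, Set.Finite.card_filter_toFinset]
  rw [Set.ncard_eq_toFinset_card s hs]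

theorem Set.Finite.sum_ite_mul_ite_eq_ncard {s : Set α} (hs : s.Finite) (P Q : α → Prop)
    [DecidablePred P] [DecidablePred Q] (m n : ℕ) :
    ∑ a ∈ hs.toFinset, (if P a then m + 1 else 1) * (if Q a then n + 1 else 1) =
      s.ncard + m * {a ∈ s | P a}.ncard + n * {a ∈ s | Q a}.ncard +
        m * n * {a ∈ s | P a ∧ Q a}.ncard := by
  have h : ∀ a, (if P a then m + 1 else 1) * (if Q a then n + 1 else 1) =
      1 + m * (if P a then 1 else 0) + n * (if Q a then 1 else 0) +
        m * n * (if P a ∧ Q a then 1 else 0) := fun a => by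
    by_cases hP : P a <;> by_cases hQ : Q a <;> simp [hP, hQ] <;> ring
  simp only [h, Finset.sum_add_distrib, ← Finset.mul_sum, Finset.sum_boole, Finset.sum_const,
    smul_eq_mul, mul_one, Nat.cast_id, Set.Finite.card_filter_toFinset]
  rw [Set.ncard_eq_toFinset_card s hs]

/-- Counts an incidence relation in two ways. Below, `β` is a projective line over a residue field
with $n$ elements: a singular matrix kills one point, or all $n+1$ when it is zero. -/
theorem Set.Finite.card_mul_eq_of_ncard_eq [Finite β] {s : Set α} (hs : s.Finite)
    {r : α → β → Prop} {P : α → Prop} {n c : ℕ} (hβ : ∀ b, {a ∈ s | r a b}.ncard = c)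
    (h1 : ∀ a ∈ s, P a → {b | r a b}.ncard = n + 1)
    (h2 : ∀ a ∈ s, ¬ P a → {b | r a b}.ncard = 1) :
    Nat.card β * c = s.ncard + n * {a ∈ s | P a}.ncard := by
  classical
  have h := Set.Finite.sum_ncard_sep_comm hs (Set.toFinite (Set.univ : Set β)) r
  simp only [Set.mem_univ, true_and, hβ] at h
  rw [Finset.sum_const, smul_eq_mul, ← Set.ncard_eq_toFinset_card, Set.ncard_univ] at h
  rw [← h, ← Set.Finite.sum_ite_eq_ncard hs]
  refine Finset.sum_congr rfl fun a ha => ?_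
  rw [Set.Finite.mem_toFinset] at ha
  split_ifs with hP
  · exact h1 a ha hP
  · exact h2 a ha hP

end DoubleCounting

section ProjectiveLine

variable {F : Type*} [Field F]

open scoped LinearAlgebra.Projectivization

theorem Projectivization.rep_mem_span_iff {v : Fin 2 → F} (hv : v ≠ 0)
    (ℓ : ℙ F (Fin 2 → F)) : ℓ.rep ∈ Submodule.span F {v} ↔ ℓ = Projectivization.mk F v hv := by
  conv_rhs => rw [← ℓ.mk_rep]
  rw [Projectivization.mk_eq_mk_iff', Submodule.mem_span_singleton]

/-- The number of points of the projective line killed by a singular matrix. -/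
theorem ncard_setOf_mulVec_rep_eq_zero [Finite F] (M : Matrix (Fin 2) (Fin 2) F) :
    (M = 0 → {ℓ : ℙ F (Fin 2 → F) | M.mulVec ℓ.rep = 0}.ncard = Nat.card F + 1) ∧
    (M ≠ 0 → M.det = 0 → {ℓ : ℙ F (Fin 2 → F) | M.mulVec ℓ.rep = 0}.ncard = 1) := by
  constructor
  · rintro rfl
    simp only [Matrix.zero_mulVec, Set.ofPred_true, Set.ncard_univ]
    exact Projectivization.card_of_finrank_two F _ (by simp)
  · intro hM hdet
    obtain ⟨w, hw, hMw⟩ := Matrix.exists_mulVec_eq_zero_iff.2 hdet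
    rw [Set.ncard_eq_one]
    refine ⟨Projectivization.mk F w hw, Set.ext fun ℓ => ?_⟩
    rw [Set.mem_singleton_iff, ← Projectivization.rep_mem_span_iff, Submodule.mem_span_singleton]
    constructor
    · intro (h : M.mulVec ℓ.rep = 0)
      obtain ⟨i, hi⟩ : ∃ i, M i ≠ 0 := by
        by_contra! h0
        exact hM (funext h0)
      have e : ∀ v : Fin 2 → F, M.mulVec v = 0 → M i 0 * v 0 + M i 1 * v 1 = 0 := fun v hv => by
        have := congrFun hv i
        simpa [Matrix.mulVec, dotProduct] using this
      obtain ⟨c, hc⟩ := exists_smul_of_dotProduct_eq_zero hw (e w hMw)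
      obtain ⟨d, hd⟩ := exists_smul_of_dotProduct_eq_zero ℓ.rep_nonzero (e _ h)
      have hd0 : d ≠ 0 := by rintro rfl; exact hi (by simpa using hd)
      have h0 := congrFun (hc.symm.trans hd) 0
      have h1 := congrFun (hc.symm.trans hd) 1
      simp at h0 h1
      refine ⟨d⁻¹ * c, funext fun j => ?_⟩
      fin_cases j
      · simp [mul_assoc, h1, hd0]
      · simp [mul_assoc, h0, hd0]
    · rintro ⟨c, hc⟩
      show M.mulVec ℓ.rep = 0
      rw [← hc, Matrix.mulVec_smul, hMw, smul_zero]

end ProjectiveLine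

namespace StdInvolution

variable {R H : Type*} [CommRing R] [IsDomain R] [Ring H] [Algebra R H]
  [Module.IsTorsionFree R H] (S : StdInvolution R H)

theorem mul_left_injective_of_N_ne_zero {s : H} (hs : S.N s ≠ 0) :
    Function.Injective (· * s) := by
  intro x y h
  have h1 := congrArg (· * S.conj s) h
  simp only [mul_assoc, S.mul_conj] at h1
  rw [← Algebra.commutes, ← Algebra.commutes, ← Algebra.smul_def, ← Algebra.smul_def] at h1
  exact smul_right_injective H hs h1

/-- Right multiples of a fixed element are counted by the cofactor. -/
theorem ncard_sep_eq_of_generator {s : H} (hs : S.N s ≠ 0) {P : H → Prop}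
    (hP : ∀ h, P h ↔ ∃ t, h = t * s) (Q : H → Prop) :
    {h | Q h ∧ P h}.ncard = {t | Q (t * s)}.ncard := by
  refine Eq.trans ?_ (Set.ncard_image_of_injective _ (S.mul_left_injective_of_N_ne_zero hs))
  congr 1
  ext h
  constructor
  · rintro ⟨hQ, hPh⟩
    obtain ⟨t, rfl⟩ := (hP h).1 hPh
    exact ⟨t, hQ, rfl⟩
  · rintro ⟨t, hQ, rfl⟩
    exact ⟨hQ, (hP _).2 ⟨t, rfl⟩⟩

theorem ncard_norm_eq_of_generator {s : H} (hs : S.N s ≠ 0) {P : H → Prop}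
    (hP : ∀ h, P h ↔ ∃ t, h = t * s) (n : R) :
    {h | S.N h = n ∧ P h}.ncard = {t | S.N s * S.N t = n}.ncard := by
  rw [S.ncard_sep_eq_of_generator hs hP]
  simp only [map_mul, mul_comm]

variable {S} in
/-- The number of elements of norm `πn` that kill some vector modulo a split prime `π`. -/
theorem Splitting.card_recurrence {π : R} (hmax : (Ideal.span {π}).IsMaximal) (hπ : π ≠ 0)
    [Finite (R ⧸ Ideal.span {π})] (σ : S.Splitting (Ideal.span {π}))
    (hgen : ∀ v ≠ 0, ∃ s, S.N s = π ∧ ∀ h, (σ.toFun h).mulVec v = 0 ↔ ∃ t, h = t * s)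
    (hfin : ∀ c, {x | S.N x = c}.Finite) (n : R) :
    (Nat.card (R ⧸ Ideal.span {π}) + 1) * {x | S.N x = n}.ncard =
      {x | S.N x = π * n}.ncard +
        Nat.card (R ⧸ Ideal.span {π}) * {x | π * S.N x = n}.ncard := by
  let := Ideal.Quotient.field (Ideal.span {π})
  have hcard := Projectivization.card_of_finrank_two (R ⧸ Ideal.span {π})
    (Fin 2 → R ⧸ Ideal.span {π}) (by simp)
  -- Pairs of an element $q$ of norm $\pi n$ and a line $\ell$ that it kills. For fixed $\ell$,
  -- $q=ts$ with $N(s)=\pi$, leaving $N(t)=n$. For fixed $q$, the reduction is singular, and it is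
  -- zero exactly when $q\in\pi H$.
  have h := Set.Finite.card_mul_eq_of_ncard_eq (hfin (π * n))
    (r := fun q (ℓ : Projectivization (R ⧸ Ideal.span {π}) (Fin 2 → R ⧸ Ideal.span {π})) =>
      (σ.toFun q).mulVec ℓ.rep = 0) (P := fun q => σ.toFun q = 0)
    (n := Nat.card (R ⧸ Ideal.span {π})) (c := {x | S.N x = n}.ncard)
    (fun ℓ => by
      obtain ⟨s, hs, hgen⟩ := hgen ℓ.rep ℓ.rep_nonzero
      have := S.ncard_norm_eq_of_generator (by rwa [hs]) hgen (π * n)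
      simp only [hs, mul_right_inj' hπ] at this
      exact this)
    (fun q _ hP => (ncard_setOf_mulVec_rep_eq_zero (σ.toFun q)).1 hP)
    (fun q hq hP => (ncard_setOf_mulVec_rep_eq_zero (σ.toFun q)).2 hP (by
      rw [σ.det, Ideal.Quotient.eq_zero_iff_mem, show S.N q = π * n from hq]
      exact Ideal.mul_mem_right _ _ (Ideal.mem_span_singleton_self π)))
  rw [hcard] at h
  rw [h]
  congr 2
  -- Elements of $\pi H$ of norm $\pi n$ are $\pi y$ with $\pi N(y)=n$; the set is empty when
  -- $\pi\nmid n$, so no case distinction is needed.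
  refine Eq.trans ?_ (Set.ncard_image_of_injective _ (smul_right_injective H hπ))
  congr 1
  ext x
  constructor
  · rintro ⟨hx, hx0⟩
    rw [σ.ker, Submodule.ideal_span_singleton_smul, Submodule.mem_smul_pointwise_iff_exists] at hx0
    obtain ⟨y, -, rfl⟩ := hx0
    refine ⟨y, ?_, rfl⟩
    have hx : S.N (π • y) = π * n := hx
    rw [S.N_smul, pow_two, mul_assoc, mul_right_inj' hπ] at hx
    exact hx
  · rintro ⟨y, hy, rfl⟩
    refine ⟨?_, (σ.ker _).2 (Submodule.smul_mem_smul (Ideal.mem_span_singleton_self π) trivial)⟩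
    show S.N (π • y) = π * n
    rw [S.N_smul, pow_two, mul_assoc, show π * S.N y = n from hy]

end StdInvolution

/-! ### Representation numbers of the maximal order -/

namespace QuatRep

theorem TotallyPositive.ne_zero {K : Type*} [Field K] [NumberField K]
    [NumberField.IsTotallyReal K] {c : 𝓞 K} (hc : TotallyPositive (algebraMap (𝓞 K) K c)) :
    c ≠ 0 := by
  rintro rfl
  obtain ⟨φ⟩ := exists_realEmbedding K
  simpa using hc φ

theorem TotallyPositive.of_mul_left {K : Type*} [Field K] {c d : 𝓞 K}
    (hc : TotallyPositive (algebraMap (𝓞 K) K c))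
    (hcd : TotallyPositive (algebraMap (𝓞 K) K (c * d))) :
    TotallyPositive (algebraMap (𝓞 K) K d) := fun φ => by
  have := hcd φ
  rwa [map_mul, map_mul, mul_pos_iff_of_pos_left (hc φ)] at this

namespace Setting

variable {K : Type*} [Field K] [NumberField K] [NumberField.IsTotallyReal K] {a b : K}
  {G H : Subalgebra (𝓞 K) (QuatAlg K a b)} {𝔇 𝔮₁ 𝔮₂ : Ideal (𝓞 K)}
  (D : Setting G H 𝔇 𝔮₁ 𝔮₂)
include D

theorem fiber_finite (c : 𝓞 K) : {x | (involution D.hH.1).N x = c}.Finite := by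
  refine ((D.hdef.elementsOfNorm_finite D.hH.1 (algebraMap (𝓞 K) K c)).preimage
    (f := ((↑) : H → QuatAlg K a b)) Subtype.val_injective.injOn).subset ?_
  rintro x rfl
  exact ⟨x.2, (coe_involution_N D.hH.1 x).symm⟩

/-- A generator of a left ideal can be scaled by a unit to have a prescribed norm. -/
theorem exists_generator_norm_eq {π : 𝓞 K} (hπ : TotallyPositive (algebraMap (𝓞 K) K π)) {s : H}
    (hs : Ideal.span {(involution D.hH.1).N s} = Ideal.span {π}) :
    ∃ s', (involution D.hH.1).N s' = π ∧ ∀ h, (∃ t, h = t * s) ↔ ∃ t, h = t * s' := by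
  obtain ⟨w, hw⟩ := D.exists_eq_sq_mul (D.totallyPositive_N (s := s) (fun h => by
    rw [h] at hs
    refine hπ.ne_zero (Ideal.span_singleton_eq_bot.1 ?_)
    rw [← hs, Ideal.span_singleton_eq_bot])) hπ hs
  refine ⟨(w : 𝓞 K) • s, by rw [StdInvolution.N_smul, ← hw], fun h => ⟨?_, ?_⟩⟩
  · rintro ⟨t, rfl⟩
    exact ⟨((w⁻¹ : (𝓞 K)ˣ) : 𝓞 K) • t, by
      rw [smul_mul_smul_comm, Units.inv_mul, one_smul]⟩
  · rintro ⟨t, rfl⟩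
    exact ⟨(w : 𝓞 K) • t, by rw [mul_smul_comm, smul_mul_assoc]⟩

theorem exists_split_generator_norm_eq {π : 𝓞 K} (hπ : TotallyPositive (algebraMap (𝓞 K) K π))
    (hp : Prime (Ideal.span {π})) (σ : (involution D.hH.1).Splitting (Ideal.span {π}))
    {v : Fin 2 → 𝓞 K ⧸ Ideal.span {π}} (hv : v ≠ 0) :
    ∃ s, (involution D.hH.1).N s = π ∧ ∀ h, (σ.toFun h).mulVec v = 0 ↔ ∃ t, h = t * s := by
  obtain ⟨s, hs, hgen⟩ := D.exists_split_generator hp σ hv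
  obtain ⟨s', hs', h⟩ := D.exists_generator_norm_eq hπ hs
  exact ⟨s', hs', fun x => (hgen x).trans (h x)⟩

/-- The number of elements of norm `c` in the maximal order. -/
theorem ncard_fiber (c : 𝓞 K) (hc : TotallyPositive (algebraMap (𝓞 K) K c)) :
    {x | (involution D.hH.1).N x = c}.ncard = {x | (involution D.hH.1).N x = 1}.ncard *
      idealDivisorSum {𝔭 | Prime 𝔭 ∧ 𝔭 ∣ 𝔇} (Ideal.span {c}) := by
  have := D.hH.1.module_finite
  have : Module.IsTorsionFree (𝓞 K) H := IsQuatOrder.isTorsionFree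
  set S := involution D.hH.1
  set P : Set (Ideal (𝓞 K)) := {𝔭 | Prime 𝔭 ∧ 𝔭 ∣ 𝔇} with hP
  have hPp : ∀ 𝔭 ∈ P, Prime 𝔭 := fun 𝔭 h => h.1
  induction hn : Ideal.absNorm (Ideal.span {c}) using Nat.strong_induction_on generalizing c with
  | _ n ih =>
  subst hn
  have hc0 := hc.ne_zero
  have hI0 : Ideal.span {c} ≠ 0 := by simpa using hc0
  by_cases hu : IsUnit (Ideal.span {c})
  · have htop := Ideal.isUnit_iff.1 hu
    rw [htop, idealDivisorSum_top hPp, mul_one]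
    -- A totally positive unit is a square $w^2$, and scaling by $w$ turns norm $1$ into norm $c$.
    obtain ⟨w, hw⟩ := D.exists_eq_sq_mul (c := 1) (fun φ => by simp) hc
      (by rw [htop, Ideal.span_singleton_one])
    rw [mul_one] at hw
    rw [← Set.ncard_image_of_injective {x | S.N x = 1}
      (fun x y (h : (w : 𝓞 K) • x = (w : 𝓞 K) • y) => smul_right_injective H w.ne_zero h)]
    congr 1
    ext x
    constructor
    · intro (hx : S.N x = c)
      refine ⟨((w⁻¹ : (𝓞 K)ˣ) : 𝓞 K) • x, ?_, ?_⟩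
      · show S.N _ = 1
        rw [S.N_smul, hx, hw, ← mul_pow, Units.inv_mul, one_pow]
      · show (w : 𝓞 K) • _ = x
        rw [smul_smul, Units.mul_inv, one_smul]
    · rintro ⟨y, hy, rfl⟩
      show S.N _ = c
      rw [S.N_smul, show S.N y = 1 from hy, mul_one, hw]
  · obtain ⟨𝔭, h𝔭, J, hJ⟩ := WfDvdMonoid.exists_irreducible_factor hu hI0
    have h𝔭 := UniqueFactorizationMonoid.irreducible_iff_prime.1 h𝔭
    obtain ⟨π, hπ, rfl⟩ := D.exists_totallyPositive_generator 𝔭 h𝔭.ne_zero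
    obtain ⟨m, rfl⟩ : π ∣ c := by
      rw [← Ideal.mem_span_singleton]
      exact Ideal.le_of_dvd (Dvd.intro _ hJ.symm) (Ideal.mem_span_singleton_self c)
    have hm := hπ.of_mul_left hc
    have hπ0 := hπ.ne_zero
    have hnorm : 2 ≤ Ideal.absNorm (Ideal.span {π}) := by
      have h0 : Ideal.absNorm (Ideal.span {π}) ≠ 0 := by
        rw [Ne, Ideal.absNorm_eq_zero_iff]; exact h𝔭.ne_zero
      have h1 : Ideal.absNorm (Ideal.span {π}) ≠ 1 := by
        rw [Ne, Ideal.absNorm_eq_one_iff]; exact (Ideal.isPrime_of_prime h𝔭).ne_top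
      omega
    have hlt : ∀ x : 𝓞 K, x ≠ 0 →
        Ideal.absNorm (Ideal.span {x}) < Ideal.absNorm (Ideal.span {π * x}) := fun x hx => by
      have h0 : Ideal.absNorm (Ideal.span {x}) ≠ 0 := by
        rw [Ne, Ideal.absNorm_eq_zero_iff]; simpa using hx
      rw [← Ideal.span_singleton_mul_span_singleton, map_mul]
      nlinarith [Nat.pos_of_ne_zero h0]
    have ihm := ih _ (hlt m hm.ne_zero) m hm rfl
    have hmI : Ideal.span {m} ≠ ⊥ := by simpa using hm.ne_zero
    rw [← Ideal.span_singleton_mul_span_singleton]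
    by_cases hdvd : Ideal.span {π} ∣ 𝔇
    · rw [idealDivisorSum_mul_of_mem h𝔭 (show Ideal.span {π} ∈ P from ⟨h𝔭, hdvd⟩), ← ihm]
      obtain ⟨s, hs, hgen⟩ := D.exists_ramified_generator h𝔭 hdvd
      obtain ⟨s', hs', h⟩ := D.exists_generator_norm_eq hπ hs
      change S.N s' = π at hs'
      -- At a ramified prime every element of norm $\pi m$ is a multiple of $s'$, so the count for
      -- $\pi m$ equals that for $m$; the divisor sum does not change either.
      have key := S.ncard_norm_eq_of_generator (s := s') (by rwa [hs'])
        (P := fun h => S.N h ∈ Ideal.span {π}) (fun x => by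
          rw [← h]
          refine ⟨hgen x, ?_⟩
          rintro ⟨t, rfl⟩
          rw [map_mul, ← hs]
          exact Ideal.mul_mem_left _ _ (Ideal.mem_span_singleton_self _)) (π * m)
      simp only [hs', mul_right_inj' hπ0] at key
      rw [← key]
      congr 1
      ext x
      refine ⟨fun hx => ⟨hx, ?_⟩, fun hx => hx.1⟩
      rw [show S.N x = π * m from hx]
      exact Ideal.mul_mem_right _ _ (Ideal.mem_span_singleton_self π)
    · obtain ⟨σ⟩ := D.exists_splitting h𝔭 hdvd
      have : Finite (𝓞 K ⧸ Ideal.span {π}) :=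
        Ideal.finiteQuotientOfFreeOfNeBot _ h𝔭.ne_zero
      have hmax : (Ideal.span {π}).IsMaximal :=
        (Ideal.isPrime_of_prime h𝔭).isMaximal h𝔭.ne_zero
      -- At a split prime the count for $\pi m$ is determined by those for $m$ and, if $\pi\mid m$,
      -- for $m/\pi$; the divisor sums satisfy the same relation.
      have hrec := σ.card_recurrence hmax hπ0
        (fun v hv => D.exists_split_generator_norm_eq hπ h𝔭 σ hv) D.fiber_finite m
      rw [← Submodule.cardQuot_apply, ← Ideal.absNorm_apply, ihm] at hrec
      have hPn : Ideal.span {π} ∉ P := fun h => hdvd h.2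
      rw [idealDivisorSum_recurrence hPp h𝔭 hPn hmI]
      by_cases hπm : π ∣ m
      · obtain ⟨m', rfl⟩ := hπm
        have hm' := hπ.of_mul_left hm
        simp only [mul_right_inj' hπ0] at hrec
        rw [ih _ ((hlt m' hm'.ne_zero).trans (hlt _ hm.ne_zero)) m' hm' rfl] at hrec
        rw [← Ideal.span_singleton_mul_span_singleton] at hrec ⊢
        have h2 := idealDivisorSum_mul hPp h𝔭 hPn
          (show Ideal.span {m'} ≠ ⊥ by simpa using hm'.ne_zero)
        rw [h2] at hrec ⊢
        nlinarith
      · have hempty : {x | π * S.N x = m} = ∅ := by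
          ext x
          simp only [Set.mem_ofPred_eq, Set.mem_empty_iff_false, iff_false]
          rintro rfl
          exact hπm (dvd_mul_right _ _)
        rw [hempty, Set.ncard_empty] at hrec
        rw [idealDivisorSum_insert_of_not_dvd (by
          rwa [Ideal.dvd_iff_le, Ideal.span_singleton_le_span_singleton])]
        nlinarith

end Setting

end QuatRep

/-! ### Elements of norm one that move given lines to the stabilised lines -/

open Matrix in
theorem Matrix.mulVec_mem_span_iff {F n : Type*} [CommRing F] [Fintype n] [DecidableEq n]
    {A B : Matrix n n F} (hAB : A * B = 1) (hBA : B * A = 1) (v w : n → F) :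
    A *ᵥ w ∈ Submodule.span F {v} ↔ w ∈ Submodule.span F {B *ᵥ v} := by
  simp only [Submodule.mem_span_singleton]
  constructor
  · rintro ⟨c, hc⟩
    exact ⟨c, by rw [← Matrix.mulVec_smul, hc, Matrix.mulVec_mulVec, hBA, Matrix.one_mulVec]⟩
  · rintro ⟨c, rfl⟩
    exact ⟨c, by rw [Matrix.mulVec_smul, Matrix.mulVec_mulVec, hAB, Matrix.one_mulVec]⟩

theorem Matrix.exists_mulVec_eq {F : Type*} [Field F] {v : Fin 2 → F} (hv : v ≠ 0)
    (w : Fin 2 → F) : ∃ A : Matrix (Fin 2) (Fin 2) F, A.mulVec v = w := by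
  obtain ⟨i, hi⟩ : ∃ i, v i ≠ 0 := by
    by_contra! h
    exact hv (funext h)
  refine ⟨Matrix.vecMulVec w (Pi.single i (v i)⁻¹), funext fun j => ?_⟩
  simp [Matrix.mulVec, Matrix.vecMulVec, dotProduct, Pi.single_apply, hi]

namespace StdInvolution

open Matrix

variable {R H : Type*} [CommRing R] [Ring H] [Algebra R H] {S : StdInvolution R H}

theorem Splitting.mul_conj_eq_one {𝔮 : Ideal R} (σ : S.Splitting 𝔮) {u : H} (hu : S.N u = 1) :
    σ.toFun u * σ.toFun (S.conj u) = 1 ∧ σ.toFun (S.conj u) * σ.toFun u = 1 := by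
  rw [← map_mul, ← map_mul, S.mul_conj, S.conj_mul_self, hu, map_one, map_one]
  exact ⟨rfl, rfl⟩

/-- Splittings at coprime ideals are jointly surjective. -/
theorem Splitting.exists_eq_and_eq {𝔮₁ 𝔮₂ : Ideal R} (hcop : 𝔮₁ ⊔ 𝔮₂ = ⊤) (σ₁ : S.Splitting 𝔮₁)
    (σ₂ : S.Splitting 𝔮₂) (A : Matrix (Fin 2) (Fin 2) (R ⧸ 𝔮₁))
    (B : Matrix (Fin 2) (Fin 2) (R ⧸ 𝔮₂)) : ∃ h, σ₁.toFun h = A ∧ σ₂.toFun h = B := by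
  obtain ⟨x, rfl⟩ := σ₁.surj A
  obtain ⟨y, rfl⟩ := σ₂.surj B
  obtain ⟨e, he, f, hf, hef⟩ := Submodule.mem_sup.1 (hcop.symm ▸ Submodule.mem_top : (1 : R) ∈ 𝔮₁ ⊔ 𝔮₂)
  refine ⟨x + e • (y - x), ?_, ?_⟩
  · rw [map_add, (σ₁.ker _).2 (Submodule.smul_mem_smul he trivial), add_zero]
  · rw [show x + e • (y - x) = y + f • (x - y) by
      rw [eq_sub_iff_add_eq'.2 hef]; module]
    rw [map_add, (σ₂.ker _).2 (Submodule.smul_mem_smul hf trivial), add_zero]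

/-- Every element of norm one moves exactly one line to a given line. -/
theorem Splitting.ncard_eq_card_mul {𝔮 : Ideal R} (hmax : 𝔮.IsMaximal) [Finite (R ⧸ 𝔮)]
    (σ : S.Splitting 𝔮) {v : Fin 2 → R ⧸ 𝔮} (hv : v ≠ 0) (hfin : {u | S.N u = 1}.Finite)
    {P : H → Prop} {c : ℕ} (hc : ∀ w ≠ 0, {u | S.N u = 1 ∧ P u ∧
      σ.toFun u *ᵥ w ∈ Submodule.span (R ⧸ 𝔮) {v}}.ncard = c) :
    {u | S.N u = 1 ∧ P u}.ncard = (Nat.card (R ⧸ 𝔮) + 1) * c := by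
  let := Ideal.Quotient.field 𝔮
  have hcard := Projectivization.card_of_finrank_two (R ⧸ 𝔮) (Fin 2 → R ⧸ 𝔮) (by simp)
  have h := Set.Finite.card_mul_eq_of_ncard_eq (s := {u | S.N u = 1 ∧ P u})
    (hfin.subset fun u hu => hu.1)
    -- Each $u$ of norm one is invertible modulo `𝔮` and carries exactly one line to $\langle
    -- v\rangle$, so the exceptional case `P` of the incidence count never occurs.
    (r := fun u (ℓ : Projectivization (R ⧸ 𝔮) (Fin 2 → R ⧸ 𝔮)) =>
      σ.toFun u *ᵥ ℓ.rep ∈ Submodule.span (R ⧸ 𝔮) {v}) (P := fun _ => False) (n := 0) (c := c)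
    (fun ℓ => by
      rw [← hc ℓ.rep ℓ.rep_nonzero]
      congr 1
      ext u
      exact and_assoc)
    (fun _ _ h => h.elim)
    (fun u hu _ => by
      obtain ⟨h1, h2⟩ := σ.mul_conj_eq_one hu.1
      have h0 : σ.toFun (S.conj u) *ᵥ v ≠ 0 := fun h0 => hv (by
        rw [← Matrix.one_mulVec v, ← h1, ← Matrix.mulVec_mulVec, h0, Matrix.mulVec_zero])
      rw [Set.ncard_eq_one]
      refine ⟨Projectivization.mk _ _ h0, Set.ext fun ℓ => ?_⟩
      exact (Matrix.mulVec_mem_span_iff h1 h2 v ℓ.rep).trans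
        (Projectivization.rep_mem_span_iff h0 ℓ))
  rw [hcard, zero_mul, add_zero] at h
  exact h.symm

variable {𝔮₁ 𝔮₂ : Ideal R}

/-- The elements of norm one that move two given lines to the stabilized lines form a coset of the
norm one group of the suborder. -/
theorem ncard_transporter (hmax₁ : 𝔮₁.IsMaximal) (hmax₂ : 𝔮₂.IsMaximal) (hcop : 𝔮₁ ⊔ 𝔮₂ = ⊤)
    (σ₁ : S.Splitting 𝔮₁) (σ₂ : S.Splitting 𝔮₂) {v₁ : Fin 2 → R ⧸ 𝔮₁} {v₂ : Fin 2 → R ⧸ 𝔮₂}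
    (hv₁ : v₁ ≠ 0) (hv₂ : v₂ ≠ 0) {P : H → Prop}
    (hP : ∀ h, P h ↔ σ₁.toFun h *ᵥ v₁ ∈ Submodule.span (R ⧸ 𝔮₁) {v₁} ∧
      σ₂.toFun h *ᵥ v₂ ∈ Submodule.span (R ⧸ 𝔮₂) {v₂})
    (hperc : ∀ q, ∃ u, S.N u = 1 ∧ P (u * q)) {w₁ : Fin 2 → R ⧸ 𝔮₁} {w₂ : Fin 2 → R ⧸ 𝔮₂}
    (hw₁ : w₁ ≠ 0) (hw₂ : w₂ ≠ 0) :
    {u | S.N u = 1 ∧ σ₁.toFun u *ᵥ w₁ ∈ Submodule.span (R ⧸ 𝔮₁) {v₁} ∧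
      σ₂.toFun u *ᵥ w₂ ∈ Submodule.span (R ⧸ 𝔮₂) {v₂}}.ncard = {u | S.N u = 1 ∧ P u}.ncard := by
  have aux : ∀ {𝔮 : Ideal R} (hmax : 𝔮.IsMaximal) (σ : S.Splitting 𝔮) {v w : Fin 2 → R ⧸ 𝔮}
      (hw : w ≠ 0) {u₀ : H}, S.N u₀ = 1 →
      σ.toFun u₀ *ᵥ w ∈ Submodule.span (R ⧸ 𝔮) {v} → ∀ u,
      σ.toFun (u * u₀) *ᵥ w ∈ Submodule.span (R ⧸ 𝔮) {v} ↔
        σ.toFun u *ᵥ v ∈ Submodule.span (R ⧸ 𝔮) {v} := by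
    intro 𝔮 hmax σ v w hw u₀ hu₀ h u
    let := Ideal.Quotient.field 𝔮
    obtain ⟨c, hc⟩ := Submodule.mem_span_singleton.1 h
    have hc0 : c ≠ 0 := by
      rintro rfl
      apply hw
      rw [← Matrix.one_mulVec w, ← (σ.mul_conj_eq_one hu₀).2, ← Matrix.mulVec_mulVec, ← hc,
        zero_smul, Matrix.mulVec_zero]
    rw [map_mul, ← Matrix.mulVec_mulVec, ← hc, Matrix.mulVec_smul]
    exact Submodule.smul_mem_iff _ hc0
  obtain ⟨A, hA⟩ : ∃ A : Matrix (Fin 2) (Fin 2) (R ⧸ 𝔮₁), A *ᵥ v₁ = w₁ := by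
    let := Ideal.Quotient.field 𝔮₁
    exact Matrix.exists_mulVec_eq hv₁ w₁
  obtain ⟨B, hB⟩ : ∃ B : Matrix (Fin 2) (Fin 2) (R ⧸ 𝔮₂), B *ᵥ v₂ = w₂ := by
    let := Ideal.Quotient.field 𝔮₂
    exact Matrix.exists_mulVec_eq hv₂ w₂
  -- Choose $q$ with $qv_i=w_i$ modulo both primes. Perceptivity gives $u_0$ with $u_0q$ in the
  -- suborder, so $u_0$ moves both lines correctly, and the transporter is the coset of its norm one
  -- group through $u_0$.
  obtain ⟨q, rfl, rfl⟩ := σ₁.exists_eq_and_eq hcop σ₂ A B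
  obtain ⟨u₀, hu₀, hP₀⟩ := hperc q
  rw [hP, map_mul, map_mul, ← Matrix.mulVec_mulVec, ← Matrix.mulVec_mulVec, hA, hB] at hP₀
  have hinj : Function.Injective (· * u₀) := fun x y h => by
    have := congrArg (· * S.conj u₀) h
    simpa [mul_assoc, S.mul_conj, hu₀] using this
  refine Eq.trans ?_ (Set.ncard_image_of_injective _ hinj)
  have key : ∀ u, (σ₁.toFun (u * u₀) *ᵥ _ ∈ Submodule.span (R ⧸ 𝔮₁) {v₁} ∧
      σ₂.toFun (u * u₀) *ᵥ _ ∈ Submodule.span (R ⧸ 𝔮₂) {v₂}) ↔ P u := fun u => by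
    rw [hP, aux hmax₁ σ₁ hw₁ hu₀ hP₀.1, aux hmax₂ σ₂ hw₂ hu₀ hP₀.2]
  congr 1
  ext u
  constructor
  · rintro ⟨hu, hu'⟩
    have hu₀' : u = u * S.conj u₀ * u₀ := by
      rw [mul_assoc, S.conj_mul_self, hu₀, map_one, mul_one]
    rw [hu₀', key] at hu'
    exact ⟨_, ⟨by rw [map_mul, S.N_conj, hu, hu₀, mul_one], hu'⟩, hu₀'.symm⟩
  · rintro ⟨u, ⟨hu, hu'⟩, rfl⟩
    exact ⟨by rw [map_mul, hu, hu₀, mul_one], (key u).2 hu'⟩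

/-- Each point of a product of two projective lines is moved to the stabilized pair by equally many
elements of norm one; a zero vector stands for a factor without condition. -/
theorem ncard_transporter_eq [Finite (R ⧸ 𝔮₁)] [Finite (R ⧸ 𝔮₂)]
    (hmax₁ : 𝔮₁.IsMaximal) (hmax₂ : 𝔮₂.IsMaximal)
    (hcop : 𝔮₁ ⊔ 𝔮₂ = ⊤)
    (σ₁ : S.Splitting 𝔮₁) (σ₂ : S.Splitting 𝔮₂) {v₁ : Fin 2 → R ⧸ 𝔮₁} {v₂ : Fin 2 → R ⧸ 𝔮₂}
    (hv₁ : v₁ ≠ 0) (hv₂ : v₂ ≠ 0) {P : H → Prop}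
    (hP : ∀ h, P h ↔ σ₁.toFun h *ᵥ v₁ ∈ Submodule.span (R ⧸ 𝔮₁) {v₁} ∧
      σ₂.toFun h *ᵥ v₂ ∈ Submodule.span (R ⧸ 𝔮₂) {v₂})
    (hperc : ∀ q, ∃ u, S.N u = 1 ∧ P (u * q)) (hfin : {u | S.N u = 1}.Finite)
    (w₁ : Fin 2 → R ⧸ 𝔮₁) (w₂ : Fin 2 → R ⧸ 𝔮₂) [Decidable (w₁ = 0)] [Decidable (w₂ = 0)] :
    {u | S.N u = 1 ∧ σ₁.toFun u *ᵥ w₁ ∈ Submodule.span (R ⧸ 𝔮₁) {v₁} ∧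
      σ₂.toFun u *ᵥ w₂ ∈ Submodule.span (R ⧸ 𝔮₂) {v₂}}.ncard =
    {u | S.N u = 1 ∧ P u}.ncard * ((if w₁ = 0 then Nat.card (R ⧸ 𝔮₁) + 1 else 1) *
      (if w₂ = 0 then Nat.card (R ⧸ 𝔮₂) + 1 else 1)) := by
  have h1 : ∀ w₁ ≠ 0, {u | S.N u = 1 ∧ σ₁.toFun u *ᵥ w₁ ∈ Submodule.span (R ⧸ 𝔮₁) {v₁} ∧
      σ₂.toFun u *ᵥ w₂ ∈ Submodule.span (R ⧸ 𝔮₂) {v₂}}.ncard =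
      {u | S.N u = 1 ∧ P u}.ncard * (if w₂ = 0 then Nat.card (R ⧸ 𝔮₂) + 1 else 1) := by
    intro w₁ hw₁
    split_ifs with hw₂
    · subst hw₂
      simp only [Matrix.mulVec_zero, Submodule.zero_mem, and_true]
      rw [σ₂.ncard_eq_card_mul hmax₂ hv₂ hfin (fun w hw =>
        ncard_transporter hmax₁ hmax₂ hcop σ₁ σ₂ hv₁ hv₂ hP hperc hw₁ hw), mul_comm]
    · rw [ncard_transporter hmax₁ hmax₂ hcop σ₁ σ₂ hv₁ hv₂ hP hperc hw₁ hw₂, mul_one]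
  by_cases hw₁ : w₁ = 0
  · subst hw₁
    simp only [Matrix.mulVec_zero, Submodule.zero_mem, true_and, if_true]
    rw [σ₁.ncard_eq_card_mul hmax₁ hv₁ hfin (c := {u | S.N u = 1 ∧ P u}.ncard *
      (if w₂ = 0 then Nat.card (R ⧸ 𝔮₂) + 1 else 1)) (fun w hw => by
      rw [← h1 w hw]
      congr 1
      ext u
      exact and_congr_right fun _ => and_comm), mul_left_comm]
  · rw [h1 w₁ hw₁, if_neg hw₁, one_mul]

/-- The elements of a given norm in the suborder, counted through the elements of the order that
kill the stabilized vectors. -/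
theorem ncard_mul_ncard_eq [Finite (R ⧸ 𝔮₁)] [Finite (R ⧸ 𝔮₂)]
    (hmax₁ : 𝔮₁.IsMaximal) (hmax₂ : 𝔮₂.IsMaximal)
    (hcop : 𝔮₁ ⊔ 𝔮₂ = ⊤)
    (σ₁ : S.Splitting 𝔮₁) (σ₂ : S.Splitting 𝔮₂) {v₁ : Fin 2 → R ⧸ 𝔮₁} {v₂ : Fin 2 → R ⧸ 𝔮₂}
    (hv₁ : v₁ ≠ 0) (hv₂ : v₂ ≠ 0) {P : H → Prop}
    (hP : ∀ h, P h ↔ σ₁.toFun h *ᵥ v₁ ∈ Submodule.span (R ⧸ 𝔮₁) {v₁} ∧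
      σ₂.toFun h *ᵥ v₂ ∈ Submodule.span (R ⧸ 𝔮₂) {v₂})
    (hperc : ∀ q, ∃ u, S.N u = 1 ∧ P (u * q)) (hfin : ∀ n, {u | S.N u = n}.Finite) (n : R) :
    {u | S.N u = 1}.ncard * {q | S.N q = n ∧ P q}.ncard = {u | S.N u = 1 ∧ P u}.ncard *
      ({q | S.N q = n}.ncard +
        Nat.card (R ⧸ 𝔮₁) * {q | S.N q = n ∧ σ₁.toFun q *ᵥ v₁ = 0}.ncard +
        Nat.card (R ⧸ 𝔮₂) * {q | S.N q = n ∧ σ₂.toFun q *ᵥ v₂ = 0}.ncard +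
        Nat.card (R ⧸ 𝔮₁) * Nat.card (R ⧸ 𝔮₂) *
          {q | S.N q = n ∧ σ₁.toFun q *ᵥ v₁ = 0 ∧ σ₂.toFun q *ᵥ v₂ = 0}.ncard) := by
  classical
  -- Pairs $(q,u)$ with $N(q)=n$, $N(u)=1$ and $uq$ in the suborder. For fixed $q$ the admissible
  -- $u$ are transporters of the vectors $qv_i$, possibly zero; for fixed $u$, left multiplication
  -- by $u$ permutes the elements of norm $n$.
  have h := Set.Finite.sum_ncard_sep_comm (hfin n) (hfin 1) (fun q u => P (u * q))
  have h1 : ∀ q, {u ∈ {u | S.N u = 1} | P (u * q)}.ncard = {u | S.N u = 1 ∧ P u}.ncard *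
      ((if σ₁.toFun q *ᵥ v₁ = 0 then Nat.card (R ⧸ 𝔮₁) + 1 else 1) *
      (if σ₂.toFun q *ᵥ v₂ = 0 then Nat.card (R ⧸ 𝔮₂) + 1 else 1)) := fun q => by
    rw [← ncard_transporter_eq hmax₁ hmax₂ hcop σ₁ σ₂ hv₁ hv₂ hP hperc (hfin 1)]
    congr 1
    ext u
    refine and_congr_right fun _ => ?_
    rw [hP, map_mul, map_mul, ← Matrix.mulVec_mulVec, ← Matrix.mulVec_mulVec]
  have h2 : ∀ u ∈ (hfin 1).toFinset, {q ∈ {q | S.N q = n} | P (u * q)}.ncard =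
      {q | S.N q = n ∧ P q}.ncard := fun u hu => by
    have hu : S.N u = 1 := by simpa using hu
    have hinj : Function.Injective (u * ·) := fun x y h => by
      have := congrArg (S.conj u * ·) h
      simpa [← mul_assoc, S.conj_mul_self, hu] using this
    rw [← Set.ncard_image_of_injective _ hinj]
    congr 1
    ext q
    constructor
    · rintro ⟨q, ⟨hq, hPq⟩, rfl⟩
      exact ⟨by rw [map_mul, hu, one_mul, show S.N q = n from hq], hPq⟩
    · rintro ⟨hq, hPq⟩
      have e : u * (S.conj u * q) = q := by
        rw [← mul_assoc, S.mul_conj, hu, map_one, one_mul]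
      refine ⟨S.conj u * q, ⟨?_, by rwa [e]⟩, e⟩
      show S.N _ = n
      rw [map_mul, S.N_conj, hu, one_mul, hq]
  rw [Finset.sum_congr rfl h2, Finset.sum_const, smul_eq_mul, ← Set.ncard_eq_toFinset_card _ (hfin 1)] at h
  simp only [h1] at h
  rw [← Finset.mul_sum, Set.Finite.sum_ite_mul_ite_eq_ncard] at h
  exact h.symm

end StdInvolution

/-! ### From the maximal order to the suborder -/

namespace QuatRep

namespace Setting

variable {K : Type*} [Field K] [NumberField K] [NumberField.IsTotallyReal K] {a b : K}
  {G H : Subalgebra (𝓞 K) (QuatAlg K a b)} {𝔇 𝔮₁ 𝔮₂ : Ideal (𝓞 K)}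
  (D : Setting G H 𝔇 𝔮₁ 𝔮₂)
include D

/-- The left count is $r_{\mathcal H}(c/\pi)$, and $\mathrm{Nm}(\pi)$ times it collects the divisors
of $c$ divisible by $\pi$. The relation is written without subtraction to stay in the natural
numbers. -/
theorem absNorm_mul_ncard {π c : 𝓞 K} (hπ : TotallyPositive (algebraMap (𝓞 K) K π))
    (hp : Prime (Ideal.span {π})) (hndvd : ¬ Ideal.span {π} ∣ 𝔇)
    (hc : TotallyPositive (algebraMap (𝓞 K) K c)) :
    Ideal.absNorm (Ideal.span {π}) * {x | π * (involution D.hH.1).N x = c}.ncard +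
      {x | (involution D.hH.1).N x = 1}.ncard *
        idealDivisorSum (insert (Ideal.span {π}) {𝔭 | Prime 𝔭 ∧ 𝔭 ∣ 𝔇}) (Ideal.span {c}) =
      {x | (involution D.hH.1).N x = 1}.ncard *
        idealDivisorSum {𝔭 | Prime 𝔭 ∧ 𝔭 ∣ 𝔇} (Ideal.span {c}) := by
  by_cases hdvd : π ∣ c
  · obtain ⟨m, rfl⟩ := hdvd
    have hm := hπ.of_mul_left hc
    simp only [mul_right_inj' hπ.ne_zero]
    rw [D.ncard_fiber m hm, ← Ideal.span_singleton_mul_span_singleton,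
      idealDivisorSum_mul (S := {𝔭 | Prime 𝔭 ∧ 𝔭 ∣ 𝔇}) (fun 𝔭 h => h.1) hp (fun h => hndvd h.2)
        (show Ideal.span {m} ≠ ⊥ by simpa using hm.ne_zero)]
    ring
  · have hempty : {x | π * (involution D.hH.1).N x = c} = ∅ := by
      ext x
      simp only [Set.mem_ofPred_eq, Set.mem_empty_iff_false, iff_false]
      rintro rfl
      exact hdvd (dvd_mul_right _ _)
    rw [hempty, Set.ncard_empty, idealDivisorSum_insert_of_not_dvd (by
      rwa [Ideal.dvd_iff_le, Ideal.span_singleton_le_span_singleton]), mul_zero, zero_add]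

/-- Inclusion–exclusion for the divisors of $c$ divisible by both $\pi$ and $\rho$. -/
theorem absNorm_mul_absNorm_mul_ncard {π ρ c : 𝓞 K}
    (hπ : TotallyPositive (algebraMap (𝓞 K) K π)) (hρ : TotallyPositive (algebraMap (𝓞 K) K ρ))
    (hp : Prime (Ideal.span {π})) (hp' : Prime (Ideal.span {ρ}))
    (hne : Ideal.span {π} ≠ Ideal.span {ρ})
    (hndvd : ¬ Ideal.span {π} ∣ 𝔇) (hndvd' : ¬ Ideal.span {ρ} ∣ 𝔇)
    (hc : TotallyPositive (algebraMap (𝓞 K) K c)) :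
    Ideal.absNorm (Ideal.span {π}) * Ideal.absNorm (Ideal.span {ρ}) *
        {x | π * (ρ * (involution D.hH.1).N x) = c}.ncard +
      {x | (involution D.hH.1).N x = 1}.ncard *
        (idealDivisorSum (insert (Ideal.span {π}) {𝔭 | Prime 𝔭 ∧ 𝔭 ∣ 𝔇}) (Ideal.span {c}) +
        idealDivisorSum (insert (Ideal.span {ρ}) {𝔭 | Prime 𝔭 ∧ 𝔭 ∣ 𝔇}) (Ideal.span {c})) =
      {x | (involution D.hH.1).N x = 1}.ncard *
        (idealDivisorSum {𝔭 | Prime 𝔭 ∧ 𝔭 ∣ 𝔇} (Ideal.span {c}) +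
        idealDivisorSum (insert (Ideal.span {π}) (insert (Ideal.span {ρ})
          {𝔭 | Prime 𝔭 ∧ 𝔭 ∣ 𝔇})) (Ideal.span {c})) := by
  by_cases hdvd : π ∣ c
  · obtain ⟨m, rfl⟩ := hdvd
    have hm := hπ.of_mul_left hc
    simp only [mul_right_inj' hπ.ne_zero]
    have h := D.absNorm_mul_ncard hρ hp' hndvd' hm
    have hm0 : Ideal.span {m} ≠ ⊥ := by simpa using hm.ne_zero
    rw [← Ideal.span_singleton_mul_span_singleton,
      idealDivisorSum_mul (S := {𝔭 | Prime 𝔭 ∧ 𝔭 ∣ 𝔇}) (fun 𝔭 h => h.1) hp (fun h => hndvd h.2) hm0,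
      idealDivisorSum_mul (S := insert (Ideal.span {ρ}) {𝔭 | Prime 𝔭 ∧ 𝔭 ∣ 𝔇})
        (by rintro 𝔭 (rfl | h) <;> [exact hp'; exact h.1]) hp
        (by rintro (h | h) <;> [exact hne h; exact hndvd h.2]) hm0]
    linear_combination Ideal.absNorm (Ideal.span {π}) * h
  · have hempty : {x | π * (ρ * (involution D.hH.1).N x) = c} = ∅ := by
      ext x
      simp only [Set.mem_ofPred_eq, Set.mem_empty_iff_false, iff_false]
      rintro rfl
      exact hdvd (dvd_mul_right _ _)
    have hdvd' : ¬ Ideal.span {π} ∣ Ideal.span {c} := by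
      rwa [Ideal.dvd_iff_le, Ideal.span_singleton_le_span_singleton]
    rw [hempty, Set.ncard_empty, idealDivisorSum_insert_of_not_dvd hdvd',
      idealDivisorSum_insert_of_not_dvd hdvd', mul_zero, zero_add]

theorem ncard_elementsOfNorm (c : 𝓞 K) : (elementsOfNorm G (algebraMap (𝓞 K) K c)).ncard =
    {x | (involution D.hH.1).N x = c ∧ (x : QuatAlg K a b) ∈ G}.ncard := by
  rw [← Set.ncard_image_of_injective _ (Subtype.val_injective (p := (· ∈ H)))]
  congr 1
  ext x
  constructor
  · rintro ⟨hx, hn⟩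
    refine ⟨⟨x, D.hperc.1 hx⟩, ⟨coe_injective_ringOfIntegers ?_, hx⟩, rfl⟩
    rw [coe_involution_N, hn]
  · rintro ⟨x, ⟨rfl, hx⟩, rfl⟩
    exact ⟨hx, (coe_involution_N D.hH.1 x).symm⟩

/-- The stabilized vector at a prime of the index. -/
theorem exists_stabilized_vector (σ : (involution D.hH.1).Splitting 𝔮₁) :
    ∃ v, v ≠ 0 ∧ ∀ A, A ∈ imageSubmodule G σ ↔
      A.mulVec v ∈ Submodule.span (𝓞 K ⧸ 𝔮₁) {v} :=
  exists_stabilized_line D.hperc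
    ((Ideal.isPrime_of_prime D.hkind.prime₁).isMaximal D.hkind.prime₁.ne_zero) D.coprime
    (fun _ hc _ hx => D.smul_mem hc hx) (fun δ hδ => by
      rw [← D.hkind.index_eq]
      exact Submodule.subset_span ⟨δ, hδ, rfl⟩) σ

/-- The number of elements of a totally positive norm in the suborder. -/
theorem ncard_elementsOfNorm_eq {α : 𝓞 K} (hα : TotallyPositive (algebraMap (𝓞 K) K α)) :
    ((elementsOfNorm G (algebraMap (𝓞 K) K α)).ncard : ℤ) = (normOne G).ncard *
      (4 * idealDivisorSum {𝔭 | Prime 𝔭 ∧ 𝔭 ∣ 𝔇} (Ideal.span {α})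
      - 2 * idealDivisorSum (insert 𝔮₁ {𝔭 | Prime 𝔭 ∧ 𝔭 ∣ 𝔇}) (Ideal.span {α})
      - 2 * idealDivisorSum (insert 𝔮₂ {𝔭 | Prime 𝔭 ∧ 𝔭 ∣ 𝔇}) (Ideal.span {α})
      + idealDivisorSum (insert 𝔮₁ (insert 𝔮₂ {𝔭 | Prime 𝔭 ∧ 𝔭 ∣ 𝔇})) (Ideal.span {α})) := by
  obtain ⟨π₁, hπ₁, h1⟩ := D.exists_totallyPositive_generator 𝔮₁ D.hkind.prime₁.ne_zero
  obtain ⟨π₂, hπ₂, h2⟩ := D.exists_totallyPositive_generator 𝔮₂ D.hkind.prime₂.ne_zero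
  subst h1 h2
  have hp₁ := D.hkind.prime₁
  have hp₂ := D.hkind.prime₂
  have hmax₁ := (Ideal.isPrime_of_prime hp₁).isMaximal hp₁.ne_zero
  have hmax₂ := (Ideal.isPrime_of_prime hp₂).isMaximal hp₂.ne_zero
  have : Module.IsTorsionFree (𝓞 K) H := IsQuatOrder.isTorsionFree
  have : Finite (𝓞 K ⧸ Ideal.span {π₁}) := Ideal.finiteQuotientOfFreeOfNeBot _ hp₁.ne_zero
  have : Finite (𝓞 K ⧸ Ideal.span {π₂}) := Ideal.finiteQuotientOfFreeOfNeBot _ hp₂.ne_zero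
  obtain ⟨σ₁⟩ := D.exists_splitting hp₁ D.hkind.not_dvd₁
  obtain ⟨σ₂⟩ := D.exists_splitting hp₂ D.hkind.not_dvd₂
  obtain ⟨v₁, hv₁, hG₁⟩ := D.exists_stabilized_vector σ₁
  obtain ⟨v₂, hv₂, hG₂⟩ := D.symm.exists_stabilized_vector σ₂
  have key := StdInvolution.ncard_mul_ncard_eq hmax₁ hmax₂ D.coprime σ₁ σ₂ hv₁ hv₂
    (P := fun h => (h : QuatAlg K a b) ∈ G) (fun h => by
      rw [mem_iff_of_splittings D.coprime (fun _ hc _ hx => D.smul_mem hc hx) σ₁ σ₂, hG₁, hG₂])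
    (fun q => by
      obtain ⟨u, ⟨huH, hu1⟩, hu⟩ := D.hperc.2 q q.2
      refine ⟨⟨u, huH⟩, coe_injective_ringOfIntegers ?_, hu⟩
      rw [coe_involution_N, hu1, map_one]) D.fiber_finite α
  obtain ⟨s₁, hs₁, hgen₁⟩ := D.exists_split_generator_norm_eq hπ₁ hp₁ σ₁ hv₁
  obtain ⟨s₂, hs₂, hgen₂⟩ := D.exists_split_generator_norm_eq hπ₂ hp₂ σ₂ hv₂
  have e₁ := (involution D.hH.1).ncard_norm_eq_of_generator (by rw [hs₁]; exact hπ₁.ne_zero) hgen₁ α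
  have e₂ := (involution D.hH.1).ncard_norm_eq_of_generator (by rw [hs₂]; exact hπ₂.ne_zero) hgen₂ α
  -- An element killing $v_1$ is $ts_1$, and it kills $v_2$ exactly when $t$ kills $s_1v_2$. This
  -- vector is nonzero since $N(s_1)=\pi_1\notin\mathfrak q_2$, so $t$ is a multiple of some $s_3$
  -- of norm $\pi_2$.
  have hw : (σ₂.toFun s₁).mulVec v₂ ≠ 0 := by
    intro h
    let := Ideal.Quotient.field (Ideal.span {π₂})
    have hdet := Matrix.exists_mulVec_eq_zero_iff.1 ⟨v₂, hv₂, h⟩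
    rw [σ₂.det, hs₁, Ideal.Quotient.eq_zero_iff_mem] at hdet
    have hle : Ideal.span {π₁} ≤ Ideal.span {π₂} := by
      rwa [Ideal.span_singleton_le_iff_mem]
    exact D.hkind.ne (hmax₁.eq_of_le hmax₂.ne_top hle)
  obtain ⟨s₃, hs₃, hgen₃⟩ := D.exists_split_generator_norm_eq hπ₂ hp₂ σ₂ hw
  simp only [hs₁, hs₂] at e₁ e₂
  have e₄ : {q | (involution D.hH.1).N q = α ∧ (σ₁.toFun q).mulVec v₁ = 0 ∧ (σ₂.toFun q).mulVec v₂ = 0}.ncard =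
      {x | π₁ * (π₂ * (involution D.hH.1).N x) = α}.ncard := by
    have h₁ := (involution D.hH.1).ncard_sep_eq_of_generator (by rw [hs₁]; exact hπ₁.ne_zero) hgen₁
      (fun h => (involution D.hH.1).N h = α ∧ (σ₂.toFun h).mulVec v₂ = 0)
    have h₂ := (involution D.hH.1).ncard_sep_eq_of_generator (by rw [hs₃]; exact hπ₂.ne_zero) hgen₃ (fun h => π₁ * (involution D.hH.1).N h = α)
    simp only [map_mul, hs₁, hs₃, mul_comm _ π₁, mul_comm _ π₂, ← Matrix.mulVec_mulVec] at h₁ h₂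
    rw [← h₂, ← h₁]
    congr 1
    ext x
    exact ⟨fun h => ⟨⟨h.1, h.2.2⟩, h.2.1⟩, fun h => ⟨h.1.1, h.2, h.1.2⟩⟩
  rw [e₁, e₂, e₄, ← Submodule.cardQuot_apply, ← Submodule.cardQuot_apply, ← Ideal.absNorm_apply,
    ← Ideal.absNorm_apply, D.ncard_fiber α hα] at key
  have f₁ := D.absNorm_mul_ncard hπ₁ hp₁ D.hkind.not_dvd₁ hα
  have f₂ := D.absNorm_mul_ncard hπ₂ hp₂ D.hkind.not_dvd₂ hα
  have f₁₂ := D.absNorm_mul_absNorm_mul_ncard hπ₁ hπ₂ hp₁ hp₂ D.hkind.ne D.hkind.not_dvd₁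
    D.hkind.not_dvd₂ hα
  have hh : {x | (involution D.hH.1).N x = 1}.ncard ≠ 0 := by
    rw [Ne, Set.ncard_eq_zero (D.fiber_finite 1)]
    exact Set.Nonempty.ne_empty ⟨1, map_one _⟩
  have hr := D.ncard_elementsOfNorm α
  have hg := D.ncard_elementsOfNorm 1
  rw [map_one] at hg
  change (normOne G).ncard = _ at hg
  rw [hr, hg]
  -- After cancelling $\#\mathcal H^1$, the four terms are $\sigma_{\mathfrak D}$, the two
  -- differences $\sigma_{\mathfrak D}-\sigma_{\mathfrak q_i\mathfrak D}$, and $\sigma_{\mathfrak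
  -- D}-\sigma_{\mathfrak q_1\mathfrak D}-\sigma_{\mathfrak q_2\mathfrak D}+\sigma_{\mathfrak
  -- q_1\mathfrak q_2\mathfrak D}$.
  apply mul_left_cancel₀ (Nat.cast_ne_zero.2 hh : ({x | (involution D.hH.1).N x = 1}.ncard : ℤ) ≠ 0)
  zify at key f₁ f₂ f₁₂
  linear_combination key + ({u | (involution D.hH.1).N u = 1 ∧ (u : QuatAlg K a b) ∈ G}.ncard : ℤ) * (f₁ + f₂ + f₁₂)

end Setting

end QuatRep

end

/-! ### The formula in terms of principal divisors -/

theorem mainTheorem8 {K : Type*} [Field K] [NumberField K] [NumberField.IsTotallyReal K]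
    (a b : K) (ha : a ≠ 0) (hb : b ≠ 0) (hdef : QuatRep.IsDefinite a b)
    (G H : Subalgebra (𝓞 K) (QuatRep.QuatAlg K a b))
    (hH : QuatRep.IsMaximalOrder H) (hG : QuatRep.IsQuatOrder G)
    (hperc : QuatRep.IsPerceptive G H) (hcls : QuatRep.classNumber G = 1)
    (k : ℕ) (𝔭 : Fin k → Ideal (𝓞 K)) (h𝔭 : ∀ i, Prime (𝔭 i))
    (𝔇 : Ideal (𝓞 K)) (h𝔇 : QuatRep.IsReducedDiscriminant H 𝔇) (hfac : 𝔇 = ∏ i, 𝔭 i)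
    (𝔮₁ 𝔮₂ : Ideal (𝓞 K)) (hkind : QuatRep.IsOfKindQQ G H 𝔇 𝔮₁ 𝔮₂)
    (α : 𝓞 K) (hα : QuatRep.TotallyPositive (α : K)) :
    (QuatRep.normOne G).Finite ∧
    (QuatRep.elementsOfNorm G (α : K)).Finite ∧
    (QuatRep.repCount G α : ℤ) =
      4 * (QuatRep.normOne G).ncard * QuatRep.divisorSum (Set.range 𝔭) α
      - 2 * (QuatRep.normOne G).ncard * QuatRep.divisorSum ({𝔮₁} ∪ Set.range 𝔭) α
      - 2 * (QuatRep.normOne G).ncard * QuatRep.divisorSum ({𝔮₂} ∪ Set.range 𝔭) α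
      + (QuatRep.normOne G).ncard * QuatRep.divisorSum ({𝔮₁, 𝔮₂} ∪ Set.range 𝔭) α ∧
    (QuatRep.repCount G α : ℤ) =
      4 * (QuatRep.normOne G).ncard * QuatRep.sigma 𝔇 α
      - 2 * (QuatRep.normOne G).ncard * QuatRep.sigma (𝔮₁ * 𝔇) α
      - 2 * (QuatRep.normOne G).ncard * QuatRep.sigma (𝔮₂ * 𝔇) α
      + (QuatRep.normOne G).ncard * QuatRep.sigma (𝔮₁ * 𝔮₂ * 𝔇) α := by
  have D : QuatRep.Setting G H 𝔇 𝔮₁ 𝔮₂ := ⟨hdef, hH, hG, hperc, hcls, h𝔇, hkind⟩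
  have h𝔇p : ∀ 𝔭', Prime 𝔭' → (𝔭' ∣ 𝔇 ↔ 𝔭' ∈ Set.range 𝔭) := by
    intro 𝔭' h'
    rw [hfac, h'.dvd_finsetProd_iff]
    constructor
    · rintro ⟨i, -, hi⟩
      exact ⟨i, (associated_iff_eq.1 (h'.associated_of_dvd (h𝔭 i) hi)).symm⟩
    · rintro ⟨i, rfl⟩
      exact ⟨i, Finset.mem_univ i, dvd_rfl⟩
  have hS : {𝔭' | Prime 𝔭' ∧ 𝔭' ∣ 𝔇} = Set.range 𝔭 := by
    ext 𝔭'
    refine ⟨fun h => (h𝔇p 𝔭' h.1).1 h.2, fun h => ?_⟩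
    have h' : Prime 𝔭' := by obtain ⟨i, rfl⟩ := h; exact h𝔭 i
    exact ⟨h', (h𝔇p 𝔭' h').2 h⟩
  have hprime : ∀ 𝔭' ∈ Set.range 𝔭, Prime 𝔭' := by rintro _ ⟨i, rfl⟩; exact h𝔭 i
  have hmul : ∀ {𝔮 : Ideal (𝓞 K)} {S : Set (Ideal (𝓞 K))} {I : Ideal (𝓞 K)}, Prime 𝔮 →
      (∀ 𝔭', Prime 𝔭' → (𝔭' ∣ I ↔ 𝔭' ∈ S)) →
      ∀ 𝔭', Prime 𝔭' → (𝔭' ∣ 𝔮 * I ↔ 𝔭' ∈ insert 𝔮 S) := by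
    intro 𝔮 S I h𝔮 hI 𝔭' h'
    rw [h'.dvd_mul, hI 𝔭' h', Set.mem_insert_iff, h'.dvd_prime_iff_associated h𝔮,
      associated_iff_eq]
  have hins : ∀ {𝔮 : Ideal (𝓞 K)} {S : Set (Ideal (𝓞 K))}, Prime 𝔮 → (∀ 𝔭' ∈ S, Prime 𝔭') →
      ∀ 𝔭' ∈ insert 𝔮 S, Prime 𝔭' := by
    rintro 𝔮 S h𝔮 hS 𝔭' (rfl | h)
    exacts [h𝔮, hS 𝔭' h]
  have hα0 := hα.ne_zero
  -- All nonzero ideals are principal, so the sums over principal divisors run over all divisors.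
  have hsum : ∀ S, QuatRep.divisorSum S α = QuatRep.idealDivisorSum S (Ideal.span {α}) := fun S =>
    QuatRep.divisorSum_eq_idealDivisorSum (fun I hI =>
      let ⟨c, _, hc⟩ := D.exists_totallyPositive_generator I hI
      ⟨c, hc⟩) hα0
  have main : (QuatRep.repCount G α : ℤ) =
      4 * (QuatRep.normOne G).ncard * QuatRep.divisorSum (Set.range 𝔭) α
      - 2 * (QuatRep.normOne G).ncard * QuatRep.divisorSum ({𝔮₁} ∪ Set.range 𝔭) α
      - 2 * (QuatRep.normOne G).ncard * QuatRep.divisorSum ({𝔮₂} ∪ Set.range 𝔭) α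
      + (QuatRep.normOne G).ncard * QuatRep.divisorSum ({𝔮₁, 𝔮₂} ∪ Set.range 𝔭) α := by
    have h := D.ncard_elementsOfNorm_eq hα
    rw [hS] at h
    simp only [hsum, Set.insert_union, Set.singleton_union]
    refine Eq.trans h ?_
    ring
  refine ⟨hdef.elementsOfNorm_finite hG _, hdef.elementsOfNorm_finite hG _, main, ?_⟩
  rw [main, mul_assoc 𝔮₁, QuatRep.sigma_eq_divisorSum h𝔇p hprime,
    QuatRep.sigma_eq_divisorSum (hmul hkind.prime₁ h𝔇p) (hins hkind.prime₁ hprime),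
    QuatRep.sigma_eq_divisorSum (hmul hkind.prime₂ h𝔇p) (hins hkind.prime₂ hprime),
    QuatRep.sigma_eq_divisorSum (hmul hkind.prime₁ (hmul hkind.prime₂ h𝔇p))
      (hins hkind.prime₁ (hins hkind.prime₂ hprime))]
  simp only [Set.insert_union, Set.singleton_union]
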